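/- Let $G=(A\cup B,E)$ be a finite bipartite graph with $m=|E|$ edges in which every vertex has a strict preference order over its neighbours. A matching $M$ is \emph{stable} if no edge $(a,b)\in E$ blocks it, i.e. there is no $(a,b)\in E$ such that each of $a,b$ is either unmatched in $M$ or strictly prefers the other one to its partner in $M$. A vertex prefers a matching $M$ to a matching $N$ if it is matched in $M$ and is either unmatched in $N$ or matched in $N$ to a neighbour that it ranks below its partner in $M$; let $\phi(M,N)$ be the number of vertices that prefer $M$ to $N$. A matching $M$ is \emph{popular} if $\phi(M,N)\ge\phi(N,M)$ for every matching $N$, and it is \emph{dominant} if it is popular and $\phi(M,N)>\phi(N,M)$ for every matching $N$ with $|N|>|M|$. \textbf{Theorem.} (1) Every such instance $G$ has an unstable popular matching if and only if it has an unstable dominant matching. (2) There is an algorithm that, given any such instance $G$ with $m$ edges, decides in $O(m^2)$ time whether every popular matching in $G$ is stable, and, if this is not the case, returns an unstable popular matching of $G$. Here the time is the number of steps of a random access machine with unit-cost instructions (assignment, increment, decrement, comparison, indirect load and store), the time bound is $C(m^2+1)$ with an absolute constant $C$, and the input consists of $|A|$, $|B|$, $m$ and the concatenated preference lists of the vertices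 of $A$ and of $B$, each entry being labelled with the vertex to whose list it belongs. -/

import Mathlib

/-- A marriage instance with strict preference lists: a finite bipartite graph `G = (A ∪ B, E)`
with `A = {0, …, nA - 1}` and `B = {0, …, nB - 1}`. Each vertex lists its neighbours without
repetition, most preferred first. Isolated vertices are allowed. -/
structure MarriageInstance where
  nA : ℕ
  nB : ℕ
  prefA : Fin nA → List (Fin nB)
  prefB : Fin nB → List (Fin nA)
  nodupA : ∀ a, (prefA a).Nodup
  nodupB : ∀ b, (prefB b).Nodup
  mem_iff : ∀ a b, b ∈ prefA a ↔ a ∈ prefB b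

namespace MarriageInstance

variable (G : MarriageInstance)

/-- The edge set. -/
def edges : Finset (Fin G.nA × Fin G.nB) :=
  Finset.univ.filter fun e => e.2 ∈ G.prefA e.1

/-- The number of edges. -/
def m : ℕ := G.edges.card

/-- `a` ranks its neighbour `b` above its neighbour `b'`. -/
def RanksA (a : Fin G.nA) (b b' : Fin G.nB) : Prop :=
  (G.prefA a).idxOf b < (G.prefA a).idxOf b'

/-- `b` ranks its neighbour `a` above its neighbour `a'`. -/
def RanksB (b : Fin G.nB) (a a' : Fin G.nA) : Prop :=
  (G.prefB b).idxOf a < (G.prefB b).idxOf a'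

instance (a : Fin G.nA) (b b' : Fin G.nB) : Decidable (G.RanksA a b b') :=
  inferInstanceAs (Decidable ((G.prefA a).idxOf b < (G.prefA a).idxOf b'))

instance (b : Fin G.nB) (a a' : Fin G.nA) : Decidable (G.RanksB b a a') :=
  inferInstanceAs (Decidable ((G.prefB b).idxOf a < (G.prefB b).idxOf a'))

/-- A matching: a set of edges, no two of which share an endpoint. -/
def IsMatching (M : Finset (Fin G.nA × Fin G.nB)) : Prop :=
  M ⊆ G.edges ∧ ∀ e ∈ M, ∀ f ∈ M, e.1 = f.1 ∨ e.2 = f.2 → e = f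

/-- The edge `(a, b)` blocks `M`: each endpoint is unmatched in `M` or ranks the other endpoint
above its partner in `M`. -/
def Blocks (M : Finset (Fin G.nA × Fin G.nB)) (a : Fin G.nA) (b : Fin G.nB) : Prop :=
  (a, b) ∈ G.edges ∧ (∀ e ∈ M, e.1 = a → G.RanksA a b e.2) ∧
    (∀ e ∈ M, e.2 = b → G.RanksB b a e.1)

/-- A stable matching: a matching without blocking edges. -/
def IsStable (M : Finset (Fin G.nA × Fin G.nB)) : Prop :=
  G.IsMatching M ∧ ∀ a b, ¬ G.Blocks M a b

/-- The vertex `a ∈ A` prefers `M` to `N`: it is matched in `M`, and it is unmatched in `N` or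
ranks its partner in `M` above its partner in `N`. -/
def PrefersA (M N : Finset (Fin G.nA × Fin G.nB)) (a : Fin G.nA) : Prop :=
  ∃ e ∈ M, e.1 = a ∧ ∀ f ∈ N, f.1 = a → G.RanksA a e.2 f.2

/-- The vertex `b ∈ B` prefers `M` to `N`. -/
def PrefersB (M N : Finset (Fin G.nA × Fin G.nB)) (b : Fin G.nB) : Prop :=
  ∃ e ∈ M, e.2 = b ∧ ∀ f ∈ N, f.2 = b → G.RanksB b e.1 f.1

instance (M N : Finset (Fin G.nA × Fin G.nB)) : DecidablePred (G.PrefersA M N) := fun a =>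
  inferInstanceAs (Decidable (∃ e ∈ M, e.1 = a ∧ ∀ f ∈ N, f.1 = a → G.RanksA a e.2 f.2))

instance (M N : Finset (Fin G.nA × Fin G.nB)) : DecidablePred (G.PrefersB M N) := fun b =>
  inferInstanceAs (Decidable (∃ e ∈ M, e.2 = b ∧ ∀ f ∈ N, f.2 = b → G.RanksB b e.1 f.1))

/-- `φ(M, N)`: the number of vertices that prefer `M` to `N`. -/
def votes (M N : Finset (Fin G.nA × Fin G.nB)) : ℕ :=
  (Finset.univ.filter (G.PrefersA M N)).card + (Finset.univ.filter (G.PrefersB M N)).card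

/-- A popular matching: it loses no head-to-head election against a matching. -/
def IsPopular (M : Finset (Fin G.nA × Fin G.nB)) : Prop :=
  G.IsMatching M ∧ ∀ N, G.IsMatching N → G.votes N M ≤ G.votes M N

/-- A dominant matching: a popular matching that defeats every larger matching. -/
def IsDominant (M : Finset (Fin G.nA × Fin G.nB)) : Prop :=
  G.IsPopular M ∧ ∀ N, G.IsMatching N → M.card < N.card → G.votes N M < G.votes M N

end MarriageInstance

/-! A random access machine in structured form. It has scalar registers, and arrays that are
accessed through the content of a register. All cells hold natural numbers. A program names only
finitely many registers and arrays. The only arithmetic is the successor and the predecessor, so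
that a run of `t` steps never holds a number that exceeds the largest number in the input and the
program by more than `t`. -/

namespace RAM

structure State where
  reg : ℕ → ℕ
  arr : ℕ → ℕ → ℕ

inductive Test where
  | lt (r s : ℕ)
  | le (r s : ℕ)
  | eq (r s : ℕ)
  | ne (r s : ℕ)

/-- The truth of a comparison of the contents of two registers. -/
def Test.Holds : Test → State → Prop
  | .lt r s, σ => σ.reg r < σ.reg s
  | .le r s, σ => σ.reg r ≤ σ.reg s
  | .eq r s, σ => σ.reg r = σ.reg s
  | .ne r s, σ => σ.reg r ≠ σ.reg s

/-- Elementary instructions. -/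
inductive Instr where
  | const (r c : ℕ)
  | copy (r s : ℕ)
  | succ (r : ℕ)
  | pred (r : ℕ)
  | load (r k i : ℕ)
  | store (k i s : ℕ)

/-- Put the value `v` in register `r`. -/
def State.setReg (σ : State) (r v : ℕ) : State :=
  { σ with reg := Function.update σ.reg r v }

/-- Put the value `v` in cell `i` of array `k`. -/
def State.setArr (σ : State) (k i v : ℕ) : State :=
  { σ with arr := Function.update σ.arr k (Function.update (σ.arr k) i v) }

/-- The effect of an elementary instruction. In `load` and `store` the address is the content of
register `i`. -/
def Instr.apply : Instr → State → State
  | .const r c, σ => σ.setReg r c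
  | .copy r s, σ => σ.setReg r (σ.reg s)
  | .succ r, σ => σ.setReg r (σ.reg r + 1)
  | .pred r, σ => σ.setReg r (σ.reg r - 1)
  | .load r k i, σ => σ.setReg r (σ.arr k (σ.reg i))
  | .store k i s, σ => σ.setArr k (σ.reg i) (σ.reg s)

inductive Program where
  | skip
  | instr (c : Instr)
  | seq (P Q : Program)
  | ite (b : Test) (P Q : Program)
  | while (b : Test) (P : Program)

/-- `Exec P σ t τ`: started in the state `σ`, the program `P` halts after exactly `t` steps in the
state `τ`. An elementary instruction takes one step, and so does each evaluation of a test. -/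
inductive Exec : Program → State → ℕ → State → Prop where
  | skip (σ : State) : Exec .skip σ 1 σ
  | instr (c : Instr) (σ : State) : Exec (.instr c) σ 1 (c.apply σ)
  | seq {P Q : Program} {σ τ υ : State} {s t : ℕ} :
      Exec P σ s τ → Exec Q τ t υ → Exec (.seq P Q) σ (s + t) υ
  | ite_true {b : Test} {P Q : Program} {σ τ : State} {t : ℕ} :
      b.Holds σ → Exec P σ t τ → Exec (.ite b P Q) σ (1 + t) τ
  | ite_false {b : Test} {P Q : Program} {σ τ : State} {t : ℕ} :
      ¬ b.Holds σ → Exec Q σ t τ → Exec (.ite b P Q) σ (1 + t) τ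
  | while_false {b : Test} {P : Program} {σ : State} :
      ¬ b.Holds σ → Exec (.while b P) σ 1 σ
  | while_true {b : Test} {P : Program} {σ τ υ : State} {s t : ℕ} :
      b.Holds σ → Exec P σ s τ → Exec (.while b P) τ t υ → Exec (.while b P) σ (1 + s + t) υ

/-- The machine is deterministic, so that the existence of a halting run within a number of steps
says that the program halts within this number of steps, with the result of that run. -/
theorem Exec.deterministic {P : Program} {σ τ τ' : State} {t t' : ℕ}
    (h : Exec P σ t τ) (h' : Exec P σ t' τ') : t = t' ∧ τ = τ' := by
  induction h generalizing t' τ' with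
  | skip => cases h'; simp
  | instr => cases h'; simp
  | seq _ _ ih₁ ih₂ =>
    cases h' with
    | seq k₁ k₂ =>
      obtain ⟨rfl, rfl⟩ := ih₁ k₁
      obtain ⟨rfl, rfl⟩ := ih₂ k₂
      simp
  | ite_true hb _ ih =>
    cases h' with
    | ite_true _ k => obtain ⟨rfl, rfl⟩ := ih k; simp
    | ite_false hn _ => exact absurd hb hn
  | ite_false hn _ ih =>
    cases h' with
    | ite_true hb _ => exact absurd hb hn
    | ite_false _ k => obtain ⟨rfl, rfl⟩ := ih k; simp
  | while_false hn =>
    cases h' with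
    | while_false _ => simp
    | while_true hb _ _ => exact absurd hb hn
  | while_true hb _ _ ih₁ ih₂ =>
    cases h' with
    | while_false hn => exact absurd hb hn
    | while_true _ k₁ k₂ =>
      obtain ⟨rfl, rfl⟩ := ih₁ k₁
      obtain ⟨rfl, rfl⟩ := ih₂ k₂
      simp

end RAM

namespace MarriageInstance

variable (G : MarriageInstance)

/-- The preference lists of the vertices `0, 1, …` of `A`, concatenated. Each entry carries the
vertex whose list it belongs to. -/
def entriesA : List (Fin G.nA × Fin G.nB) :=
  (List.finRange G.nA).flatMap fun a => (G.prefA a).map fun b => (a, b)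

/-- The preference lists of the vertices `0, 1, …` of `B`, concatenated. Each entry carries the
vertex whose list it belongs to. -/
def entriesB : List (Fin G.nB × Fin G.nA) :=
  (List.finRange G.nB).flatMap fun b => (G.prefB b).map fun a => (b, a)

/-- The initial state of the machine on input `G`. Registers `0, 1, 2` hold `|A|, |B|, m`. Arrays
`0, 1` hold the entries of the concatenated preference lists of `A` (owner and listed neighbour),
arrays `2, 3` those of `B`. Everything else is `0`. -/
def input : RAM.State where
  reg r :=
    match r with
    | 0 => G.nA
    | 1 => G.nB
    | 2 => G.m
    | _ => 0
  arr k i :=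
    match k with
    | 0 => (G.entriesA[i]?).elim 0 fun e => e.1.val
    | 1 => (G.entriesA[i]?).elim 0 fun e => e.2.val
    | 2 => (G.entriesB[i]?).elim 0 fun e => e.1.val
    | 3 => (G.entriesB[i]?).elim 0 fun e => e.2.val
    | _ => 0

/-- The machine returns the matching `M` in array `4`: the cell `a ∈ A` holds `b + 1` if
`(a, b) ∈ M`, and `0` if `a` is unmatched in `M`. -/
def Returns (σ : RAM.State) (M : Finset (Fin G.nA × Fin G.nB)) : Prop :=
  ∀ a : Fin G.nA, (∀ b : Fin G.nB, σ.arr 4 a = b + 1 ↔ (a, b) ∈ M) ∧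
    (σ.arr 4 a = 0 ↔ ∀ b : Fin G.nB, (a, b) ∉ M)

end MarriageInstance

/-! Replace every edge by two options, a low one and a high one. A man first goes through all his
low options in order of preference and then through all his high ones; a woman prefers every high
option to every low one and otherwise follows her list. Part (1) and the correctness of the
algorithm both reduce to stable sets of this market.

A stable set projects to a matching, and levels become vertex weights: `1` for a man on a low
option, `-1` on a high one, the opposite sign for women, `0` for unmatched vertices. Stability says
exactly enough to make these weights a dual certificate of popularity (`IsWitness`). At an edge
whose man is unmatched the certificate has slack, because such a man has even had his high option
refused. This slack yields dominance (`stable_isDominant`).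

Conversely, a popular matching has a witness with weights in `{-1, 0, 1}`
(`IsPopular.exists_isWitness`): a closed walk of positive weight among partner swaps would give a
matching that wins the election, and in the absence of such walks longest walks form a potential. A
blocking edge has weight at least `2`, so both ends have weight `1`: its man sits on a low option
and its woman on a high one. The matched edges of weight `0` have no forced level and the lifted
matching need not be stable, but `Market.exists_stable` repairs it by proposals while keeping every
edge of weight `±1`. The repaired stable set therefore still has the man on a low option worse than
the blocking edge and the woman on a high option worse than it, which is `Market.Good`. Such a set
projects to a dominant matching that the same edge blocks (`good_not_stable`). Hence an unstable
popular matching exists if and only if some edge has a good stable set, and part (1) follows.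

For part (2) fix an edge. The requirements on its man and woman are built into a truncated market
whose stable sets include all good ones. A man-optimal stable set there matches the same men and
women as every other stable set, is best for the men and worst for the women, so it is good as soon
as some stable set is (`good_of_trunc`). One run of deferred acceptance, linear in `m`, thus settles
one edge. Running over the `m` edges costs `O(m^2)`, as does building the tables by naive double
loops. Vertices are only touched through options, so `|A|` and `|B|` do not enter the time bound. -/

/-- A bipartite multigraph market. Its edges, called options, are the numbers below `K`. A man
prefers options with smaller index, a woman prefers options with smaller priority number. -/
structure Market where
  K : ℕ
  man : ℕ → ℕ
  woman : ℕ → ℕ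
  pr : ℕ → ℕ

/-! ### Stable sets in a market with parallel options. -/

namespace Market

/-- A set of options no two of which share a man or a woman. -/
def IsMatch (I : Market) (S : Finset ℕ) : Prop :=
  (∀ s ∈ S, s < I.K) ∧ ∀ s ∈ S, ∀ t ∈ S, I.man s = I.man t ∨ I.woman s = I.woman t → s = t

/-- The woman of `k` is matched in `S` by `k` or by a better option. -/
def WDom (I : Market) (S : Finset ℕ) (k : ℕ) : Prop :=
  ∃ s ∈ S, I.woman s = I.woman k ∧ I.pr s ≤ I.pr k

/-- The man of `k` is matched in `S` by `k` or by a better option. -/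
def MDom (I : Market) (S : Finset ℕ) (k : ℕ) : Prop :=
  ∃ s ∈ S, I.man s = I.man k ∧ s ≤ k

/-- A stable set of options. -/
def Stable (I : Market) (S : Finset ℕ) : Prop :=
  I.IsMatch S ∧ ∀ k < I.K, I.MDom S k ∨ I.WDom S k

/-- The preferences of the women are strict. -/
def Strict (I : Market) : Prop :=
  ∀ k < I.K, ∀ l < I.K, I.woman k = I.woman l → I.pr k = I.pr l → k = l

open Classical in
/-- A matching in which the better options of matched men are dominated by the women extends, by
letting unmatched men propose, to a stable one. -/
theorem exists_stable {I : Market} (hI : I.Strict) {H₀ F : Finset ℕ} (hM : I.IsMatch H₀)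
    (hq : ∀ h ∈ H₀, ∀ k < h, I.man k = I.man h → I.WDom H₀ k)
    (hFK : ∀ f ∈ F, f < I.K)
    (hF : ∀ f ∈ F, ∀ k < I.K, I.woman k = I.woman f → I.pr k < I.pr f →
      ∃ f' ∈ F, I.man f' = I.man k ∧ f' < k)
    (hF₀ : ∀ f ∈ F, ∀ h ∈ H₀, I.woman h = I.woman f → I.pr f ≤ I.pr h) :
    ∃ S, I.Stable S ∧ ∀ f ∈ F, f ∈ H₀ → f ∈ S := by
  -- Invariants of a proposal process started at `H₀`: men have used up their better options, women
  -- never fall below `H₀`, and no woman gets anything better than her option in `F`. Instead of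
  -- running the process, take a set satisfying them that maximises the number of options dominated
  -- by the women.
  let p : Finset ℕ → Prop := fun H => I.IsMatch H ∧
    (∀ h ∈ H, ∀ k < h, I.man k = I.man h → I.WDom H k) ∧ (∀ h ∈ H₀, I.WDom H h) ∧
    ∀ f ∈ F, ∀ h ∈ H, I.woman h = I.woman f → I.pr f ≤ I.pr h
  have hne : ((Finset.range I.K).powerset.filter p).Nonempty := by
    refine ⟨H₀, Finset.mem_filter.2 ⟨Finset.mem_powerset.2 fun s hs =>
      Finset.mem_range.2 (hM.1 s hs), hM, hq, fun h hh => ⟨h, hh, rfl, le_rfl⟩, hF₀⟩⟩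
  obtain ⟨S, hS, hmax⟩ := Finset.exists_max_image _
    (fun H => ((Finset.range I.K).filter (I.WDom H)).card) hne
  obtain ⟨-, hSM, hSq, hSH, hSF⟩ := Finset.mem_filter.1 hS
  have key : I.Stable S := by
    refine ⟨hSM, ?_⟩
    by_contra! hcon
    obtain ⟨k₀, hk₀, hm, hw⟩ := hcon
    -- A blocking option can only belong to an unmatched man, since the better options of a matched
    -- man are dominated.
    have hun : ∀ h ∈ S, I.man h ≠ I.man k₀ := by
      intro h hh he
      rcases le_or_gt h k₀ with hle | hlt
      · exact hm ⟨h, hh, he, hle⟩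
      · exact hw (hSq h hh k₀ hlt he.symm)
    have hex : ∃ k, k < I.K ∧ I.man k = I.man k₀ ∧ ¬ I.WDom S k := ⟨k₀, hk₀, rfl, hw⟩
    obtain ⟨hkK, hkm, hkw⟩ := Nat.find_spec hex
    have hmin := fun {j} => Nat.find_min hex (m := j)
    set k := Nat.find hex
    -- The unmatched man proposes his first undominated option `k`, and its woman drops whatever she
    -- held.
    let H := insert k (S.filter fun h => I.woman h ≠ I.woman k)
    have hmono : ∀ j, I.WDom S j → I.WDom H j := by
      rintro j ⟨s, hs, hsw, hsp⟩
      by_cases he : I.woman s = I.woman k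
      · refine ⟨k, by simp [H], he ▸ hsw, ?_⟩
        by_contra hlt
        exact hkw ⟨s, hs, he, by omega⟩
      · exact ⟨s, by simp [H, hs, he], hsw, hsp⟩
    have hp : p H := by
      refine ⟨⟨?_, ?_⟩, ?_, fun h hh => hmono _ (hSH h hh), ?_⟩
      · intro s hs
        rcases Finset.mem_insert.1 hs with rfl | hs
        · exact hkK
        · exact hSM.1 s (Finset.mem_filter.1 hs).1
      · intro s hs t ht hst
        rcases Finset.mem_insert.1 hs with rfl | hs <;> rcases Finset.mem_insert.1 ht with rfl | ht
        · rfl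
        · obtain ⟨ht, htw⟩ := Finset.mem_filter.1 ht
          rcases hst with h | h
          · exact absurd (h.symm.trans hkm) (hun t ht)
          · exact absurd h.symm htw
        · obtain ⟨hs, hsw⟩ := Finset.mem_filter.1 hs
          rcases hst with h | h
          · exact absurd (h.trans hkm) (hun s hs)
          · exact absurd h hsw
        · exact hSM.2 s (Finset.mem_filter.1 hs).1 t (Finset.mem_filter.1 ht).1 hst
      · intro h hh j hj hjm
        apply hmono
        rcases Finset.mem_insert.1 hh with rfl | hh
        · by_contra hc
          exact hmin hj ⟨hj.trans hkK, hjm.trans hkm, hc⟩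
        · exact hSq h (Finset.mem_filter.1 hh).1 j hj hjm
      · intro f hf h hh hw
        rcases Finset.mem_insert.1 hh with rfl | hh
        -- If `k` beat `f`, the man of `k` would have an earlier option `f'` in `F`. Its woman holds
        -- something at least as good by minimality of `k`, and nothing better than `f'` by the
        -- invariant. So she holds `f'`, and the man is not unmatched.
        · by_contra hlt
          obtain ⟨f', hf', hfm, hfk⟩ := hF f hf k hkK hw (by omega)
          have : I.WDom S f' := by
            by_contra hc
            exact hmin hfk ⟨hFK f' hf', hfm.trans hkm, hc⟩
          obtain ⟨s, hs, hsw, hsp⟩ := this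
          have := hI s (hSM.1 s hs) f' (hFK f' hf') hsw
            (le_antisymm hsp (hSF f' hf' s hs hsw))
          subst this
          exact hun s hs (hfm.trans hkm)
        · exact hSF f hf h (Finset.mem_filter.1 hh).1 hw
    have hle := hmax H (Finset.mem_filter.2 ⟨Finset.mem_powerset.2 fun s hs =>
      Finset.mem_range.2 (hp.1.1 s hs), hp⟩)
    refine absurd hle (not_le.2 (Finset.card_lt_card ?_))
    refine Finset.ssubset_iff_of_subset (fun j hj => ?_) |>.2 ⟨k, ?_, ?_⟩
    · obtain ⟨h1, h2⟩ := Finset.mem_filter.1 hj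
      exact Finset.mem_filter.2 ⟨h1, hmono j h2⟩
    · exact Finset.mem_filter.2 ⟨Finset.mem_range.2 hkK, k, by simp [H], rfl, le_rfl⟩
    · exact fun h => hkw (Finset.mem_filter.1 h).2
  -- Both sides pin `f`: its woman gets nothing better because `f` is in `F`, and its man gets
  -- nothing better because his earlier options were already refused in `H₀` and women only improve.
  refine ⟨S, key, fun f hf hf₀ => ?_⟩
  rcases key.2 f (hFK f hf) with ⟨s, hs, hsm, hsf⟩ | ⟨s, hs, hsw, hsp⟩
  · rcases hsf.eq_or_lt with rfl | hlt
    · exact hs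
    · obtain ⟨h, hh, hhw, hhp⟩ := hq f hf₀ s hlt hsm
      obtain ⟨s', hs', hsw', hsp'⟩ := hSH h hh
      have := hSM.2 s' hs' s hs (Or.inr (hsw'.trans hhw))
      subst this
      have := hI h (hM.1 h hh) s' (hSM.1 _ hs') hhw (le_antisymm hhp hsp')
      subst this
      rwa [hM.2 f hf₀ h hh (Or.inl hsm.symm)]
  · have := hI s (hSM.1 s hs) f (hFK f hf) hsw (le_antisymm hsp (hSF f hf s hs hsw))
    rwa [← this]

/-- `T` is at least as good as every stable set for every man. -/
def ManOptimal (I : Market) (T : Finset ℕ) : Prop :=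
  ∀ S, I.Stable S → ∀ s ∈ S, I.MDom T s

/-- Opposition of interests: if the woman of `t` did worse in `S`, stability of `S` would give her
man an option of `S` at least as good as `t`; optimality of `T` leaves only `t` itself. -/
theorem woman_le {I : Market} {S T : Finset ℕ} (hS : I.Stable S) (hT : I.Stable T)
    (ho : I.ManOptimal T) : ∀ t ∈ T, I.WDom S t := by
  intro t ht
  rcases hS.2 t (hT.1.1 t ht) with ⟨s, hs, hsm, hst⟩ | h
  · obtain ⟨t', ht', htm, hts⟩ := ho S hS s hs
    have := hT.1.2 t' ht' t ht (Or.inl (htm.trans hsm))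
    subst this
    have : s = t' := le_antisymm hst hts
    subst this
    exact ⟨s, hs, rfl, le_rfl⟩
  · exact h

/-- A man-optimal stable set matches the same men and women as any stable set. -/
theorem same_matched {I : Market} {S T : Finset ℕ} (hS : I.Stable S)
    (hT : I.Stable T) (ho : I.ManOptimal T) :
    (∀ s ∈ S, ∃ t ∈ T, I.woman t = I.woman s) ∧ (∀ t ∈ T, ∃ s ∈ S, I.man s = I.man t) := by
  -- `T` matches at least the men of `S` and at most its women; the numbers of matched men and women
  -- agree within each set, so both inclusions are equalities.
  have h1 : S.image I.man ⊆ T.image I.man := by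
    intro x hx
    obtain ⟨s, hs, rfl⟩ := Finset.mem_image.1 hx
    obtain ⟨t, ht, he, -⟩ := ho S hS s hs
    exact Finset.mem_image.2 ⟨t, ht, he⟩
  have h2 : T.image I.woman ⊆ S.image I.woman := by
    intro x hx
    obtain ⟨t, ht, rfl⟩ := Finset.mem_image.1 hx
    obtain ⟨s, hs, he, -⟩ := woman_le hS hT ho t ht
    exact Finset.mem_image.2 ⟨s, hs, he⟩
  have cm : ∀ {U}, I.Stable U → (U.image I.man).card = U.card := fun hU =>
    Finset.card_image_of_injOn fun s hs t ht h => hU.1.2 s hs t ht (Or.inl h)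
  have cw : ∀ {U}, I.Stable U → (U.image I.woman).card = U.card := fun hU =>
    Finset.card_image_of_injOn fun s hs t ht h => hU.1.2 s hs t ht (Or.inr h)
  have l1 := Finset.card_le_card h1
  have l2 := Finset.card_le_card h2
  rw [cm hS, cm hT] at l1
  rw [cw hS, cw hT] at l2
  have e1 := Finset.eq_of_subset_of_card_le h1 (by rw [cm hS, cm hT]; exact l2)
  have e2 := Finset.eq_of_subset_of_card_le h2 (by rw [cw hS, cw hT]; exact l1)
  constructor
  · intro s hs
    have : I.woman s ∈ T.image I.woman := e2 ▸ Finset.mem_image_of_mem _ hs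
    simpa using this
  · intro t ht
    have : I.man t ∈ S.image I.man := e1 ▸ Finset.mem_image_of_mem _ ht
    simpa using this

/-! ### Truncation -/

/-- The options of the man of `k₀` up to `k₀` become separate men, and `k₀` gets priority `m`. -/
def trunc (I : Market) (m k₀ : ℕ) : Market where
  K := I.K
  man k := if I.man k = I.man k₀ ∧ k ≤ k₀ then 2 * k + 1 else 2 * I.man k
  woman := I.woman
  pr k := if k = k₀ then m else I.pr k

/-- `S` matches the man of `k₀` below `k₀` at level `0`, and the woman of `k₀` at level `1` by an
option worse than `m + k₀`. -/
def Good (I : Market) (m k₀ : ℕ) (S : Finset ℕ) : Prop :=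
  (∀ t ∈ S, I.man t = I.man k₀ → k₀ < t ∧ t < m) ∧ (∃ t ∈ S, I.man t = I.man k₀) ∧
    ∃ t ∈ S, m ≤ t ∧ I.woman t = I.woman k₀ ∧ I.pr (m + k₀) < I.pr t

/-- The options from `m` on have priority better than `m`, the others worse. -/
def Leveled (I : Market) (m : ℕ) : Prop :=
  (∀ k < m, m < I.pr k) ∧ ∀ k < I.K, m ≤ k → I.pr k < m

/-- The value `m` lies in the gap between the two levels of priorities, so giving it to `k₀` creates
no tie. -/
theorem trunc_strict {I : Market} (hI : I.Strict) {m k₀ : ℕ} (hm : I.Leveled m) :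
    (I.trunc m k₀).Strict := by
  have hne : ∀ k < I.K, I.pr k ≠ m := by
    intro k hk
    rcases lt_or_ge k m with h | h
    · exact (hm.1 k h).ne'
    · exact (hm.2 k hk h).ne
  intro k hk l hl hw hp
  simp only [trunc] at *
  split_ifs at hp with h1 h2 h2
  · rw [h1, h2]
  · exact absurd hp.symm (hne l hl)
  · exact absurd hp (hne k hk)
  · exact hI k hk l hl hw hp

/-- Split-off men have odd codes and the others even ones, so an option that is not split off can
share its man only with another such option. -/
theorem trunc_man_eq {I : Market} {m k₀ s t : ℕ} (hs : I.man s = I.man k₀ → k₀ < s) :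
    (I.trunc m k₀).man s = (I.trunc m k₀).man t ↔
      I.man s = I.man t ∧ (I.man t = I.man k₀ → k₀ < t) := by
  have : ¬ (I.man s = I.man k₀ ∧ s ≤ k₀) := fun h => absurd (hs h.1) (by omega)
  simp only [trunc, if_neg this]
  split_ifs with h
  · constructor
    · intro; omega
    · intro h'; have := h'.2 h.1; omega
  · constructor
    · intro h'; exact ⟨by omega, fun h2 => by by_contra hc; exact h ⟨h2, by omega⟩⟩
    · intro h'; rw [h'.1]

/-- A good set uses no split-off man, so domination transfers back. Only `k₀` changes priority, and
its woman holds a high option, which beats `k₀` under either priority. -/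
theorem stable_of_trunc {I : Market} {m k₀ : ℕ} (hm : I.Leveled m) (hk : k₀ < m)
    {T : Finset ℕ} (hT : (I.trunc m k₀).Stable T) (hg : I.Good m k₀ T) : I.Stable T := by
  obtain ⟨g1, -, t₀, ht₀, htm, htw, -⟩ := hg
  have hgm : ∀ t ∈ T, I.man t = I.man k₀ → k₀ < t := fun t ht h => (g1 t ht h).1
  have hne : ∀ t ∈ T, t ≠ k₀ := by
    rintro t ht rfl
    exact absurd (hgm t ht rfl) (lt_irrefl _)
  refine ⟨⟨hT.1.1, fun s hs t ht hst => hT.1.2 s hs t ht ?_⟩, ?_⟩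
  · rcases hst with h | h
    · exact Or.inl ((trunc_man_eq (hgm s hs)).2 ⟨h, hgm t ht⟩)
    · exact Or.inr h
  · intro k hkK
    rcases hT.2 k hkK with ⟨s, hs, hsm, hsk⟩ | ⟨s, hs, hsw, hsp⟩
    · exact Or.inl ⟨s, hs, ((trunc_man_eq (hgm s hs)).1 hsm).1, hsk⟩
    · by_cases hkk : k = k₀
      · subst hkk
        refine Or.inr ⟨t₀, ht₀, htw, ?_⟩
        have := hm.1 k hk
        have := hm.2 t₀ (hT.1.1 t₀ ht₀) htm
        omega
      · refine Or.inr ⟨s, hs, hsw, ?_⟩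
        simpa [trunc, hne s hs, hkk] using hsp

/-- In a good set the man of `k₀` is matched after `k₀`, so his options up to `k₀` must be dominated
by the women. They remain so when their proposers become independent and stay unmatched; for `k₀` at
its new priority `m` a high option is required and present. -/
theorem trunc_stable {I : Market} {m k₀ : ℕ} (hm : I.Leveled m)
    {S : Finset ℕ} (hS : I.Stable S) (hg : I.Good m k₀ S) : (I.trunc m k₀).Stable S := by
  obtain ⟨g1, -, t₀, ht₀, htm, htw, -⟩ := hg
  have hgm : ∀ t ∈ S, I.man t = I.man k₀ → k₀ < t := fun t ht h => (g1 t ht h).1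
  have hne : ∀ t ∈ S, t ≠ k₀ := by
    rintro t ht rfl
    exact absurd (hgm t ht rfl) (lt_irrefl _)
  refine ⟨⟨hS.1.1, fun s hs t ht hst => hS.1.2 s hs t ht ?_⟩, ?_⟩
  · rcases hst with h | h
    · exact Or.inl ((trunc_man_eq (hgm s hs)).1 h).1
    · exact Or.inr h
  · intro k hkK
    by_cases hkk : k = k₀
    · subst hkk
      refine Or.inr ⟨t₀, ht₀, htw, ?_⟩
      have := hm.2 t₀ (hS.1.1 t₀ ht₀) htm
      simp [trunc, hne t₀ ht₀, this.le]
    rcases hS.2 k hkK with ⟨s, hs, hsm, hsk⟩ | ⟨s, hs, hsw, hsp⟩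
    · exact Or.inl ⟨s, hs, (trunc_man_eq (hgm s hs)).2
        ⟨hsm, fun h => (hgm s hs (hsm.trans h)).trans_le hsk⟩, hsk⟩
    · refine Or.inr ⟨s, hs, hsw, ?_⟩
      simpa [trunc, hne s hs, hkk] using hsp

/-- The same agents are matched in `T` as in the good set `S`. So the split-off men stay single, and
the man of `k₀` is matched after `k₀`, no later than in `S`. The woman of `k₀` is matched too, and
no better than in `S`. -/
theorem good_of_trunc {I : Market} (hI : I.Strict) {m k₀ : ℕ} (hm : I.Leveled m)
    (hk₀ : k₀ < I.K) {S T : Finset ℕ} (hS : I.Stable S) (hg : I.Good m k₀ S)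
    (hT : (I.trunc m k₀).Stable T) (ho : (I.trunc m k₀).ManOptimal T) : I.Good m k₀ T := by
  have hS' := trunc_stable hm hS hg
  have hI' := trunc_strict hI hm (k₀ := k₀)
  obtain ⟨g1, ⟨s₁, hs₁, hsm₁⟩, t₀, ht₀, htm, htw, htp⟩ := hg
  obtain ⟨hw, hmn⟩ := same_matched hS' hT ho
  have hgm : ∀ t ∈ S, I.man t = I.man k₀ → k₀ < t := fun t ht h => (g1 t ht h).1
  have hgT : ∀ t ∈ T, I.man t = I.man k₀ → k₀ < t := by
    intro t ht h
    obtain ⟨s, hs, hsm⟩ := hmn t ht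
    exact ((trunc_man_eq (hgm s hs)).1 hsm).2 h
  have hne : ∀ t ∈ T, t ≠ k₀ := by
    rintro t ht rfl
    exact absurd (hgT t ht rfl) (lt_irrefl _)
  have hneS : ∀ t ∈ S, t ≠ k₀ := by
    rintro t ht rfl
    exact absurd (hgm t ht rfl) (lt_irrefl _)
  obtain ⟨t₁, ht₁, htm₁, htle⟩ := ho S hS' s₁ hs₁
  have htm₁' := ((trunc_man_eq (hgT t₁ ht₁)).1 htm₁).1
  refine ⟨fun t ht h => ⟨hgT t ht h, ?_⟩, ⟨t₁, ht₁, htm₁'.trans hsm₁⟩, ?_⟩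
  · have : t = t₁ := hT.1.2 t ht t₁ ht₁ (Or.inl
      ((trunc_man_eq (hgT t ht)).2 ⟨h.trans (htm₁'.trans hsm₁).symm, hgT t₁ ht₁⟩))
    have := (g1 s₁ hs₁ hsm₁).2
    omega
  · obtain ⟨t, ht, htw'⟩ := hw t₀ ht₀
    have htw' : I.woman t = I.woman k₀ := htw'.trans htw
    refine ⟨t, ht, ?_, htw', ?_⟩
    -- The split-off man of `k₀` is single in `T`, so stability forces his woman to hold something
    -- of priority at most `m`. Other than `k₀` itself, only high options qualify.
    · rcases hT.2 k₀ hk₀ with ⟨u, hu, hum, -⟩ | ⟨u, hu, huw, hup⟩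
      · exact absurd (((trunc_man_eq (hgT u hu)).1 hum).2 rfl) (lt_irrefl _)
      · have : u = t := hT.1.2 u hu t ht (Or.inr (huw.trans htw'.symm))
        subst this
        simp only [trunc, if_neg (hne u hu), if_true] at hup
        by_contra hc
        have := hm.1 u (by omega)
        omega
    · obtain ⟨s, hs, hsw, hsp⟩ := woman_le hS' hT ho t ht
      have : s = t₀ := hS.1.2 s hs t₀ ht₀ (Or.inr (hsw.trans (htw'.trans htw.symm)))
      subst this
      simp only [trunc, if_neg (hne t ht), if_neg (hneS s hs)] at hsp
      omega

/-! ### Deferred acceptance -/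

/-- The state of deferred acceptance: `hold w` is `k + 1` if the woman `w` holds the option `k`,
`cur` is `k + 1` if the option `k` is to be proposed next, men whose first option is below `pos`
have started. -/
structure DA where
  hold : ℕ → ℕ
  cur : ℕ
  pos : ℕ

/-- One step of deferred acceptance, driven by a table of successors and a table of starts. -/
def daStep (I : Market) (nxt start : ℕ → ℕ) (d : DA) : DA :=
  if d.cur = 0 then
    if d.pos < I.K then
      { d with cur := if start d.pos ≠ 0 then d.pos + 1 else d.cur, pos := d.pos + 1 }
    else d
  else
    if d.hold (I.woman (d.cur - 1)) = 0 then
      { d with hold := Function.update d.hold (I.woman (d.cur - 1)) d.cur, cur := 0 }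
    else if I.pr (d.cur - 1) < I.pr (d.hold (I.woman (d.cur - 1)) - 1) then
      { d with
        hold := Function.update d.hold (I.woman (d.cur - 1)) d.cur
        cur := nxt (d.hold (I.woman (d.cur - 1)) - 1) }
    else { d with cur := nxt (d.cur - 1) }

/-- `nxt k` is `l + 1` if `l` is the next option of the man of `k`, and `0` if there is none. -/
def NextSpec (I : Market) (nxt : ℕ → ℕ) : Prop :=
  ∀ k < I.K, (nxt k = 0 ∧ ∀ l, k < l → l < I.K → I.man l ≠ I.man k) ∨
    ∃ l, nxt k = l + 1 ∧ k < l ∧ l < I.K ∧ I.man l = I.man k ∧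
      ∀ j, k < j → j < l → I.man j ≠ I.man k

/-- `start k ≠ 0` if `k` is the first option of its man. -/
def StartSpec (I : Market) (start : ℕ → ℕ) : Prop :=
  ∀ k < I.K, start k ≠ 0 ↔ ∀ j < k, I.man j ≠ I.man k

/-- The invariant of deferred acceptance; `P` is the set of options that have been proposed. -/
structure DAInv (I : Market) (start : ℕ → ℕ) (d : DA) (P : Finset ℕ) : Prop where
  hold_woman : ∀ k < I.K, ∀ j, d.hold (I.woman k) = j + 1 → j < I.K ∧ I.woman j = I.woman k
  sub : ∀ k ∈ P, k < I.K
  held : ∀ k < I.K, d.hold (I.woman k) = k + 1 → k ∈ P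
  dom : ∀ k ∈ P, ∃ h, d.hold (I.woman k) = h + 1 ∧ I.pr h ≤ I.pr k
  -- Men propose in order and move on only after a refusal.
  down : ∀ k ∈ P, ∀ j < k, I.man j = I.man k → j ∈ P ∧ d.hold (I.woman j) ≠ j + 1
  cur : ∀ k, d.cur = k + 1 → k < I.K ∧ k ∉ P ∧
    ∀ j < k, I.man j = I.man k → j ∈ P ∧ d.hold (I.woman j) ≠ j + 1
  -- The man of an option not yet proposed is about to propose, is held by some woman, or has not
  -- begun. Once the process has ended only the second case remains.
  rest : ∀ k < I.K, k ∉ P → (∃ j, d.cur = j + 1 ∧ I.man j = I.man k) ∨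
    (∃ h < I.K, d.hold (I.woman h) = h + 1 ∧ I.man h = I.man k) ∨
    ∃ j, d.pos ≤ j ∧ j ≤ k ∧ I.man j = I.man k ∧ start j ≠ 0
  fresh : ∀ k < I.K, d.pos ≤ k → start k ≠ 0 → k ∉ P ∧ d.cur ≠ k + 1
  -- A refused option lies in no stable set; this is the source of man-optimality.
  opt : ∀ S, I.Stable S → ∀ k ∈ P, d.hold (I.woman k) ≠ k + 1 → k ∉ S

theorem DAInv.init {I : Market} {start : ℕ → ℕ} (hs : I.StartSpec start) {hold : ℕ → ℕ}
    (h0 : ∀ k < I.K, hold (I.woman k) = 0) : I.DAInv start ⟨hold, 0, 0⟩ ∅ where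
  hold_woman k hk j h := by simp [h0 k hk] at h
  sub := by simp
  held k hk h := by simp [h0 k hk] at h
  dom := by simp
  down := by simp
  cur := by simp
  rest k hk _ := by
    classical
    have hex : ∃ j, I.man j = I.man k := ⟨k, rfl⟩
    have hle := Nat.find_min' hex rfl
    refine Or.inr (Or.inr ⟨Nat.find hex, Nat.zero_le _, hle, Nat.find_spec hex, ?_⟩)
    refine (hs _ (hle.trans_lt hk)).2 fun j hj => ?_
    rw [Nat.find_spec hex]
    exact Nat.find_min hex hj
  fresh := by simp
  opt := by simp

/-- A free woman accepts; nobody is refused, so the content of `opt` is unaffected. -/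
theorem DAInv.settle {I : Market} {start : ℕ → ℕ} {d : DA}
    {P : Finset ℕ} (hd : I.DAInv start d P) {k : ℕ} (hk : d.cur = k + 1)
    (hw : d.hold (I.woman k) = 0) :
    I.DAInv start ⟨Function.update d.hold (I.woman k) (k + 1), 0, d.pos⟩ (insert k P) := by
  obtain ⟨hkK, hkP, hkd⟩ := hd.cur k hk
  have old : ∀ x, Function.update d.hold (I.woman k) (k + 1) (I.woman x) = x + 1 → x ≠ k →
      d.hold (I.woman x) = x + 1 := by
    intro x hx hxk
    by_cases hxw : I.woman x = I.woman k
    · simp [hxw] at hx; omega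
    · simpa [Function.update_of_ne hxw] using hx
  have new : ∀ x, d.hold (I.woman x) = x + 1 →
      Function.update d.hold (I.woman k) (k + 1) (I.woman x) = x + 1 := by
    intro x hx
    by_cases hxw : I.woman x = I.woman k
    · rw [hxw] at hx; omega
    · simpa [Function.update_of_ne hxw] using hx
  constructor
  · intro x hx j hj
    by_cases hxw : I.woman x = I.woman k
    · simp [hxw] at hj
      subst hj
      exact ⟨hkK, hxw.symm⟩
    · exact hd.hold_woman x hx j (by simpa [Function.update_of_ne hxw] using hj)
  · intro x hx
    rcases Finset.mem_insert.1 hx with rfl | hx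
    exacts [hkK, hd.sub x hx]
  · intro x hx hj
    by_cases hxk : x = k
    · simp [hxk]
    · exact Finset.mem_insert_of_mem (hd.held x hx (old x hj hxk))
  · intro x hx
    by_cases hxw : I.woman x = I.woman k
    · rcases Finset.mem_insert.1 hx with rfl | hx
      · exact ⟨x, by simp, le_rfl⟩
      · obtain ⟨h, hh, -⟩ := hd.dom x hx
        rw [hxw] at hh; omega
    · rcases Finset.mem_insert.1 hx with rfl | hx
      · exact absurd rfl hxw
      · simpa [Function.update_of_ne hxw] using hd.dom x hx
  · intro x hx j hj hjm
    have : j ∈ P ∧ d.hold (I.woman j) ≠ j + 1 := by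
      rcases Finset.mem_insert.1 hx with rfl | hx
      exacts [hkd j hj hjm, hd.down x hx j hj hjm]
    refine ⟨Finset.mem_insert_of_mem this.1, fun h => this.2 (old j h ?_)⟩
    rintro rfl; exact hkP this.1
  · simp
  · intro x hx hxP
    rw [Finset.mem_insert, not_or] at hxP
    rcases hd.rest x hx hxP.2 with ⟨j, hj, hjm⟩ | ⟨h, hh, hhh, hhm⟩ | h
    · obtain rfl : k = j := by omega
      exact Or.inr (Or.inl ⟨k, hkK, by simp, hjm⟩)
    · exact Or.inr (Or.inl ⟨h, hh, new h hhh, hhm⟩)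
    · exact Or.inr (Or.inr h)
  · intro x hx hp hs
    obtain ⟨h1, h2⟩ := hd.fresh x hx hp hs
    refine ⟨?_, by simp⟩
    rw [Finset.mem_insert, not_or]
    exact ⟨by rintro rfl; exact h2 hk, h1⟩
  · intro S hS x hx hh
    rcases Finset.mem_insert.1 hx with rfl | hx
    · simp at hh
    · exact hd.opt S hS x hx fun h => hh (new x h)

/-- The two outcomes of a contested proposal are treated together: of the proposal `k` and the held
option `h`, the woman keeps `v` and refuses `r`, and the man of `r` continues. -/
theorem DAInv.reject {I : Market} {nxt start : ℕ → ℕ} (hn : I.NextSpec nxt)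
    (hs : I.StartSpec start) {d : DA} {P : Finset ℕ} (hd : I.DAInv start d P) {k h v r : ℕ}
    (hk : d.cur = k + 1) (hw : d.hold (I.woman k) = h + 1)
    (hvr : (v = k ∧ r = h) ∨ (v = h ∧ r = k)) (hlt : I.pr v ≤ I.pr r) (hne : I.Strict) :
    I.DAInv start ⟨Function.update d.hold (I.woman k) (v + 1), nxt r, d.pos⟩ (insert k P) := by
  obtain ⟨hkK, hkP, hkd⟩ := hd.cur k hk
  obtain ⟨hhK, hhw⟩ := hd.hold_woman k hkK h hw
  have hhh : d.hold (I.woman h) = h + 1 := by rw [hhw, hw]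
  have hhP : h ∈ P := hd.held h hhK hhh
  have hkh : k ≠ h := by rintro rfl; exact hkP hhP
  have hvr' : v ≠ r := by omega
  have hvw : I.woman v = I.woman k := by rcases hvr with ⟨rfl, -⟩ | ⟨rfl, -⟩ <;> simp [hhw]
  have hrw : I.woman r = I.woman k := by rcases hvr with ⟨-, rfl⟩ | ⟨-, rfl⟩ <;> simp [hhw]
  have hvK : v < I.K := by rcases hvr with ⟨rfl, -⟩ | ⟨rfl, -⟩ <;> assumption
  have hrK : r < I.K := by rcases hvr with ⟨-, rfl⟩ | ⟨-, rfl⟩ <;> assumption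
  have hrP : r ∈ insert k P := by rcases hvr with ⟨-, rfl⟩ | ⟨-, rfl⟩ <;> simp [hhP]
  have hlt' : I.pr v < I.pr r := lt_of_le_of_ne hlt fun he =>
    hvr' (hne v hvK r hrK (hvw.trans hrw.symm) he)
  have old : ∀ x ∈ P, Function.update d.hold (I.woman k) (v + 1) (I.woman x) = x + 1 →
      d.hold (I.woman x) = x + 1 := by
    intro x hxP hx
    by_cases hxw : I.woman x = I.woman k
    · simp [hxw] at hx
      subst hx
      rcases hvr with ⟨rfl, -⟩ | ⟨rfl, -⟩
      · exact absurd hxP hkP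
      · exact hhh
    · simpa [Function.update_of_ne hxw] using hx
  have new : ∀ x, d.hold (I.woman x) = x + 1 → x ≠ r →
      Function.update d.hold (I.woman k) (v + 1) (I.woman x) = x + 1 := by
    intro x hx hxr
    by_cases hxw : I.woman x = I.woman k
    · rw [hxw] at hx
      have : x = v := by omega
      rw [hxw, Function.update_self, this]
    · simpa [Function.update_of_ne hxw] using hx
  have below : ∀ x, (x = k ∨ x ∈ P) → ∀ j < x, I.man j = I.man x →
      j ∈ P ∧ d.hold (I.woman j) ≠ j + 1 := by
    rintro x (rfl | hx) j hj hjm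
    exacts [hkd j hj hjm, hd.down x hx j hj hjm]
  -- A stable set containing `r` leaves the woman worse off than with `v`, so the man of `v` must
  -- have an option better than `v` in it. That option was already refused, contrary to `opt`.
  have rejected : ∀ S, I.Stable S → r ∉ S := by
    intro S hS hrS
    rcases hS.2 v hvK with ⟨s, hs, hsm, hsv⟩ | ⟨s, hs, hsw, hsp⟩
    · rcases hsv.eq_or_lt with rfl | hsv
      · exact hvr' (hS.1.2 s hs r hrS (Or.inr (hvw.trans hrw.symm)))
      · obtain ⟨h1, h2⟩ := below v (by rcases hvr with ⟨rfl, -⟩ | ⟨rfl, -⟩ <;> simp [hhP])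
          s hsv hsm
        exact hd.opt S hS s h1 h2 hs
    · have := hS.1.2 s hs r hrS (Or.inr (hsw.trans (hvw.trans hrw.symm)))
      subst this
      omega
  have next : ∀ x < I.K, x ∉ P → x ≠ k → I.man x = I.man r →
      ∃ j, nxt r = j + 1 ∧ I.man j = I.man x := by
    intro x hx hxP hxk hxm
    rcases hn r hrK with ⟨-, h0⟩ | ⟨l, hl, -, -, hlm, -⟩
    · exfalso
      rcases lt_trichotomy x r with hxr | rfl | hxr
      · exact hxP (below r (by rcases hvr with ⟨-, rfl⟩ | ⟨-, rfl⟩ <;> simp [hhP]) x hxr hxm).1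
      · rcases Finset.mem_insert.1 hrP with h | h
        exacts [hxk h, hxP h]
      · exact h0 x hxr hx hxm
    · exact ⟨l, hl, hlm.trans hxm.symm⟩
  constructor
  · intro x hx j hj
    by_cases hxw : I.woman x = I.woman k
    · simp [hxw] at hj
      subst hj
      exact ⟨hvK, hvw.trans hxw.symm⟩
    · exact hd.hold_woman x hx j (by simpa [Function.update_of_ne hxw] using hj)
  · intro x hx
    rcases Finset.mem_insert.1 hx with rfl | hx
    exacts [hkK, hd.sub x hx]
  · intro x hx hj
    by_cases hxw : I.woman x = I.woman k
    · simp [hxw] at hj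
      subst hj
      rcases hvr with ⟨rfl, -⟩ | ⟨rfl, -⟩ <;> simp [hhP]
    · exact Finset.mem_insert_of_mem
        (hd.held x hx (by simpa [Function.update_of_ne hxw] using hj))
  · intro x hx
    by_cases hxw : I.woman x = I.woman k
    · refine ⟨v, by simp [hxw], ?_⟩
      rcases Finset.mem_insert.1 hx with rfl | hx
      · rcases hvr with ⟨rfl, -⟩ | ⟨rfl, rfl⟩
        exacts [le_rfl, hlt]
      · obtain ⟨g, hg, hgp⟩ := hd.dom x hx
        have : g = h := by rw [hxw] at hg; omega
        subst this
        rcases hvr with ⟨rfl, rfl⟩ | ⟨rfl, rfl⟩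
        exacts [hlt.trans hgp, hgp]
    · rcases Finset.mem_insert.1 hx with rfl | hx
      · exact absurd rfl hxw
      · simpa [Function.update_of_ne hxw] using hd.dom x hx
  · intro x hx j hj hjm
    obtain ⟨h1, h2⟩ := below x (Finset.mem_insert.1 hx) j hj hjm
    exact ⟨Finset.mem_insert_of_mem h1, fun h => h2 (old j h1 h)⟩
  · intro l hl
    rcases hn r hrK with ⟨h0, -⟩ | ⟨l', hl', hrl, hlK, hlm, hmid⟩
    · simp only at hl; omega
    simp only at hl
    obtain rfl : l' = l := by omega
    have hlP : l' ∉ P ∧ l' ≠ k := by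
      constructor
      · intro hP
        obtain ⟨h1, h2⟩ := hd.down l' hP r hrl hlm.symm
        rcases hvr with ⟨-, rfl⟩ | ⟨-, rfl⟩
        exacts [h2 hhh, hkP h1]
      · rintro rfl
        rcases hvr with ⟨-, rfl⟩ | ⟨-, rfl⟩
        · exact (hkd r hrl hlm.symm).2 hhh
        · exact lt_irrefl _ hrl
    refine ⟨hlK, by simp [hlP], fun j hj hjm => ?_⟩
    rcases lt_trichotomy j r with hjr | rfl | hjr
    · obtain ⟨h1, h2⟩ := below r (Finset.mem_insert.1 hrP) j hjr (hjm.trans hlm)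
      exact ⟨Finset.mem_insert_of_mem h1, fun h => h2 (old j h1 h)⟩
    · exact ⟨hrP, by simp [hrw]; exact hvr'⟩
    · exact absurd (hjm.trans hlm) (hmid j hjr hj)
  · intro x hx hxP
    rw [Finset.mem_insert, not_or] at hxP
    rcases hd.rest x hx hxP.2 with ⟨j, hj, hjm⟩ | ⟨g, hg, hgh, hgm⟩ | h
    · obtain rfl : k = j := by omega
      rcases hvr with ⟨rfl, rfl⟩ | ⟨rfl, rfl⟩
      · exact Or.inr (Or.inl ⟨v, hkK, by simp, hjm⟩)
      · exact Or.inl (next x hx hxP.2 hxP.1 hjm.symm)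
    · by_cases hgr : g = r
      · subst hgr
        exact Or.inl (next x hx hxP.2 hxP.1 hgm.symm)
      · exact Or.inr (Or.inl ⟨g, hg, new g hgh hgr, hgm⟩)
    · exact Or.inr (Or.inr h)
  · intro x hx hp hst
    obtain ⟨h1, h2⟩ := hd.fresh x hx hp hst
    refine ⟨?_, ?_⟩
    · rw [Finset.mem_insert, not_or]
      exact ⟨by rintro rfl; exact h2 hk, h1⟩
    · intro hx'
      rcases hn r hrK with ⟨h0, -⟩ | ⟨l, hl, hrl, -, hlm, -⟩
      · simp only at hx'; omega
      · simp only at hx'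
        obtain rfl : l = x := by omega
        exact (hs l hx).1 hst r hrl hlm.symm
  · intro S hS x hx hh
    by_cases hxr : x = r
    · rw [hxr]; exact rejected S hS
    rcases Finset.mem_insert.1 hx with rfl | hx
    · rcases hvr with ⟨rfl, -⟩ | ⟨-, rfl⟩
      · simp at hh
      · exact absurd rfl hxr
    · exact hd.opt S hS x hx fun h => hh (new x h hxr)

theorem DAInv.begin {I : Market} {start : ℕ → ℕ}
    (hs : I.StartSpec start) {d : DA} {P : Finset ℕ} (hd : I.DAInv start d P)
    (hc : d.cur = 0) (hp : d.pos < I.K) :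
    I.DAInv start ⟨d.hold, if start d.pos ≠ 0 then d.pos + 1 else d.cur, d.pos + 1⟩ P := by
  refine ⟨hd.hold_woman, hd.sub, hd.held, hd.dom, hd.down, ?_, ?_, ?_, hd.opt⟩
  · intro k hk
    split_ifs at hk with h
    · obtain rfl : d.pos = k := by simpa using hk
      exact ⟨hp, (hd.fresh _ hp le_rfl h).1, fun j hj hjm => absurd hjm ((hs _ hp).1 h j hj)⟩
    · exact absurd (hc.symm.trans hk) (by omega)
  · intro k hk hkP
    rcases hd.rest k hk hkP with ⟨j, hj, -⟩ | h | ⟨j, hj, hjk, hjm, hjs⟩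
    · omega
    · exact Or.inr (Or.inl h)
    · rcases hj.eq_or_lt with rfl | hj
      · exact Or.inl ⟨d.pos, by simp [hjs], hjm⟩
      · exact Or.inr (Or.inr ⟨j, hj, hjk, hjm, hjs⟩)
  · intro k hk hpk hst
    refine ⟨(hd.fresh k hk (by simp only at hpk; omega) hst).1, ?_⟩
    simp only at hpk ⊢
    split_ifs <;> omega

/-- The progress measure is `pos` plus the number of proposals made. Both terms are at most `K`,
which is why `2 * K` steps suffice. -/
theorem DAInv.step {I : Market} (hI : I.Strict) {nxt start : ℕ → ℕ} (hn : I.NextSpec nxt)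
    (hs : I.StartSpec start) {d : DA} {P : Finset ℕ} (hd : I.DAInv start d P) (hp : d.pos ≤ I.K) :
    ∃ P', I.DAInv start (I.daStep nxt start d) P' ∧ (I.daStep nxt start d).pos ≤ I.K ∧
      ((d.cur = 0 ∧ d.pos = I.K ∧ I.daStep nxt start d = d) ∨
        d.pos + P.card < (I.daStep nxt start d).pos + P'.card) := by
  obtain ⟨hold, cur, pos⟩ := d
  rcases cur with _ | k
  · by_cases h2 : pos < I.K
    · refine ⟨P, by simpa [daStep, h2] using hd.begin hs rfl h2, by simp [daStep, h2],
        Or.inr ?_⟩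
      simp [daStep, h2]
    · refine ⟨P, by simpa [daStep, h2] using hd, by simpa [daStep, h2] using hp, Or.inl ?_⟩
      simp only [daStep, if_true, if_neg h2, true_and, and_true]
      simp only at hp
      omega
  · have hkP := (hd.cur k rfl).2.1
    refine ⟨insert k P, ?_⟩
    rw [Finset.card_insert_of_notMem hkP]
    have hr := fun {h v r} => hd.reject hn hs (k := k) (h := h) (v := v) (r := r) rfl
    rcases hh : hold (I.woman k) with _ | h
    · exact ⟨by simpa [daStep, hh] using hd.settle rfl hh, by simpa [daStep, hh] using hp,
        Or.inr (by simp [daStep, hh])⟩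
    · by_cases hlt : I.pr k < I.pr h
      · exact ⟨by simpa [daStep, hh, hlt] using hr hh (Or.inl ⟨rfl, rfl⟩) hlt.le hI,
          by simpa [daStep, hh, hlt] using hp, Or.inr (by simp [daStep, hh, hlt])⟩
      · refine ⟨?_, by simpa [daStep, hh, hlt] using hp, Or.inr (by simp [daStep, hh, hlt])⟩
        have := hr hh (Or.inr ⟨rfl, rfl⟩) (not_lt.1 hlt) hI
        rw [← hh, Function.update_eq_self] at this
        simpa [daStep, hh, hlt] using this

/-- The options held in a state. -/
def DA.matching (I : Market) (hold : ℕ → ℕ) : Finset ℕ :=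
  (Finset.range I.K).filter fun k => hold (I.woman k) = k + 1

/-- Deferred acceptance ends with a man-optimal stable set after `2 * K` steps. -/
theorem da_spec {I : Market} (hI : I.Strict) {nxt start : ℕ → ℕ} (hn : I.NextSpec nxt)
    (hs : I.StartSpec start) {hold : ℕ → ℕ} (h0 : ∀ k < I.K, hold (I.woman k) = 0) :
    I.Stable (DA.matching I ((I.daStep nxt start)^[2 * I.K] ⟨hold, 0, 0⟩).hold) ∧
      I.ManOptimal (DA.matching I ((I.daStep nxt start)^[2 * I.K] ⟨hold, 0, 0⟩).hold) := by
  have run : ∀ n, ∃ P, I.DAInv start ((I.daStep nxt start)^[n] ⟨hold, 0, 0⟩) P ∧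
      ((I.daStep nxt start)^[n] ⟨hold, 0, 0⟩).pos ≤ I.K ∧
      ((((I.daStep nxt start)^[n] ⟨hold, 0, 0⟩).cur = 0 ∧
        ((I.daStep nxt start)^[n] ⟨hold, 0, 0⟩).pos = I.K) ∨
        n ≤ ((I.daStep nxt start)^[n] ⟨hold, 0, 0⟩).pos + P.card) := by
    intro n
    induction n with
    | zero => exact ⟨∅, DAInv.init hs h0, Nat.zero_le _, Or.inr (Nat.zero_le _)⟩
    | succ n ih =>
      obtain ⟨P, hd, hp, hprog⟩ := ih
      rw [Function.iterate_succ_apply']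
      obtain ⟨P', hd', hp', h⟩ := hd.step hI hn hs hp
      refine ⟨P', hd', hp', ?_⟩
      rcases h with ⟨h1, h2, h3⟩ | h
      · exact Or.inl (by rw [h3]; exact ⟨h1, h2⟩)
      · rcases hprog with ⟨h1, h2⟩ | hprog
        · generalize (I.daStep nxt start)^[n] ⟨hold, 0, 0⟩ = d at *
          left
          simp [daStep, h1, h2]
        · right; omega
  obtain ⟨P, hd, hp, hfin⟩ := run (2 * I.K)
  generalize (I.daStep nxt start)^[2 * I.K] ⟨hold, 0, 0⟩ = d at *
  have hPsub : P ⊆ Finset.range I.K := fun k hk => Finset.mem_range.2 (hd.sub k hk)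
  have hcard := Finset.card_le_card hPsub
  rw [Finset.card_range] at hcard
  have hcp : d.cur = 0 ∧ d.pos = I.K := by
    rcases hfin with h | h
    · exact h
    -- At the maximal value `2 * K` of the measure every option has been proposed, so none can be
    -- pending.
    · refine ⟨?_, by omega⟩
      by_contra hc
      obtain ⟨k, hk⟩ := Nat.exists_eq_succ_of_ne_zero hc
      obtain ⟨h1, h2, -⟩ := hd.cur k hk
      have := Finset.eq_of_subset_of_card_le hPsub (by rw [Finset.card_range]; omega)
      exact h2 (this ▸ Finset.mem_range.2 h1)
  have mem : ∀ k, k ∈ DA.matching I d.hold ↔ k < I.K ∧ d.hold (I.woman k) = k + 1 := by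
    simp [DA.matching]
  have rest : ∀ k < I.K, k ∉ P → ∃ h ∈ DA.matching I d.hold, I.man h = I.man k ∧ h ≤ k := by
    intro k hk hkP
    rcases hd.rest k hk hkP with ⟨j, hj, -⟩ | ⟨h, hh, hhh, hhm⟩ | ⟨j, hj, hjk, -⟩
    · omega
    · refine ⟨h, (mem h).2 ⟨hh, hhh⟩, hhm, ?_⟩
      by_contra hlt
      exact hkP (hd.down h (hd.held h hh hhh) k (by omega) hhm.symm).1
    · omega
  refine ⟨⟨⟨fun s hs => ((mem s).1 hs).1, ?_⟩, ?_⟩, ?_⟩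
  · intro s hs t ht hst
    obtain ⟨hs, hsh⟩ := (mem s).1 hs
    obtain ⟨ht, hth⟩ := (mem t).1 ht
    rcases hst with h | h
    · rcases lt_trichotomy s t with hl | hl | hl
      · exact absurd hsh (hd.down t (hd.held t ht hth) s hl h).2
      · exact hl
      · exact absurd hth (hd.down s (hd.held s hs hsh) t hl h.symm).2
    · rw [h] at hsh; omega
  · intro k hk
    by_cases hkP : k ∈ P
    · obtain ⟨h, hh, hhp⟩ := hd.dom k hkP
      obtain ⟨h1, h2⟩ := hd.hold_woman k hk h hh
      exact Or.inr ⟨h, (mem h).2 ⟨h1, by rw [h2, hh]⟩, h2, hhp⟩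
    · exact Or.inl (rest k hk hkP)
  · intro S hS s hs
    have hsK := hS.1.1 s hs
    by_cases hsP : s ∈ P
    · by_cases hh : d.hold (I.woman s) = s + 1
      · exact ⟨s, (mem s).2 ⟨hsK, hh⟩, rfl, le_rfl⟩
      · exact absurd hs (hd.opt S hS s hsP hh)
    · exact rest s hsK hsP

/-! ### The search -/

/-- The successor table of the truncated market. -/
def truncNxt (I : Market) (nxt : ℕ → ℕ) (k₀ k : ℕ) : ℕ :=
  if I.man k = I.man k₀ ∧ k ≤ k₀ then 0 else nxt k

/-- The table of starts of the truncated market. -/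
def truncStart (I : Market) (nxt start : ℕ → ℕ) (k₀ k : ℕ) : ℕ :=
  if (I.man k = I.man k₀ ∧ k ≤ k₀) ∨ nxt k₀ = k + 1 then 1 else start k

theorem trunc_nextSpec {I : Market} {nxt : ℕ → ℕ} (hn : I.NextSpec nxt) (m k₀ : ℕ) :
    (I.trunc m k₀).NextSpec (I.truncNxt nxt k₀) := by
  intro k hk
  by_cases h : I.man k = I.man k₀ ∧ k ≤ k₀
  · refine Or.inl ⟨by simp [truncNxt, h], fun l hkl hl => ?_⟩
    simp only [trunc, if_pos h]
    split_ifs <;> omega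
  · have hk' : I.man k = I.man k₀ → k₀ < k := fun h1 => by
      by_contra hc; exact h ⟨h1, by omega⟩
    simp only [truncNxt, if_neg h]
    rcases hn k hk with ⟨h1, h2⟩ | ⟨l, h1, h2, h3, h4, h5⟩
    · refine Or.inl ⟨h1, fun l hkl hl he => h2 l hkl hl ?_⟩
      exact ((trunc_man_eq hk').1 he.symm).1.symm
    · refine Or.inr ⟨l, h1, h2, h3, ?_, fun j hj hjl he => h5 j hj hjl ?_⟩
      · exact ((trunc_man_eq hk').2 ⟨h4.symm, fun h => (hk' (h4.symm.trans h)).trans h2⟩).symm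
      · exact ((trunc_man_eq hk').1 he.symm).1.symm

/-- Each split-off option is the only option of its man and hence a start; the remainder of the old
man begins at the successor of `k₀`. All other starts are unchanged. -/
theorem trunc_startSpec {I : Market} {nxt start : ℕ → ℕ} (hn : I.NextSpec nxt)
    (hs : I.StartSpec start) (m : ℕ) {k₀ : ℕ} (hk₀ : k₀ < I.K) :
    (I.trunc m k₀).StartSpec (I.truncStart nxt start k₀) := by
  intro k hk
  by_cases h : I.man k = I.man k₀ ∧ k ≤ k₀
  · simp only [truncStart, h, true_and, true_or, if_true, ne_eq, one_ne_zero, not_false_eq_true,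
      true_iff]
    intro j hj
    simp only [trunc, if_pos h]
    split_ifs <;> omega
  · have hk' : I.man k = I.man k₀ → k₀ < k := fun h1 => by
      by_contra hc; exact h ⟨h1, by omega⟩
    by_cases h2 : nxt k₀ = k + 1
    · simp only [truncStart, h2, or_true, if_true, ne_eq, one_ne_zero, not_false_eq_true,
        true_iff]
      rcases hn k₀ hk₀ with ⟨h0, -⟩ | ⟨l, h1, hl, -, hlm, hmid⟩
      · omega
      obtain rfl : l = k := by omega
      intro j hj he
      obtain ⟨h4, h5⟩ := (trunc_man_eq hk').1 he.symm
      exact hmid j (h5 (h4.symm.trans hlm)) hj (h4.symm.trans hlm)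
    · simp only [truncStart, h, h2, or_self, if_false]
      rw [hs k hk]
      constructor
      · intro h3 j hj he
        exact h3 j hj ((trunc_man_eq hk').1 he.symm).1.symm
      · intro h3 j hj he
        by_cases hkm : I.man k = I.man k₀
        · have hlt := hk' hkm
          rcases hn k₀ hk₀ with ⟨-, h0⟩ | ⟨l, h1, hl, hlK, hlm, hmid⟩
          · exact h0 k hlt hk hkm
          · have : l < k := by
              rcases lt_trichotomy l k with h | h | h
              · exact h
              · omega
              · exact absurd hkm (hmid k hlt h)
            exact h3 l this ((trunc_man_eq hk').2 ⟨hkm.trans hlm.symm, fun _ => hl⟩).symm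
        · exact h3 j hj ((trunc_man_eq hk').2
            ⟨he.symm, fun h => absurd (he.symm.trans h) hkm⟩).symm

theorem Stable.congr {I : Market} {pr : ℕ → ℕ} (h : ∀ k < I.K, pr k = I.pr k) {S : Finset ℕ} :
    ({ I with pr := pr } : Market).Stable S ↔ I.Stable S := by
  refine and_congr_right fun hM => forall₂_congr fun k hk => or_congr Iff.rfl ?_
  refine exists_congr fun s => and_congr_right fun hs => and_congr_right fun _ => ?_
  change pr s ≤ pr k ↔ _
  rw [h k hk, h s (hM.1 s hs)]

/-- Deferred acceptance in the truncated market finds a good stable set if there is one. -/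
theorem search_spec {I : Market} (hI : I.Strict) {nxt start : ℕ → ℕ} (hn : I.NextSpec nxt)
    (hs : I.StartSpec start) {m k₀ : ℕ} (hm : I.Leveled m) (hk₀ : k₀ < m) (hk : k₀ < I.K)
    {J : Market} (hJK : J.K = I.K) (hJw : J.woman = I.woman)
    (hpr : ∀ k < I.K, J.pr k = (I.trunc m k₀).pr k)
    {nxt' start' hold : ℕ → ℕ} (hn' : ∀ k < I.K, nxt' k = I.truncNxt nxt k₀ k)
    (hs' : ∀ k < I.K, start' k = I.truncStart nxt start k₀ k)
    (h0 : ∀ k < I.K, hold (I.woman k) = 0) {T : Finset ℕ}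
    (hT : T = DA.matching I ((J.daStep nxt' start')^[2 * I.K] ⟨hold, 0, 0⟩).hold) :
    (I.Good m k₀ T → I.Stable T) ∧ ∀ S, I.Stable S → I.Good m k₀ S → I.Good m k₀ T := by
  -- The step function never reads `man`, so a run on tables without the truncated men is a run in
  -- the truncated market. Priorities are kept from `J` because the tables are only known to agree
  -- below `K`.
  let J' : Market := { I.trunc m k₀ with pr := J.pr }
  have hJ' : J'.daStep nxt' start' = J.daStep nxt' start' := by
    funext d
    simp only [daStep, J', trunc, hJK, hJw]
    rfl
  have hst : J'.Strict := by
    intro k hk l hl hw hp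
    exact trunc_strict hI hm k hk l hl hw ((hpr k hk).symm.trans (hp.trans (hpr l hl)))
  have hnx : J'.NextSpec nxt' := by
    intro k hk
    have := trunc_nextSpec hn m k₀ k hk
    rwa [← hn' k hk] at this
  have hsx : J'.StartSpec start' := by
    intro k hk
    have := trunc_startSpec hn hs m ‹k₀ < I.K› k hk
    rwa [← hs' k hk] at this
  have h := da_spec hst hnx hsx (hold := hold) h0
  rw [hJ'] at h
  change J'.Stable (DA.matching I ((J.daStep nxt' start')^[2 * I.K] ⟨hold, 0, 0⟩).hold) ∧
    J'.ManOptimal (DA.matching I ((J.daStep nxt' start')^[2 * I.K] ⟨hold, 0, 0⟩).hold) at h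
  rw [← hT] at h
  have hc : ∀ {S}, J'.Stable S ↔ (I.trunc m k₀).Stable S := Stable.congr hpr
  exact ⟨fun hg => stable_of_trunc hm hk₀ (hc.1 h.1) hg, fun S hS hg =>
    good_of_trunc hI hm hk hS hg (hc.1 h.1) fun S hS s hs => h.2 S (hc.2 hS) s hs⟩

/-! ### The market of doubled edges. -/

/-- `I` is the market with two options `i` and `m + i` for each of `m` edges, where the edge `i` has
the man `f i`, the woman `g i`, and rank `c i` for the woman. -/
structure Doubles (I : Market) (m : ℕ) (f g c : ℕ → ℕ) : Prop where
  K : I.K = m + m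
  man_low : ∀ i < m, I.man i = f i
  man_high : ∀ i < m, I.man (m + i) = f i
  woman_low : ∀ i < m, I.woman i = g i
  woman_high : ∀ i < m, I.woman (m + i) = g i
  pr_low : ∀ i < m, I.pr i = m + c i + 1
  pr_high : ∀ i < m, I.pr (m + i) = c i

theorem Doubles.cases {I : Market} {m : ℕ} {f g c : ℕ → ℕ} (h : I.Doubles m f g c) {k : ℕ}
    (hk : k < I.K) : k < m ∨ ∃ i < m, k = m + i := by
  rcases lt_or_ge k m with h' | h'
  · exact Or.inl h'
  · rw [h.K] at hk
    exact Or.inr ⟨k - m, by omega, by omega⟩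

theorem Doubles.leveled {I : Market} {m : ℕ} {f g c : ℕ → ℕ} (h : I.Doubles m f g c)
    (hc : ∀ i < m, c i < m) : I.Leveled m := by
  refine ⟨fun k hk => ?_, fun k hk hmk => ?_⟩
  · rw [h.pr_low k hk]; omega
  · rcases h.cases hk with h' | ⟨i, hi, rfl⟩
    · omega
    · rw [h.pr_high i hi]; exact hc i hi

theorem Doubles.strict {I : Market} {m : ℕ} {f g c : ℕ → ℕ} (h : I.Doubles m f g c)
    (hc : ∀ i < m, c i < m) (hinj : ∀ i < m, ∀ j < m, c i = c j → i = j) : I.Strict := by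
  intro k hk l hl _ hp
  rcases h.cases hk with hk | ⟨i, hi, rfl⟩ <;> rcases h.cases hl with hl | ⟨j, hj, rfl⟩
  · rw [h.pr_low k hk, h.pr_low l hl] at hp
    exact hinj k hk l hl (by omega)
  · rw [h.pr_low k hk, h.pr_high j hj] at hp
    have := hc j hj; omega
  · rw [h.pr_high i hi, h.pr_low l hl] at hp
    have := hc i hi; omega
  · rw [h.pr_high i hi, h.pr_high j hj] at hp
    rw [hinj i hi j hj hp]

end Market

/-! ### Total correctness with time bounds, and frame reasoning. -/

namespace RAM

/-- `P` halts from `σ` within `T` steps in a state satisfying `Q`. -/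
def Runs (P : Program) (σ : State) (T : ℕ) (Q : State → Prop) : Prop :=
  ∃ t τ, Exec P σ t τ ∧ t ≤ T ∧ Q τ

theorem Runs.mono {P : Program} {σ : State} {T T' : ℕ} {Q Q' : State → Prop} (h : Runs P σ T Q)
    (hT : T ≤ T') (hQ : ∀ τ, Q τ → Q' τ) : Runs P σ T' Q' := by
  obtain ⟨t, τ, he, ht, hq⟩ := h
  exact ⟨t, τ, he, ht.trans hT, hQ τ hq⟩

theorem Runs.seq {P P' : Program} {σ : State} {T T' : ℕ} {R Q : State → Prop}
    (h : Runs P σ T R) (h' : ∀ τ, R τ → Runs P' τ T' Q) : Runs (.seq P P') σ (T + T') Q := by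
  obtain ⟨t, τ, he, ht, hr⟩ := h
  obtain ⟨s, υ, he', hs, hq⟩ := h' τ hr
  exact ⟨t + s, υ, he.seq he', by omega, hq⟩

/-- A loop whose body takes at most `c` steps and decreases the measure `μ`. -/
theorem Runs.while {b : Test} {P : Program} {c : ℕ} {I : State → Prop} {μ : State → ℕ}
    (hstep : ∀ σ, I σ → b.Holds σ → Runs P σ c fun τ => I τ ∧ μ τ < μ σ) (σ : State) (h : I σ) :
    Runs (.while b P) σ (μ σ * (c + 1) + 1) fun τ => I τ ∧ ¬ b.Holds τ := by
  induction hn : μ σ using Nat.strong_induction_on generalizing σ with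
  | _ n ih =>
    by_cases hb : b.Holds σ
    · obtain ⟨t, τ, he, ht, hi, hlt⟩ := hstep σ h hb
      obtain ⟨s, υ, he', hs, hq⟩ := ih (μ τ) (hn ▸ hlt) τ hi rfl
      refine ⟨1 + t + s, υ, he.while_true hb he', ?_, hq⟩
      have : (μ τ + 1) * (c + 1) ≤ n * (c + 1) := Nat.mul_le_mul_right _ (hn ▸ hlt)
      linarith
    · exact ⟨1, σ, .while_false hb, by omega, h, hb⟩

/-- The register written by an instruction. -/
def Instr.regs : Instr → List ℕ
  | .const r _ => [r]
  | .copy r _ => [r]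
  | .succ r => [r]
  | .pred r => [r]
  | .load r _ _ => [r]
  | .store _ _ _ => []

/-- The array written by an instruction. -/
def Instr.arrs : Instr → List ℕ
  | .store k _ _ => [k]
  | _ => []

/-- The registers written by a program. -/
def Program.regs : Program → List ℕ
  | .skip => []
  | .instr c => c.regs
  | .seq P Q => P.regs ++ Q.regs
  | .ite _ P Q => P.regs ++ Q.regs
  | .while _ P => P.regs

/-- The arrays written by a program. -/
def Program.arrs : Program → List ℕ
  | .skip => []
  | .instr c => c.arrs
  | .seq P Q => P.arrs ++ Q.arrs
  | .ite _ P Q => P.arrs ++ Q.arrs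
  | .while _ P => P.arrs

/-- The states agree on the registers and arrays that `P` does not write. -/
def SameOff (P : Program) (σ τ : State) : Prop :=
  (∀ r, r ∉ P.regs → τ.reg r = σ.reg r) ∧ ∀ k, k ∉ P.arrs → τ.arr k = σ.arr k

theorem SameOff.refl (P : Program) (σ : State) : SameOff P σ σ := ⟨fun _ _ => rfl, fun _ _ => rfl⟩

theorem SameOff.trans {P : Program} {σ τ υ : State} (h : SameOff P σ τ) (h' : SameOff P τ υ) :
    SameOff P σ υ :=
  ⟨fun r hr => (h'.1 r hr).trans (h.1 r hr), fun k hk => (h'.2 k hk).trans (h.2 k hk)⟩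

theorem SameOff.mono {P Q : Program} {σ τ : State} (h : SameOff P σ τ)
    (hr : ∀ r ∈ P.regs, r ∈ Q.regs) (hk : ∀ k ∈ P.arrs, k ∈ Q.arrs) : SameOff Q σ τ :=
  ⟨fun r h' => h.1 r fun h'' => h' (hr r h''), fun k h' => h.2 k fun h'' => h' (hk k h'')⟩

/-- The frame rule: what a program does not mention as a target is preserved. Membership in the
lists of targets is decidable, so later uses reduce to `decide`. -/
theorem Exec.sameOff {P : Program} {σ τ : State} {t : ℕ} (h : Exec P σ t τ) : SameOff P σ τ := by
  induction h with
  | skip => exact .refl _ _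
  | instr c σ =>
    refine ⟨fun r hr => ?_, fun k hk => ?_⟩
    · cases c <;> simp_all [Program.regs, Instr.regs, Instr.apply, State.setReg, State.setArr]
    · cases c <;> simp_all [Program.arrs, Instr.arrs, Instr.apply, State.setReg, State.setArr]
  | seq _ _ ih₁ ih₂ =>
    exact (ih₁.mono (by simp +contextual [Program.regs]) (by simp +contextual [Program.arrs])).trans
      (ih₂.mono (by simp +contextual [Program.regs]) (by simp +contextual [Program.arrs]))
  | ite_true _ _ ih =>
    exact ih.mono (by simp +contextual [Program.regs]) (by simp +contextual [Program.arrs])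
  | ite_false _ _ ih =>
    exact ih.mono (by simp +contextual [Program.regs]) (by simp +contextual [Program.arrs])
  | while_false => exact .refl _ _
  | while_true _ _ _ ih₁ ih₂ =>
    exact (ih₁.mono (by simp +contextual [Program.regs]) (by simp +contextual [Program.arrs])).trans
      (ih₂.mono (by simp +contextual [Program.regs]) (by simp +contextual [Program.arrs]))

theorem Runs.frame {P : Program} {σ : State} {T : ℕ} {Q : State → Prop} (h : Runs P σ T Q) :
    Runs P σ T fun τ => SameOff P σ τ ∧ Q τ := by
  obtain ⟨t, τ, he, ht, hq⟩ := h
  exact ⟨t, τ, he, ht, he.sameOff, hq⟩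

/-- Count register `i` from `0` up to the content of register `n`, exclusively. -/
def forLoop (i n : ℕ) (P : Program) : Program :=
  .seq (.instr (.const i 0)) (.while (.lt i n) (.seq P (.instr (.succ i))))

/-- The invariant `I j` is stated for states whose counter already shows `j`, hence the `setReg`
after the body. Besides it, each round may use that everything outside the targets of the loop is as
at the beginning. -/
theorem Runs.forLoop {i n : ℕ} {P : Program} {c N : ℕ} {I : ℕ → State → Prop} {σ : State}
    (hn : n ∉ (RAM.forLoop i n P).regs) (hi : i ∉ P.regs) (hN : σ.reg n = N)
    (h0 : I 0 (σ.setReg i 0))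
    (hstep : ∀ j < N, ∀ τ, τ.reg i = j → SameOff (RAM.forLoop i n P) σ τ → I j τ →
      Runs P τ c fun υ => I (j + 1) (υ.setReg i (j + 1))) :
    Runs (RAM.forLoop i n P) σ (N * (c + 2) + 2) (I N) := by
  have hs0 : SameOff (RAM.forLoop i n P) σ (σ.setReg i 0) :=
    Exec.sameOff (Exec.instr (.const i 0) σ) |>.mono
      (by simp [RAM.forLoop, Program.regs, Instr.regs]) (by simp [Program.arrs, Instr.arrs])
  have hw : Runs (.while (.lt i n) (.seq P (.instr (.succ i)))) (σ.setReg i 0)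
      ((N - (σ.setReg i 0).reg i) * (c + 1 + 1) + 1)
      fun τ => (SameOff (RAM.forLoop i n P) σ τ ∧ τ.reg i ≤ N ∧ I (τ.reg i) τ) ∧
        ¬ (Test.lt i n).Holds τ := by
    refine Runs.while (μ := fun τ => N - τ.reg i) ?_ _
      ⟨hs0, by simp [State.setReg], by simpa [State.setReg] using h0⟩
    rintro τ ⟨hs, hj, hI⟩ hb
    have hb' : τ.reg i < N := by
      have : τ.reg i < τ.reg n := hb
      rwa [hs.1 n hn, hN] at this
    obtain ⟨t, υ, he, ht, hq⟩ := hstep _ hb' τ rfl hs hI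
    have he' := he.seq (Exec.instr (.succ i) υ)
    have hυ : υ.reg i = τ.reg i := he.sameOff.1 i hi
    have hr : ((Instr.succ i).apply υ).reg i = τ.reg i + 1 := by
      simp [Instr.apply, State.setReg, hυ]
    refine ⟨t + 1, _, he', by omega, ⟨hs.trans (he'.sameOff.mono ?_ ?_), by omega, ?_⟩, ?_⟩
    · intro r hr; simp only [RAM.forLoop, Program.regs, List.mem_append] at hr ⊢; exact Or.inr hr
    · intro r hr; simp only [RAM.forLoop, Program.arrs, List.mem_append] at hr ⊢; exact Or.inr hr
    · rw [hr]; simpa only [Instr.apply, hυ] using hq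
    · rw [hr]; omega
  obtain ⟨t, τ, he, ht, ⟨hs, hj, hI⟩, hb⟩ := hw
  have hb' : ¬ τ.reg i < N := by
    have : ¬ τ.reg i < τ.reg n := hb
    rwa [hs.1 n hn, hN] at this
  have hjN : τ.reg i = N := by omega
  refine ⟨1 + t, τ, Exec.seq (.instr _ _) he, ?_, hjN ▸ hI⟩
  simp only [State.setReg, Function.update_self, Nat.sub_zero] at ht
  have : N * (c + 1 + 1) = N * (c + 2) := rfl
  omega

/-- Programs without loops. -/
def Program.LoopFree : Program → Prop
  | .skip => True
  | .instr _ => True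
  | .seq P Q => P.LoopFree ∧ Q.LoopFree
  | .ite _ P Q => P.LoopFree ∧ Q.LoopFree
  | .while _ _ => False

open Classical in
/-- The final state of a loop-free program. -/
noncomputable def Program.eval : Program → State → State
  | .skip, σ => σ
  | .instr c, σ => c.apply σ
  | .seq P Q, σ => Q.eval (P.eval σ)
  | .ite b P Q, σ => if b.Holds σ then P.eval σ else Q.eval σ
  | .while _ _, σ => σ

/-- A bound on the running time of a loop-free program. -/
def Program.cost : Program → ℕ
  | .skip => 1
  | .instr _ => 1
  | .seq P Q => P.cost + Q.cost
  | .ite _ P Q => 1 + P.cost + Q.cost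
  | .while _ _ => 0

theorem Program.LoopFree.exec {P : Program} (h : P.LoopFree) (σ : State) :
    ∃ t ≤ P.cost, Exec P σ t (P.eval σ) := by
  induction P generalizing σ with
  | skip => exact ⟨1, le_rfl, .skip σ⟩
  | instr c => exact ⟨1, le_rfl, .instr c σ⟩
  | seq P Q ihP ihQ =>
    obtain ⟨s, hs, es⟩ := ihP h.1 σ
    obtain ⟨t, ht, et⟩ := ihQ h.2 (P.eval σ)
    exact ⟨s + t, Nat.add_le_add hs ht, es.seq et⟩
  | ite b P Q ihP ihQ =>
    by_cases hb : b.Holds σ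
    · obtain ⟨s, hs, es⟩ := ihP h.1 σ
      exact ⟨1 + s, by simp only [cost]; omega, by simpa only [eval, if_pos hb] using es.ite_true hb⟩
    · obtain ⟨s, hs, es⟩ := ihQ h.2 σ
      exact ⟨1 + s, by simp only [cost]; omega,
        by simpa only [eval, if_neg hb] using es.ite_false hb⟩
  | _ => exact h.elim

theorem Runs.loopFree {P : Program} (h : P.LoopFree) {σ : State} {Q : State → Prop}
    (hQ : Q (P.eval σ)) : Runs P σ P.cost Q := by
  obtain ⟨t, ht, he⟩ := h.exec σ
  exact ⟨t, _, he, ht, hQ⟩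

theorem Runs.instr (c : Instr) (σ : State) : Runs (.instr c) σ 1 fun τ => τ = c.apply σ :=
  ⟨1, _, .instr c σ, le_rfl, rfl⟩

/-- Run a list of programs one after the other. -/
def block : List Program → Program
  | [] => .skip
  | [P] => P
  | P :: Q :: L => .seq P (block (Q :: L))

end RAM

/-! ### Machine programs for the search over edges. -/

namespace RAM

/-- One step of deferred acceptance. -/
def stepProg : Program :=
  -- Registers `20` and `21` are `pos` and `cur`; register `4` is constantly `0`. Array `6` gives
  -- the women, `10` to `12` are the priorities, successors and starts of the truncated market, and
  -- `13` is `hold`.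
  .ite (.eq 21 4)
    (.ite (.lt 20 3)
      (block [.instr (.load 22 12 20),
        .ite (.ne 22 4) (block [.instr (.copy 21 20), .instr (.succ 21)]) .skip,
        .instr (.succ 20)])
      .skip)
    (block [.instr (.copy 23 21), .instr (.pred 23), .instr (.load 24 6 23),
      .instr (.load 25 13 24),
      .ite (.eq 25 4)
        (block [.instr (.store 13 24 21), .instr (.const 21 0)])
        (block [.instr (.pred 25), .instr (.load 26 10 23), .instr (.load 27 10 25),
          .ite (.lt 26 27)
            (block [.instr (.store 13 24 21), .instr (.load 21 11 25)])
            (.instr (.load 21 11 23))])])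

/-- The state holds the data of deferred acceptance. -/
structure Holds (σ : State) (d : Market.DA) : Prop where
  hold : σ.arr 13 = d.hold
  cur : σ.reg 21 = d.cur
  pos : σ.reg 20 = d.pos

theorem stepProg_holds {σ : State} {J : Market} {nxt start : ℕ → ℕ} {d : Market.DA}
    (hK : σ.reg 3 = J.K) (h4 : σ.reg 4 = 0) (h6 : σ.arr 6 = J.woman) (h10 : σ.arr 10 = J.pr)
    (h11 : σ.arr 11 = nxt) (h12 : σ.arr 12 = start) (hd : Holds σ d) :
    Holds (stepProg.eval σ) (J.daStep nxt start d) := by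
  obtain ⟨h1, h2, h3⟩ := hd
  by_cases c1 : d.cur = 0
  · by_cases c2 : d.pos < J.K
    · by_cases c3 : start d.pos = 0
      all_goals
        constructor <;>
        simp [stepProg, block, Program.eval, Test.Holds, Instr.apply, State.setReg, *,
          Market.daStep]
    · constructor <;>
        simp [stepProg, block, Program.eval, Test.Holds, *, Market.daStep]
  · by_cases c2 : d.hold (J.woman (d.cur - 1)) = 0
    · constructor <;>
        simp [stepProg, block, Program.eval, Test.Holds, Instr.apply, State.setReg, *,
          State.setArr, Function.update_of_ne, Market.daStep]
    · by_cases c3 : J.pr (d.cur - 1) < J.pr (d.hold (J.woman (d.cur - 1)) - 1)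
      all_goals
        constructor <;>
        simp [stepProg, block, Program.eval, Test.Holds, Instr.apply, State.setReg, *,
          State.setArr, Function.update_of_ne, Market.daStep]

/-- Deferred acceptance. -/
def daProg : Program :=
  -- Two steps per round turn a loop of length `K` into the `2 * K` steps that `Market.da_spec`
  -- requires.
  block [.instr (.const 20 0), .instr (.const 21 0), forLoop 28 3 (.seq stepProg stepProg)]

theorem daProg_runs {σ : State} {J : Market} {nxt start hold : ℕ → ℕ}
    (hK : σ.reg 3 = J.K) (h4 : σ.reg 4 = 0) (h6 : σ.arr 6 = J.woman) (h10 : σ.arr 10 = J.pr)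
    (h11 : σ.arr 11 = nxt) (h12 : σ.arr 12 = start) (h13 : σ.arr 13 = hold) :
    Runs daProg σ (J.K * 100 + 100) fun τ =>
      τ.arr 13 = ((J.daStep nxt start)^[2 * J.K] ⟨hold, 0, 0⟩).hold := by
  refine ((Runs.instr _ σ).seq (T' := J.K * 100 + 99) fun τ hτ => ?_).mono (by omega) fun _ h => h
  subst hτ
  refine ((Runs.instr _ _).seq (T' := J.K * 100 + 98) fun τ hτ => ?_).mono (by omega) fun _ h => h
  subst hτ
  refine (Runs.forLoop (N := J.K) (c := (Program.seq stepProg stepProg).cost)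
    (I := fun j τ => Holds τ ((J.daStep nxt start)^[2 * j] ⟨hold, 0, 0⟩))
    (by decide) (by decide) (by simpa [State.setReg, Instr.apply] using hK) ?_ ?_).mono ?_ ?_
  · constructor <;> simp [State.setReg, Instr.apply, h13]
  · intro j _ τ _ hs hd
    refine Runs.loopFree (P := .seq stepProg stepProg) ⟨by simp [stepProg, block, Program.LoopFree],
      by simp [stepProg, block, Program.LoopFree]⟩ ?_
    have e1 : ∀ r, r ∉ (forLoop 28 3 (.seq stepProg stepProg)).regs → r ≠ 20 → r ≠ 21 →
        τ.reg r = σ.reg r := by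
      intro r hr h1 h2
      rw [hs.1 r hr]
      simp [State.setReg, Instr.apply, h1, h2]
    have e2 : ∀ k, k ∉ (forLoop 28 3 (.seq stepProg stepProg)).arrs → τ.arr k = σ.arr k := by
      intro k hk
      rw [hs.2 k hk]
      simp [State.setReg, Instr.apply]
    have p1 := stepProg_holds (J := J) (nxt := nxt) (start := start)
      ((e1 3 (by decide) (by decide) (by decide)).trans hK)
      ((e1 4 (by decide) (by decide) (by decide)).trans h4) ((e2 6 (by decide)).trans h6)
      ((e2 10 (by decide)).trans h10) ((e2 11 (by decide)).trans h11)
      ((e2 12 (by decide)).trans h12) hd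
    have hf : SameOff stepProg τ (stepProg.eval τ) := by
      obtain ⟨t, -, he⟩ := Program.LoopFree.exec (P := stepProg)
        (by simp [stepProg, block, Program.LoopFree]) τ
      exact he.sameOff
    have p2 := stepProg_holds (J := J) (nxt := nxt) (start := start)
      ((hf.1 3 (by decide)).trans ((e1 3 (by decide) (by decide) (by decide)).trans hK))
      ((hf.1 4 (by decide)).trans ((e1 4 (by decide) (by decide) (by decide)).trans h4))
      ((hf.2 6 (by decide)).trans ((e2 6 (by decide)).trans h6))
      ((hf.2 10 (by decide)).trans ((e2 10 (by decide)).trans h10))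
      ((hf.2 11 (by decide)).trans ((e2 11 (by decide)).trans h11))
      ((hf.2 12 (by decide)).trans ((e2 12 (by decide)).trans h12)) p1
    rw [show 2 * (j + 1) = 2 * j + 1 + 1 by ring, Function.iterate_succ_apply',
      Function.iterate_succ_apply']
    refine ⟨?_, ?_, ?_⟩
    · simpa [State.setReg, Program.eval] using p2.hold
    · simpa [State.setReg, Program.eval] using p2.cur
    · simpa [State.setReg, Program.eval] using p2.pos
  · have : (Program.seq stepProg stepProg).cost ≤ 90 := by decide
    nlinarith
  · exact fun τ h => h.hold

/-- The tables of a market. -/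
structure Table (I : Market) (nxt start : ℕ → ℕ) (m : ℕ) (σ : State) : Prop where
  m : σ.reg 2 = m
  K : σ.reg 3 = I.K
  zero : σ.reg 4 = 0
  man : σ.arr 5 = I.man
  woman : σ.arr 6 = I.woman
  pr : σ.arr 7 = I.pr
  nxt : σ.arr 8 = nxt
  start : σ.arr 9 = start

theorem Table.of_sameOff {I : Market} {nxt start : ℕ → ℕ} {m : ℕ} {P : Program} {σ τ : State}
    (h : Table I nxt start m σ) (hs : SameOff P σ τ)
    (hr : ∀ r ∈ P.regs, r ∉ [2, 3, 4]) (hk : ∀ k ∈ P.arrs, k ∉ [5, 6, 7, 8, 9]) :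
    Table I nxt start m τ := by
  have e1 : ∀ r ∈ [2, 3, 4], τ.reg r = σ.reg r := fun r h => hs.1 r fun h' => hr r h' h
  have e2 : ∀ k ∈ [5, 6, 7, 8, 9], τ.arr k = σ.arr k := fun k h => hs.2 k fun h' => hk k h' h
  exact ⟨(e1 2 (by simp)).trans h.m, (e1 3 (by simp)).trans h.K, (e1 4 (by simp)).trans h.zero,
    (e2 5 (by simp)).trans h.man, (e2 6 (by simp)).trans h.woman, (e2 7 (by simp)).trans h.pr,
    (e2 8 (by simp)).trans h.nxt, (e2 9 (by simp)).trans h.start⟩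

/-- Copy one row of the tables into the tables of the truncated market. -/
def setupBody : Program :=
  -- `hold` is cleared only at women of options, which is all that deferred acceptance reads and
  -- avoids a loop over `B`. The two final tests override the copied row at the successor of `k₀`
  -- (register `15`) and at the split-off options of the man of `k₀` (register `14`).
  block [.instr (.load 30 6 12), .instr (.store 13 30 4), .instr (.load 30 7 12),
    .instr (.store 10 12 30), .instr (.load 30 8 12), .instr (.store 11 12 30),
    .instr (.load 30 9 12), .instr (.store 12 12 30), .instr (.const 31 1),
    .instr (.copy 32 12), .instr (.succ 32), .instr (.load 33 5 12),
    .ite (.eq 32 15) (.instr (.store 12 12 31)) .skip,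
    .ite (.eq 33 14) (.ite (.le 12 10)
      (block [.instr (.store 12 12 31), .instr (.store 11 12 4)]) .skip) .skip]

/-- Set up the truncated market. -/
def setupProg : Program :=
  block [.instr (.load 14 5 10), .instr (.load 15 8 10), forLoop 12 3 setupBody,
    -- The priority of `k₀` (register `10`) becomes `m`, after the loop that copies the old
    -- priorities.
    .instr (.store 10 10 2)]

theorem setupBody_eval {I : Market} {nxt start : ℕ → ℕ} {m k₀ : ℕ} {σ : State}
    (h : Table I nxt start m σ) (h10 : σ.reg 10 = k₀) (h14 : σ.reg 14 = I.man k₀)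
    (h15 : σ.reg 15 = nxt k₀) :
    (setupBody.eval σ).arr 10 =
        Function.update (σ.arr 10) (σ.reg 12) (I.pr (σ.reg 12)) ∧
      (setupBody.eval σ).arr 11 =
        Function.update (σ.arr 11) (σ.reg 12) (I.truncNxt nxt k₀ (σ.reg 12)) ∧
      (setupBody.eval σ).arr 12 =
        Function.update (σ.arr 12) (σ.reg 12) (I.truncStart nxt start k₀ (σ.reg 12)) ∧
      (setupBody.eval σ).arr 13 = Function.update (σ.arr 13) (I.woman (σ.reg 12)) 0 := by
  obtain ⟨g1, g2, g3, g4, g5, g6, g7, g8⟩ := h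
  by_cases c1 : σ.reg 12 + 1 = nxt k₀ <;> by_cases c2 : I.man (σ.reg 12) = I.man k₀ <;>
  by_cases c3 : σ.reg 12 ≤ k₀
  all_goals
    refine ⟨?_, ?_, ?_, ?_⟩ <;>
    simp [setupBody, block, Program.eval, Test.Holds, Instr.apply, State.setReg, State.setArr,
      Function.update_of_ne, Market.truncNxt, Market.truncStart, eq_comm (a := nxt k₀), *]

end RAM

namespace RAM

theorem setupProg_runs {I : Market} {nxt start : ℕ → ℕ} {m k₀ : ℕ} {σ : State}
    (h : Table I nxt start m σ) (h10 : σ.reg 10 = k₀) :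
    Runs setupProg σ (I.K * 100 + 100) fun τ =>
      (∀ k < I.K, τ.arr 10 k = (I.trunc m k₀).pr k) ∧
      (∀ k < I.K, τ.arr 11 k = I.truncNxt nxt k₀ k) ∧
      (∀ k < I.K, τ.arr 12 k = I.truncStart nxt start k₀ k) ∧
      ∀ k < I.K, τ.arr 13 (I.woman k) = 0 := by
  refine ((Runs.instr _ σ).seq (T' := I.K * 100 + 99) fun τ hτ => ?_).mono (by omega) fun _ h => h
  subst hτ
  refine ((Runs.instr _ _).seq (T' := I.K * 100 + 98) fun τ hτ => ?_).mono (by omega) fun _ h => h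
  subst hτ
  set σ' := (Instr.load 15 8 10).apply ((Instr.load 14 5 10).apply σ) with hσ'
  have ht : Table I nxt start m σ' := by
    obtain ⟨g1, g2, g3, g4, g5, g6, g7, g8⟩ := h
    constructor <;> simpa [hσ', Instr.apply, State.setReg]
  have e10 : σ'.reg 10 = k₀ := by simpa [hσ', Instr.apply, State.setReg]
  have e14 : σ'.reg 14 = I.man k₀ := by simp [hσ', Instr.apply, State.setReg, h10, h.man]
  have e15 : σ'.reg 15 = nxt k₀ := by simp [hσ', Instr.apply, State.setReg, h10, h.nxt]
  refine (Runs.seq (T' := 1) (Runs.forLoop (N := I.K) (c := setupBody.cost)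
    (I := fun j τ => (∀ k < j, τ.arr 10 k = I.pr k) ∧ (∀ k < j, τ.arr 11 k = I.truncNxt nxt k₀ k) ∧
      (∀ k < j, τ.arr 12 k = I.truncStart nxt start k₀ k) ∧ ∀ k < j, τ.arr 13 (I.woman k) = 0)
    (by decide) (by decide) ht.K ?_ ?_).frame fun τ hτ =>
      ?_).mono ?_ fun _ h => h
  · simp
  · intro j _ τ hj hs hI
    refine Runs.loopFree (by simp [setupBody, block, Program.LoopFree]) ?_
    obtain ⟨q1, q2, q3, q4⟩ := setupBody_eval (ht.of_sameOff hs (by decide) (by decide))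
      ((hs.1 10 (by decide)).trans e10) ((hs.1 14 (by decide)).trans e14)
      ((hs.1 15 (by decide)).trans e15)
    rw [hj] at q1 q2 q3 q4
    simp only [State.setReg, q1, q2, q3, q4]
    obtain ⟨i1, i2, i3, i4⟩ := hI
    refine ⟨fun k hk => ?_, fun k hk => ?_, fun k hk => ?_, fun k hk => ?_⟩
    · rcases Nat.lt_succ_iff_lt_or_eq.1 hk with hk | rfl
      · rw [Function.update_of_ne hk.ne, i1 k hk]
      · simp
    · rcases Nat.lt_succ_iff_lt_or_eq.1 hk with hk | rfl
      · rw [Function.update_of_ne hk.ne, i2 k hk]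
      · simp
    · rcases Nat.lt_succ_iff_lt_or_eq.1 hk with hk | rfl
      · rw [Function.update_of_ne hk.ne, i3 k hk]
      · simp
    · rcases Nat.lt_succ_iff_lt_or_eq.1 hk with hk | rfl
      · by_cases hw : I.woman k = I.woman j
        · simp [hw]
        · rw [Function.update_of_ne hw, i4 k hk]
      · simp
  · obtain ⟨hs, i1, i2, i3, i4⟩ := hτ
    refine (Runs.instr _ τ).mono le_rfl ?_
    rintro _ rfl
    have f2 : τ.reg 2 = m := (hs.1 2 (by decide)).trans ht.m
    have f10 : τ.reg 10 = k₀ := (hs.1 10 (by decide)).trans e10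
    refine ⟨fun k hk => ?_, ?_, ?_, ?_⟩
    · by_cases hkk : k = k₀
      · simp [Instr.apply, State.setArr, f2, f10, Market.trunc, hkk]
      · simp [Instr.apply, State.setArr, f10, Market.trunc, hkk, i1 k hk]
    · simpa [Instr.apply, State.setArr] using i2
    · simpa [Instr.apply, State.setArr] using i3
    · simpa [Instr.apply, State.setArr] using i4
  · have : setupBody.cost ≤ 90 := by decide
    nlinarith

/-- Inspect one option for the test of `Market.Good`. -/
def checkBody : Program :=
  block [.instr (.load 40 6 12), .instr (.load 41 13 40), .instr (.copy 42 12), .instr (.succ 42),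
    .ite (.eq 41 42)
      (block [.instr (.load 43 5 12),
        .ite (.eq 43 14)
          (block [.instr (.const 35 1),
            .ite (.lt 10 12) (.ite (.lt 12 2) .skip (.instr (.const 34 1)))
              (.instr (.const 34 1))])
          .skip,
        .ite (.eq 40 16)
          (.ite (.le 2 12)
            (block [.instr (.load 44 7 12), .ite (.lt 17 44) (.instr (.const 36 1)) .skip]) .skip)
          .skip])
      .skip]

/-- Test whether the held options satisfy `Market.Good`. -/
def checkProg : Program :=
  -- Flag `34` records a violation of the universal clause of `Good`; flags `35` and `36` record
  -- witnesses of the two existential ones.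
  block [.instr (.load 14 5 10), .instr (.load 16 6 10), .instr (.load 17 7 11),
    .instr (.const 34 0), .instr (.const 35 0), .instr (.const 36 0), forLoop 12 3 checkBody]

theorem checkBody_eval {I : Market} {nxt start : ℕ → ℕ} {m k₀ : ℕ} {σ : State}
    (h : Table I nxt start m σ) (h10 : σ.reg 10 = k₀) (h14 : σ.reg 14 = I.man k₀)
    (h16 : σ.reg 16 = I.woman k₀) (h17 : σ.reg 17 = I.pr (m + k₀)) (hK : σ.reg 12 < I.K) :
    ((checkBody.eval σ).reg 34 = 0 ↔ σ.reg 34 = 0 ∧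
      (σ.reg 12 ∈ Market.DA.matching I (σ.arr 13) → I.man (σ.reg 12) = I.man k₀ →
        k₀ < σ.reg 12 ∧ σ.reg 12 < m)) ∧
    ((checkBody.eval σ).reg 35 = 0 ↔ σ.reg 35 = 0 ∧
      ¬ (σ.reg 12 ∈ Market.DA.matching I (σ.arr 13) ∧ I.man (σ.reg 12) = I.man k₀)) ∧
    ((checkBody.eval σ).reg 36 = 0 ↔ σ.reg 36 = 0 ∧
      ¬ (σ.reg 12 ∈ Market.DA.matching I (σ.arr 13) ∧ m ≤ σ.reg 12 ∧
        I.woman (σ.reg 12) = I.woman k₀ ∧ I.pr (m + k₀) < I.pr (σ.reg 12))) := by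
  obtain ⟨g1, g2, g3, g4, g5, g6, g7, g8⟩ := h
  have hm : σ.reg 12 ∈ Market.DA.matching I (σ.arr 13) ↔
      σ.arr 13 (I.woman (σ.reg 12)) = σ.reg 12 + 1 := by
    simp [Market.DA.matching, hK]
  rw [hm]
  by_cases c1 : σ.arr 13 (I.woman (σ.reg 12)) = σ.reg 12 + 1
  · have c1' : I.woman (σ.reg 12) = I.woman k₀ → σ.arr 13 (I.woman k₀) = σ.reg 12 + 1 :=
      fun h => h ▸ c1
    by_cases c2 : I.man (σ.reg 12) = I.man k₀ <;>
    by_cases c3 : I.woman (σ.reg 12) = I.woman k₀ <;> by_cases c4 : k₀ < σ.reg 12 <;>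
    by_cases c5 : m ≤ σ.reg 12 <;> by_cases c6 : I.pr (m + k₀) < I.pr (σ.reg 12)
    all_goals
      have c5' : σ.reg 12 < m ↔ ¬ m ≤ σ.reg 12 := not_le.symm
      simp [checkBody, block, Program.eval, Test.Holds, Instr.apply, State.setReg, *]
  · simp [checkBody, block, Program.eval, Test.Holds, Instr.apply, State.setReg, *]

end RAM

namespace RAM

theorem checkProg_runs {I : Market} {nxt start : ℕ → ℕ} {m k₀ : ℕ} {σ : State}
    (h : Table I nxt start m σ) (h10 : σ.reg 10 = k₀) (h11 : σ.reg 11 = m + k₀) :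
    Runs checkProg σ (I.K * 100 + 100) fun τ =>
      (I.Good m k₀ (Market.DA.matching I (σ.arr 13)) ↔
        τ.reg 34 = 0 ∧ τ.reg 35 ≠ 0 ∧ τ.reg 36 ≠ 0) := by
  refine ((Runs.instr _ σ).seq (T' := I.K * 100 + 99) fun τ hτ => ?_).mono (by omega) fun _ h => h
  subst hτ
  refine ((Runs.instr _ _).seq (T' := I.K * 100 + 98) fun τ hτ => ?_).mono (by omega) fun _ h => h
  subst hτ
  refine ((Runs.instr _ _).seq (T' := I.K * 100 + 97) fun τ hτ => ?_).mono (by omega) fun _ h => h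
  subst hτ
  refine ((Runs.instr _ _).seq (T' := I.K * 100 + 96) fun τ hτ => ?_).mono (by omega) fun _ h => h
  subst hτ
  refine ((Runs.instr _ _).seq (T' := I.K * 100 + 95) fun τ hτ => ?_).mono (by omega) fun _ h => h
  subst hτ
  refine ((Runs.instr _ _).seq (T' := I.K * 100 + 94) fun τ hτ => ?_).mono (by omega) fun _ h => h
  subst hτ
  set σ' := (Instr.const 36 0).apply _ with hσ'
  have ht : Table I nxt start m σ' := by
    obtain ⟨g1, g2, g3, g4, g5, g6, g7, g8⟩ := h
    constructor <;> simpa [hσ', Instr.apply, State.setReg]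
  have e10 : σ'.reg 10 = k₀ := by simpa [hσ', Instr.apply, State.setReg]
  have e14 : σ'.reg 14 = I.man k₀ := by simp [hσ', Instr.apply, State.setReg, h10, h.man]
  have e16 : σ'.reg 16 = I.woman k₀ := by simp [hσ', Instr.apply, State.setReg, h10, h.woman]
  have e17 : σ'.reg 17 = I.pr (m + k₀) := by simp [hσ', Instr.apply, State.setReg, h11, h.pr]
  have e13 : σ'.arr 13 = σ.arr 13 := by simp [hσ', Instr.apply, State.setReg]
  have e34 : σ'.reg 34 = 0 := by simp [hσ', Instr.apply, State.setReg]
  have e35 : σ'.reg 35 = 0 := by simp [hσ', Instr.apply, State.setReg]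
  have e36 : σ'.reg 36 = 0 := by simp [hσ', Instr.apply, State.setReg]
  clear_value σ'
  set T := Market.DA.matching I (σ.arr 13) with hT
  have hTK : ∀ t ∈ T, t < I.K := by simp +contextual [hT, Market.DA.matching]
  refine (Runs.forLoop (N := I.K) (c := checkBody.cost)
    (I := fun j τ =>
      (τ.reg 34 = 0 ↔ ∀ t < j, t ∈ T → I.man t = I.man k₀ → k₀ < t ∧ t < m) ∧
      (τ.reg 35 = 0 ↔ ∀ t < j, ¬ (t ∈ T ∧ I.man t = I.man k₀)) ∧
      (τ.reg 36 = 0 ↔ ∀ t < j, ¬ (t ∈ T ∧ m ≤ t ∧ I.woman t = I.woman k₀ ∧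
        I.pr (m + k₀) < I.pr t)))
    (by decide) (by decide) ht.K ?_ ?_).mono ?_ ?_
  · simp [State.setReg, e34, e35, e36]
  · rintro j hjK τ rfl hs ⟨i1, i2, i3⟩
    refine Runs.loopFree (by simp [checkBody, block, Program.LoopFree]) ?_
    obtain ⟨q1, q2, q3⟩ := checkBody_eval (ht.of_sameOff hs (by decide) (by decide))
      ((hs.1 10 (by decide)).trans e10) ((hs.1 14 (by decide)).trans e14)
      ((hs.1 16 (by decide)).trans e16) ((hs.1 17 (by decide)).trans e17) hjK
    rw [hs.2 13 (by decide), e13, ← hT] at q1 q2 q3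
    simp only [State.setReg, Function.update_of_ne (show (34 : ℕ) ≠ 12 by decide),
      Function.update_of_ne (show (35 : ℕ) ≠ 12 by decide),
      Function.update_of_ne (show (36 : ℕ) ≠ 12 by decide), Nat.forall_lt_succ_right]
    rw [q1, q2, q3, i1, i2, i3]
    exact ⟨Iff.rfl, Iff.rfl, Iff.rfl⟩
  · have : checkBody.cost ≤ 90 := by decide
    nlinarith
  · rintro τ ⟨i1, i2, i3⟩
    rw [ne_eq, ne_eq, i1, i2, i3]
    push Not
    refine and_congr ⟨fun h t _ ht => h t ht, fun h t ht => h t (hTK t ht) ht⟩ (and_congr ?_ ?_)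
    · exact ⟨fun ⟨t, ht, h⟩ => ⟨t, hTK t ht, ht, h⟩, fun ⟨t, _, ht, h⟩ => ⟨t, ht, h⟩⟩
    · exact ⟨fun ⟨t, ht, h⟩ => ⟨t, hTK t ht, ht, h⟩, fun ⟨t, _, ht, h⟩ => ⟨t, ht, h⟩⟩

/-- Write one held option to the output. -/
def outputBody : Program :=
  block [.instr (.load 40 6 12), .instr (.load 41 13 40), .instr (.copy 42 12), .instr (.succ 42),
    .ite (.eq 41 42)
      (block [.instr (.load 43 5 12), .instr (.succ 40), .instr (.store 4 43 40)])
      .skip]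

/-- Write the held options to the output. -/
def outputProg : Program := forLoop 12 3 outputBody

/-- The array `4` represents the set of options `T`. -/
def Outputs (I : Market) (T : Finset ℕ) (σ : State) : Prop :=
  (∀ a, (∀ t ∈ T, I.man t ≠ a) → σ.arr 4 a = 0) ∧ ∀ t ∈ T, σ.arr 4 (I.man t) = I.woman t + 1

/-- Only cells of matched men are written. The others are right because the output array is zero at
the start, so no loop over `A` is needed. -/
theorem outputProg_runs {I : Market} {nxt start : ℕ → ℕ} {m : ℕ} {σ : State}
    (h : Table I nxt start m σ) (h4 : ∀ a, σ.arr 4 a = 0)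
    (hT : I.IsMatch (Market.DA.matching I (σ.arr 13))) :
    Runs outputProg σ (I.K * 100 + 100) (Outputs I (Market.DA.matching I (σ.arr 13))) := by
  set T := Market.DA.matching I (σ.arr 13) with hT'
  have hTm : ∀ t, t ∈ T ↔ t < I.K ∧ σ.arr 13 (I.woman t) = t + 1 := by
    simp [hT', Market.DA.matching]
  refine (Runs.forLoop (N := I.K) (c := outputBody.cost)
    (I := fun j τ =>
      (∀ a, (∀ t ∈ T, t < j → I.man t ≠ a) → τ.arr 4 a = 0) ∧
      ∀ t ∈ T, t < j → τ.arr 4 (I.man t) = I.woman t + 1)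
    (by decide) (by decide) h.K ?_ ?_).mono ?_ ?_
  · simp [State.setReg, h4]
  · rintro j hjK τ rfl hs ⟨i1, i2⟩
    refine Runs.loopFree (by simp [outputBody, block, Program.LoopFree]) ?_
    obtain ⟨g1, g2, g3, g4, g5, g6, g7, g8⟩ := h.of_sameOff hs (by decide) (by decide)
    have g13 : τ.arr 13 = σ.arr 13 := hs.2 13 (by decide)
    have hm : τ.reg 12 ∈ T ↔ σ.arr 13 (I.woman (τ.reg 12)) = τ.reg 12 + 1 := by
      rw [hTm]; exact and_iff_right hjK
    by_cases c1 : σ.arr 13 (I.woman (τ.reg 12)) = τ.reg 12 + 1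
    · have e : (outputBody.eval τ).arr 4 =
          Function.update (τ.arr 4) (I.man (τ.reg 12)) (I.woman (τ.reg 12) + 1) := by
        simp [outputBody, block, Program.eval, Test.Holds, Instr.apply, State.setReg,
          State.setArr, *]
      have hmem := hm.2 c1
      simp only [State.setReg, e]
      refine ⟨fun a ha => ?_, fun t ht hlt => ?_⟩
      · rw [Function.update_of_ne (ha _ hmem (Nat.lt_succ_self _)).symm]
        exact i1 a fun t ht hlt => ha t ht (by omega)
      · rcases Nat.lt_succ_iff_lt_or_eq.1 hlt with hlt | rfl
        · rw [Function.update_of_ne, i2 t ht hlt]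
          intro he
          exact hlt.ne (hT.2 t ht _ hmem (Or.inl he))
        · simp
    · have e : (outputBody.eval τ).arr 4 = τ.arr 4 := by
        simp [outputBody, block, Program.eval, Test.Holds, Instr.apply, State.setReg, *]
      simp only [State.setReg, e]
      refine ⟨fun a ha => i1 a fun t ht hlt => ha t ht (by omega), fun t ht hlt => i2 t ht ?_⟩
      rcases Nat.lt_succ_iff_lt_or_eq.1 hlt with hlt | rfl
      · exact hlt
      · exact absurd (hm.1 ht) c1
  · have : outputBody.cost ≤ 90 := by decide
    nlinarith
  · rintro τ ⟨i1, i2⟩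
    exact ⟨fun a ha => i1 a fun t ht _ => ha t ht, fun t ht => i2 t ht ((hTm t).1 ht).1⟩

/-- Search for a good stable set with parameter in register `10`. -/
def iterProg : Program :=
  block [setupProg, daProg, checkProg,
    .ite (.eq 34 4)
      (.ite (.ne 35 4)
        (.ite (.ne 36 4)
          -- Setting the parameter to `m` ends the outer loop after a success.
          (block [outputProg, .instr (.const 0 0), .instr (.copy 10 2)])
          (block [.instr (.succ 10), .instr (.succ 11)]))
        (block [.instr (.succ 10), .instr (.succ 11)]))
      (block [.instr (.succ 10), .instr (.succ 11)])]

/-- Nothing has been found for the parameters below `k`. -/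
structure Searching (I : Market) (m : ℕ) (σ : State) : Prop where
  res : σ.reg 0 = 1
  shift : σ.reg 11 = m + σ.reg 10
  out : ∀ a, σ.arr 4 a = 0
  none : ∀ k < σ.reg 10, ∀ S, I.Stable S → ¬ I.Good m k S

/-- A good stable set has been found and written to the output. -/
def Found (I : Market) (m : ℕ) (σ : State) : Prop :=
  σ.reg 0 = 0 ∧ σ.reg 10 = m ∧ ∃ k < m, ∃ T, I.Stable T ∧ I.Good m k T ∧ Outputs I T σ

theorem iterProg_runs {I : Market} (hI : I.Strict) {nxt start : ℕ → ℕ} (hn : I.NextSpec nxt)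
    (hst : I.StartSpec start) {m k₀ : ℕ} (hm : I.Leveled m) (hk₀ : k₀ < m) (hk : k₀ < I.K)
    {σ : State} (h : Table I nxt start m σ) (h10 : σ.reg 10 = k₀) (hs : Searching I m σ) :
    Runs iterProg σ (I.K * 400 + 410) fun τ => Table I nxt start m τ ∧
      ((Searching I m τ ∧ τ.reg 10 = k₀ + 1) ∨ Found I m τ) := by
  have hS := hs
  refine Runs.mono (T := I.K * 100 + 100 + (I.K * 100 + 100 + (I.K * 100 + 100 +
    (I.K * 100 + 110)))) ?_ (by omega) fun _ h => h
  refine Runs.seq (setupProg_runs h h10).frame fun σ₁ ⟨f₁, a₁, a₂, a₃, a₄⟩ => ?_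
  have t₁ := h.of_sameOff f₁ (by decide) (by decide)
  -- The men of `J` are irrelevant to the run; only the new priorities matter.
  let J : Market := ⟨I.K, I.man, I.woman, σ₁.arr 10⟩
  refine Runs.seq (daProg_runs (J := J) t₁.K t₁.zero t₁.woman rfl rfl rfl rfl).frame
    fun σ₂ ⟨f₂, b⟩ => ?_
  have t₂ := t₁.of_sameOff f₂ (by decide) (by decide)
  have r₂ : ∀ r ∈ [0, 10, 11], σ₂.reg r = σ.reg r := by
    intro r hr
    rw [f₂.1 r, f₁.1 r] <;> revert r <;> decide
  refine Runs.seq (checkProg_runs t₂ ((r₂ 10 (by decide)).trans h10)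
    ((r₂ 11 (by decide)).trans (by rw [hs.shift, h10]))).frame fun σ₃ ⟨f₃, c⟩ => ?_
  have t₃ := t₂.of_sameOff f₃ (by decide) (by decide)
  have r₃ : ∀ r ∈ [0, 10, 11], σ₃.reg r = σ.reg r := by
    intro r hr
    rw [f₃.1 r, r₂ r hr]
    revert r; decide
  have h4 : σ₃.arr 4 = σ.arr 4 := by
    rw [f₃.2 4 (by decide), f₂.2 4 (by decide), f₁.2 4 (by decide)]
  have h13 : σ₃.arr 13 = σ₂.arr 13 := f₃.2 13 (by decide)
  obtain ⟨s1, s2⟩ := Market.search_spec hI hn hst hm hk₀ hk (J := J) rfl rfl a₁ a₂ a₃ a₄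
    (T := Market.DA.matching I (σ₂.arr 13)) (by rw [b])
  set T := Market.DA.matching I (σ₂.arr 13) with hT
  have fail : ¬ I.Good m k₀ T →
      Runs (block [.instr (.succ 10), .instr (.succ 11)]) σ₃ 2 fun τ => Table I nxt start m τ ∧
        ((Searching I m τ ∧ τ.reg 10 = k₀ + 1) ∨ Found I m τ) := by
    intro hg
    refine (Runs.instr _ _).seq fun τ hτ => (Runs.instr _ τ).mono le_rfl ?_
    subst hτ
    rintro _ rfl
    have e10 := (r₃ 10 (by decide)).trans h10
    have e11 := (r₃ 11 (by decide)).trans (hs.shift)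
    have e0 := (r₃ 0 (by decide)).trans (hs.res)
    refine ⟨?_, Or.inl ⟨⟨?_, ?_, ?_, ?_⟩, ?_⟩⟩
    · obtain ⟨g1, g2, g3, g4, g5, g6, g7, g8⟩ := t₃
      constructor <;> simpa [Instr.apply, State.setReg]
    · simpa [Instr.apply, State.setReg]
    · simp [Instr.apply, State.setReg, e10, e11, h10]; omega
    · simpa [Instr.apply, State.setReg, h4] using hs.out
    · intro k hk S hS hgS
      have hk : k < k₀ + 1 := by simpa [Instr.apply, State.setReg, e10] using hk
      rcases Nat.lt_succ_iff_lt_or_eq.1 hk with hk | rfl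
      · exact hs.none k (h10 ▸ hk) S hS hgS
      · exact hg (s2 S hS hgS)
    · simp [Instr.apply, State.setReg, e10]
  have wrap : ∀ {b : Test} {P Q : Program} {t : ℕ} {R : State → Prop},
      (b.Holds σ₃ → Runs P σ₃ t R) → (¬ b.Holds σ₃ → Runs Q σ₃ t R) →
      Runs (.ite b P Q) σ₃ (t + 1) R := by
    intro b P Q t R hp hq
    by_cases hb : b.Holds σ₃
    · obtain ⟨t, τ, he, ht, hR⟩ := hp hb
      exact ⟨1 + t, τ, he.ite_true hb, by omega, hR⟩
    · obtain ⟨t, τ, he, ht, hR⟩ := hq hb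
      exact ⟨1 + t, τ, he.ite_false hb, by omega, hR⟩
  have z := t₃.zero
  refine wrap (t := I.K * 100 + 109) (fun h34 => ?_) fun h34 => (fail ?_).mono (by omega) fun _ h => h
  swap
  · simp only [Test.Holds, z] at h34
    exact fun hg => h34 (c.1 hg).1
  refine wrap (t := I.K * 100 + 108) (fun h35 => ?_) fun h35 => (fail ?_).mono (by omega) fun _ h => h
  swap
  · simp only [Test.Holds, z] at h35
    exact fun hg => h35 (c.1 hg).2.1
  refine wrap (t := I.K * 100 + 107) (fun h36 => ?_) fun h36 => (fail ?_).mono (by omega) fun _ h => h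
  swap
  · simp only [Test.Holds, z] at h36
    exact fun hg => h36 (c.1 hg).2.2
  simp only [Test.Holds, z] at h34 h35 h36
  have hg := c.2 ⟨h34, h35, h36⟩
  have hst := s1 hg
  have hO := outputProg_runs t₃ (by rw [h4]; exact hs.out) (by rw [h13]; exact hst.1)
  rw [h13, ← hT] at hO
  refine Runs.mono (T := I.K * 100 + 100 + (1 + 1)) ?_ (by omega) fun _ h => h
  refine hO.frame.seq fun σ₄ ⟨f₄, o⟩ => ?_
  refine (Runs.instr _ _).seq fun τ hτ => (Runs.instr _ τ).mono le_rfl ?_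
  subst hτ
  rintro _ rfl
  have t₄ := t₃.of_sameOff f₄ (by decide) (by decide)
  refine ⟨?_, Or.inr ⟨?_, ?_, k₀, hk₀, T, hst, hg, ?_⟩⟩
  · obtain ⟨g1, g2, g3, g4, g5, g6, g7, g8⟩ := t₄
    constructor <;> simpa [Instr.apply, State.setReg]
  · simp [Instr.apply, State.setReg]
  · simp [Instr.apply, State.setReg, t₄.m]
  · simpa [Outputs, Instr.apply, State.setReg] using o

/-- Search for a good stable set. -/
def searchProg : Program :=
  block [.instr (.const 0 1), .instr (.const 10 0), .instr (.copy 11 2), .while (.lt 10 2) iterProg]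

/-- Each round is linear in `K` and either advances the parameter or jumps to `m`, so there are at
most `m` rounds. -/
theorem searchProg_runs {I : Market} (hI : I.Strict) {nxt start : ℕ → ℕ} (hn : I.NextSpec nxt)
    (hst : I.StartSpec start) {m : ℕ} (hm : I.Leveled m) (hmK : m ≤ I.K)
    {σ : State} (h : Table I nxt start m σ) (h4 : ∀ a, σ.arr 4 a = 0) :
    Runs searchProg σ (m * (I.K * 400 + 410 + 1) + 4) fun τ =>
      (τ.reg 0 = 1 ∧ ∀ k < m, ∀ S, I.Stable S → ¬ I.Good m k S) ∨
      (τ.reg 0 = 0 ∧ ∃ k < m, ∃ T, I.Stable T ∧ I.Good m k T ∧ Outputs I T τ) := by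
  refine Runs.mono (T := 1 + (1 + (1 + (m * (I.K * 400 + 410 + 1) + 1)))) ?_ (by omega) fun _ h => h
  refine (Runs.instr _ _).seq fun τ hτ => ?_
  subst hτ
  refine (Runs.instr _ _).seq fun τ hτ => ?_
  subst hτ
  refine (Runs.instr _ _).seq fun τ hτ => ?_
  subst hτ
  refine Runs.mono (Runs.while (c := I.K * 400 + 410) (μ := fun σ => m - σ.reg 10)
    (I := fun σ => Table I nxt start m σ ∧ (Searching I m σ ∨ Found I m σ)) ?_ _ ?_) ?_ ?_
  · rintro τ ⟨ht, hs⟩ hb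
    have hb : τ.reg 10 < m := by simpa [Test.Holds, ht.m] using hb
    rcases hs with hs | ⟨-, h10, -⟩
    · refine (iterProg_runs hI hn hst hm hb (hb.trans_le hmK) ht rfl hs).mono le_rfl ?_
      rintro υ ⟨ht', ⟨hs', h10⟩ | hf⟩
      · exact ⟨⟨ht', Or.inl hs'⟩, by omega⟩
      · exact ⟨⟨ht', Or.inr hf⟩, by have := hf.2.1; omega⟩
    · omega
  · refine ⟨?_, Or.inl ⟨?_, ?_, ?_, ?_⟩⟩
    · obtain ⟨g1, g2, g3, g4, g5, g6, g7, g8⟩ := h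
      constructor <;> simpa [Instr.apply, State.setReg]
    · simp [Instr.apply, State.setReg]
    · simp [Instr.apply, State.setReg, h.m]
    · simpa [Instr.apply, State.setReg] using h4
    · simp [Instr.apply, State.setReg]
  · simp [Instr.apply, State.setReg]
  · rintro τ ⟨⟨ht, hs | hf⟩, hb⟩
    · have hb : m ≤ τ.reg 10 := by simpa [Test.Holds, ht.m] using hb
      exact Or.inl ⟨hs.res, fun k hk => hs.none k (hk.trans_le hb)⟩
    · exact Or.inr ⟨hf.1, hf.2.2⟩

end RAM

/-! ### Building the tables of the market from the input lists. -/

namespace RAM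

/-- Compare entry `6` of the second list with entry `5` of the first one. -/
def crossBody : Program :=
  -- Register `13` is incremented before the test, so at entry `j` it shows `m + j + 1`. The extra
  -- `1` keeps low priorities above `m` and leaves `m` free for the truncation.
  block [.instr (.succ 13), .instr (.load 9 2 6),
    .ite (.eq 9 8)
      (block [.instr (.load 10 3 6),
        .ite (.eq 10 7) (block [.instr (.store 7 3 6), .instr (.store 7 5 13)]) .skip])
      .skip]

/-- Enter the two options of an edge into the tables. -/
def buildBody : Program :=
  block [.instr (.load 7 0 5), .instr (.store 5 5 7), .instr (.store 5 3 7),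
    .instr (.load 8 1 5), .instr (.store 6 5 8), .instr (.store 6 3 8), .instr (.copy 13 2),
    forLoop 6 2 crossBody, .instr (.succ 3)]

/-- Build the tables of men, women and priorities. -/
def buildProg : Program := block [.instr (.copy 3 2), forLoop 5 2 buildBody]

theorem cross_runs {m i c : ℕ} {σ : State} (h2 : σ.reg 2 = m) (h3 : σ.reg 3 = m + i)
    (h5 : σ.reg 5 = i) (h13 : σ.reg 13 = m) (hc : c < m)
    (hcr : ∀ j < m, σ.arr 2 j = σ.reg 8 ∧ σ.arr 3 j = σ.reg 7 ↔ j = c) :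
    Runs (forLoop 6 2 crossBody) σ (m * 20 + 2) fun τ =>
      τ.arr 7 = Function.update (Function.update (σ.arr 7) (m + i) c) i (m + c + 1) := by
  refine (Runs.forLoop (N := m) (c := crossBody.cost)
    (I := fun j τ => τ.reg 13 = m + j ∧ (j ≤ c → τ.arr 7 = σ.arr 7) ∧
      (c < j → τ.arr 7 = Function.update (Function.update (σ.arr 7) (m + i) c) i (m + c + 1)))
    (by decide) (by decide) h2 ?_ ?_).mono ?_ ?_
  · simp [State.setReg, h13]
  · rintro j hj τ hj6 hs ⟨i1, i2, i3⟩
    refine Runs.loopFree (by simp [crossBody, block, Program.LoopFree]) ?_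
    have e3 := (hs.1 3 (by decide)).trans h3
    have e5 := (hs.1 5 (by decide)).trans h5
    have e7 := hs.1 7 (by decide)
    have e8 := hs.1 8 (by decide)
    have a2 := hs.2 2 (by decide)
    have a3 := hs.2 3 (by decide)
    have hcj := hcr j hj
    have e13 : (crossBody.eval τ).reg 13 = m + (j + 1) := by
      by_cases c1 : σ.arr 2 j = σ.reg 8 <;> by_cases c2 : σ.arr 3 j = σ.reg 7 <;>
        simp [crossBody, block, Program.eval, Test.Holds, Instr.apply, State.setReg,
          State.setArr, e3, e5, e7, e8, a2, a3, i1, hj6, c1, c2] <;> omega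
    refine ⟨by simpa [State.setReg] using e13, ?_, ?_⟩
    · intro hle
      have hne : ¬ (σ.arr 2 j = σ.reg 8 ∧ σ.arr 3 j = σ.reg 7) := fun h => by
        have := hcj.1 h; omega
      rw [← i2 (by omega)]
      by_cases c1 : σ.arr 2 j = σ.reg 8
      · have c2 : ¬ σ.arr 3 j = σ.reg 7 := fun h => hne ⟨c1, h⟩
        simp [crossBody, block, Program.eval, Test.Holds, Instr.apply, State.setReg,
          e7, e8, a2, a3, hj6, c1, c2]
      · simp [crossBody, block, Program.eval, Test.Holds, Instr.apply, State.setReg,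
          e8, a2, hj6, c1]
    · intro hle
      rcases Nat.lt_succ_iff_lt_or_eq.1 hle with hlt | rfl
      · have hne : ¬ (σ.arr 2 j = σ.reg 8 ∧ σ.arr 3 j = σ.reg 7) := fun h => by
          have := hcj.1 h; omega
        rw [← i3 hlt]
        by_cases c1 : σ.arr 2 j = σ.reg 8
        · have c2 : ¬ σ.arr 3 j = σ.reg 7 := fun h => hne ⟨c1, h⟩
          simp [crossBody, block, Program.eval, Test.Holds, Instr.apply, State.setReg,
            e7, e8, a2, a3, hj6, c1, c2]
        · simp [crossBody, block, Program.eval, Test.Holds, Instr.apply, State.setReg,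
            e8, a2, hj6, c1]
      · obtain ⟨c1, c2⟩ := hcj.2 rfl
        simp [crossBody, block, Program.eval, Test.Holds, Instr.apply, State.setReg,
          State.setArr, e3, e5, e7, e8, a2, a3, i1, hj6, c1, c2, i2 le_rfl]
  · have : crossBody.cost ≤ 18 := by decide
    nlinarith
  · exact fun τ h => h.2.2 hc

theorem buildProg_runs {m : ℕ} {cross : ℕ → ℕ} {σ : State} (h2 : σ.reg 2 = m)
    (hc : ∀ i < m, cross i < m)
    (hcr : ∀ i < m, ∀ j < m, σ.arr 2 j = σ.arr 1 i ∧ σ.arr 3 j = σ.arr 0 i ↔ j = cross i) :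
    Runs buildProg σ (m * (m * 20 + 50) + 50) fun τ => τ.reg 3 = m + m ∧ ∀ i < m,
      τ.arr 5 i = σ.arr 0 i ∧ τ.arr 5 (m + i) = σ.arr 0 i ∧
      τ.arr 6 i = σ.arr 1 i ∧ τ.arr 6 (m + i) = σ.arr 1 i ∧
      τ.arr 7 i = m + cross i + 1 ∧ τ.arr 7 (m + i) = cross i := by
  refine Runs.mono (T := 1 + (m * ((m * 20 + 10) + 2) + 2)) ?_ (by nlinarith) fun _ h => h
  refine (Runs.instr _ σ).seq fun τ hτ => ?_
  subst hτ
  set σ' := (Instr.copy 3 2).apply σ with hσ'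
  have hr2 : σ'.reg 2 = m := by simpa [hσ', Instr.apply, State.setReg]
  have hr3 : σ'.reg 3 = m := by simpa [hσ', Instr.apply, State.setReg]
  have harr : σ'.arr = σ.arr := by simp [hσ', Instr.apply, State.setReg]
  clear_value σ'
  refine Runs.forLoop (N := m) (c := m * 20 + 10)
    (I := fun j τ => τ.reg 3 = m + j ∧ ∀ i < j,
      τ.arr 5 i = σ.arr 0 i ∧ τ.arr 5 (m + i) = σ.arr 0 i ∧
      τ.arr 6 i = σ.arr 1 i ∧ τ.arr 6 (m + i) = σ.arr 1 i ∧
      τ.arr 7 i = m + cross i + 1 ∧ τ.arr 7 (m + i) = cross i)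
    (by decide) (by decide) hr2 ?_ ?_
  · simp [State.setReg, hr3]
  · rintro j hj τ hj5 hs ⟨i1, i2⟩
    have e2 := (hs.1 2 (by decide)).trans hr2
    have a0 : τ.arr 0 = σ.arr 0 := (hs.2 0 (by decide)).trans (by rw [harr])
    have a1 : τ.arr 1 = σ.arr 1 := (hs.2 1 (by decide)).trans (by rw [harr])
    have a2 : τ.arr 2 = σ.arr 2 := (hs.2 2 (by decide)).trans (by rw [harr])
    have a3 : τ.arr 3 = σ.arr 3 := (hs.2 3 (by decide)).trans (by rw [harr])
    refine Runs.mono (T := 1 + (1 + (1 + (1 + (1 + (1 + (1 + ((m * 20 + 2) + 1))))))))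
      ?_ (by omega) fun _ h => h
    refine (Runs.instr _ _).seq fun υ hυ => ?_
    subst hυ
    refine (Runs.instr _ _).seq fun υ hυ => ?_
    subst hυ
    refine (Runs.instr _ _).seq fun υ hυ => ?_
    subst hυ
    refine (Runs.instr _ _).seq fun υ hυ => ?_
    subst hυ
    refine (Runs.instr _ _).seq fun υ hυ => ?_
    subst hυ
    refine (Runs.instr _ _).seq fun υ hυ => ?_
    subst hυ
    refine (Runs.instr _ _).seq fun υ hυ => ?_
    subst hυ
    set τ' := (Instr.copy 13 2).apply _ with hτ'
    have b2 : τ'.reg 2 = m := by simpa [hτ', Instr.apply, State.setReg, State.setArr]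
    have b3 : τ'.reg 3 = m + j := by simpa [hτ', Instr.apply, State.setReg, State.setArr]
    have b5 : τ'.reg 5 = j := by simpa [hτ', Instr.apply, State.setReg, State.setArr]
    have b7 : τ'.reg 7 = σ.arr 0 j := by
      simp [hτ', Instr.apply, State.setReg, State.setArr, hj5, a0]
    have b8 : τ'.reg 8 = σ.arr 1 j := by
      simp [hτ', Instr.apply, State.setReg, State.setArr, hj5, a1]
    have b13 : τ'.reg 13 = m := by simpa [hτ', Instr.apply, State.setReg, State.setArr]
    have d2 : τ'.arr 2 = σ.arr 2 := by simp [hτ', Instr.apply, State.setReg, State.setArr, a2]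
    have d3 : τ'.arr 3 = σ.arr 3 := by simp [hτ', Instr.apply, State.setReg, State.setArr, a3]
    have d5 : τ'.arr 5 = Function.update (Function.update (τ.arr 5) j (σ.arr 0 j)) (m + j)
        (σ.arr 0 j) := by
      simp [hτ', Instr.apply, State.setReg, State.setArr, hj5, i1, a0]
    have d6 : τ'.arr 6 = Function.update (Function.update (τ.arr 6) j (σ.arr 1 j)) (m + j)
        (σ.arr 1 j) := by
      simp [hτ', Instr.apply, State.setReg, State.setArr, hj5, i1, a1]
    have d7 : τ'.arr 7 = τ.arr 7 := by simp [hτ', Instr.apply, State.setReg, State.setArr]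
    clear_value τ'
    refine (cross_runs b2 b3 b5 b13 (hc j hj) (fun l hl => by
      rw [d2, d3, b7, b8]; exact hcr j hj l hl)).frame.seq fun υ ⟨hυ, h7⟩ =>
      (Runs.instr _ _).mono le_rfl ?_
    rintro _ rfl
    have f3 := (hυ.1 3 (by decide)).trans b3
    have f5 := (hυ.2 5 (by decide)).trans d5
    have f6 := (hυ.2 6 (by decide)).trans d6
    rw [d7] at h7
    simp only [Instr.apply, State.setReg, f3, f5, f6, h7]
    refine ⟨by simp; omega, fun i hi => ?_⟩
    rcases Nat.lt_succ_iff_lt_or_eq.1 hi with hi | rfl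
    · have n1 : i ≠ j := hi.ne
      have n2 : i ≠ m + j := by omega
      have n3 : m + i ≠ j := by omega
      have n4 : m + i ≠ m + j := by omega
      simpa [Function.update_of_ne, n1, n2, n3] using i2 i hi
    · have n2 : i ≠ m + i := by omega
      have n3 : m + i ≠ i := by omega
      simp only [Function.update_self, Function.update_of_ne n2, Function.update_of_ne n3,
        and_self]

/-- Compare option `6` with option `5`. -/
def linkBody : Program :=
  block [.instr (.load 9 5 6),
    .ite (.eq 9 8)
      (.ite (.lt 6 5) (.instr (.store 9 5 4))
        (.ite (.lt 5 6)
          (block [.instr (.load 10 8 5),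
            .ite (.eq 10 4)
              (block [.instr (.copy 11 6), .instr (.succ 11), .instr (.store 8 5 11)]) .skip])
          .skip))
      .skip]

/-- Build the tables of successors and starts. -/
def linkProg : Program :=
  forLoop 5 3 (block [.instr (.const 7 1), .instr (.store 9 5 7), .instr (.store 8 5 4),
    .instr (.load 8 5 5), forLoop 6 3 linkBody])

/-- The entry for `i` in the tables of successors and starts, as far as the options below `j` are
concerned. -/
def LinkRow (man : ℕ → ℕ) (i j n s : ℕ) : Prop :=
  (s ≠ 0 ↔ ∀ l < j, l < i → man l ≠ man i) ∧
    ((n = 0 ∧ ∀ l < j, i < l → man l ≠ man i) ∨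
      ∃ l, n = l + 1 ∧ i < l ∧ l < j ∧ man l = man i ∧ ∀ q, i < q → q < l → man q ≠ man i)

/-- The scan is upwards, so the first later option of the same man fills the empty successor cell
and subsequent ones find it occupied; an earlier option of that man erases the start mark. -/
theorem linkRow_runs {K i : ℕ} {man : ℕ → ℕ} {σ : State} (h3 : σ.reg 3 = K) (h4 : σ.reg 4 = 0)
    (h5 : σ.reg 5 = i) (h8 : σ.reg 8 = man i) (a5 : σ.arr 5 = man) (a8 : σ.arr 8 i = 0)
    (a9 : σ.arr 9 i = 1) :
    Runs (forLoop 6 3 linkBody) σ (K * 20 + 2) fun τ =>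
      (∀ k, k ≠ i → τ.arr 8 k = σ.arr 8 k ∧ τ.arr 9 k = σ.arr 9 k) ∧
      LinkRow man i K (τ.arr 8 i) (τ.arr 9 i) := by
  refine (Runs.forLoop (N := K) (c := linkBody.cost)
    (I := fun j τ => (∀ k, k ≠ i → τ.arr 8 k = σ.arr 8 k ∧ τ.arr 9 k = σ.arr 9 k) ∧
      LinkRow man i j (τ.arr 8 i) (τ.arr 9 i))
    (by decide) (by decide) h3 ?_ ?_).mono ?_ ?_
  · simp [State.setReg, LinkRow, a8, a9]
  · rintro j hj τ hj6 hs ⟨i1, i2, i3⟩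
    refine Runs.loopFree (by simp [linkBody, block, Program.LoopFree]) ?_
    have e4 := (hs.1 4 (by decide)).trans h4
    have e5 := (hs.1 5 (by decide)).trans h5
    have e8 := (hs.1 8 (by decide)).trans h8
    have f5 := (hs.2 5 (by decide)).trans a5
    simp only [State.setReg]
    by_cases c1 : man j = man i
    · rcases lt_trichotomy j i with c2 | c2 | c2
      · have x8 : (linkBody.eval τ).arr 8 = τ.arr 8 := by
          simp [linkBody, block, Program.eval, Test.Holds, Instr.apply, State.setReg,
            State.setArr, e4, e5, e8, f5, hj6, c1, c2]
        have x9 : (linkBody.eval τ).arr 9 = Function.update (τ.arr 9) i 0 := by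
          simp [linkBody, block, Program.eval, Test.Holds, Instr.apply, State.setReg,
            State.setArr, e4, e5, e8, f5, hj6, c1, c2]
        rw [x8, x9]
        refine ⟨fun k hk => by rw [Function.update_of_ne hk]; exact i1 k hk, ?_, ?_⟩
        · simp only [Function.update_self, ne_eq, not_true_eq_false, false_iff]
          exact fun h => h j (Nat.lt_succ_self j) c2 c1
        · rcases i3 with ⟨h1, h2⟩ | ⟨l, h1, h2, h3, h4⟩
          · refine Or.inl ⟨h1, fun l hl hil => h2 l (by omega) hil⟩
          · exact absurd h3 (by omega)
      · have hx : linkBody.eval τ = τ.setReg 9 (man j) := by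
          simp [linkBody, block, Program.eval, Test.Holds, Instr.apply, State.setReg,
            e5, e8, f5, hj6, c2]
        rw [hx]
        simp only [State.setReg]
        refine ⟨i1, i2.trans ?_, ?_⟩
        · exact ⟨fun h l _ hl => h l (by omega) hl, fun h l _ hl => h l (by omega) hl⟩
        · rcases i3 with ⟨h1, h2⟩ | ⟨l, h1, h2, h3, h4⟩
          · refine Or.inl ⟨h1, fun l hl hil => h2 l (by omega) hil⟩
          · exact absurd h3 (by omega)
      · have c2' : ¬ j < i := by omega
        have x9 : (linkBody.eval τ).arr 9 = τ.arr 9 := by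
          by_cases c3 : τ.arr 8 i = 0 <;>
          simp [linkBody, block, Program.eval, Test.Holds, Instr.apply, State.setReg,
            State.setArr, e4, e5, e8, f5, hj6, c1, c2, c2', c3]
        have hs' : (τ.arr 9 i ≠ 0 ↔ ∀ l < j + 1, l < i → man l ≠ man i) := i2.trans
          ⟨fun h l _ hl => h l (by omega) hl, fun h l _ hl => h l (by omega) hl⟩
        by_cases c3 : τ.arr 8 i = 0
        · have x8 : (linkBody.eval τ).arr 8 = Function.update (τ.arr 8) i (j + 1) := by
            simp [linkBody, block, Program.eval, Test.Holds, Instr.apply, State.setReg,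
              State.setArr, e4, e5, e8, f5, hj6, c1, c2, c2', c3]
          rw [x8, x9]
          refine ⟨fun k hk => by rw [Function.update_of_ne hk]; exact i1 k hk, hs', Or.inr ?_⟩
          rcases i3 with ⟨h1, h2⟩ | ⟨l, h1, -⟩
          · exact ⟨j, by simp, c2, Nat.lt_succ_self j, c1, fun q hq hqj => h2 q hqj hq⟩
          · omega
        · have x8 : (linkBody.eval τ).arr 8 = τ.arr 8 := by
            simp [linkBody, block, Program.eval, Test.Holds, Instr.apply, State.setReg,
              e4, e5, e8, f5, hj6, c1, c2, c2', c3]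
          rw [x8, x9]
          refine ⟨i1, hs', Or.inr ?_⟩
          rcases i3 with ⟨h1, -⟩ | ⟨l, h1, h2, h3, h4⟩
          · exact absurd h1 c3
          · exact ⟨l, h1, h2, by omega, h4⟩
    · have hx : linkBody.eval τ = τ.setReg 9 (man j) := by
        simp [linkBody, block, Program.eval, Test.Holds, Instr.apply, State.setReg,
          e8, f5, hj6, c1]
      rw [hx]
      simp only [State.setReg]
      refine ⟨i1, i2.trans ?_, ?_⟩
      · rw [Nat.forall_lt_succ_right]
        exact (and_iff_left fun _ => c1).symm
      · rcases i3 with ⟨h1, h2⟩ | ⟨l, h1, h2, h3, h4⟩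
        · refine Or.inl ⟨h1, Nat.forall_lt_succ_right.2 ⟨h2, fun _ => c1⟩⟩
        · exact Or.inr ⟨l, h1, h2, by omega, h4⟩
  · have : linkBody.cost ≤ 18 := by decide
    nlinarith
  · exact fun τ h => h

theorem linkProg_runs {I : Market} {σ : State} (h3 : σ.reg 3 = I.K) (h4 : σ.reg 4 = 0)
    (a5 : σ.arr 5 = I.man) :
    Runs linkProg σ (I.K * (I.K * 20 + 10) + 2) fun τ =>
      I.NextSpec (τ.arr 8) ∧ I.StartSpec (τ.arr 9) := by
  refine Runs.mono (T := I.K * ((I.K * 20 + 6) + 2) + 2) (Runs.forLoop (N := I.K)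
    (c := I.K * 20 + 6)
    (I := fun j τ => ∀ i < j, LinkRow I.man i I.K (τ.arr 8 i) (τ.arr 9 i))
    (by decide) (by decide) h3 ?_ ?_) (by nlinarith) ?_
  · simp
  · rintro j hj τ hj5 hs hI
    have e3 := (hs.1 3 (by decide)).trans h3
    have e4 := (hs.1 4 (by decide)).trans h4
    have f5 := (hs.2 5 (by decide)).trans a5
    refine Runs.mono (T := 1 + (1 + (1 + (1 + (I.K * 20 + 2))))) ?_ (by omega) fun _ h => h
    refine (Runs.instr _ _).seq fun υ hυ => ?_
    subst hυ
    refine (Runs.instr _ _).seq fun υ hυ => ?_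
    subst hυ
    refine (Runs.instr _ _).seq fun υ hυ => ?_
    subst hυ
    refine (Runs.instr _ _).seq fun υ hυ => ?_
    subst hυ
    refine (linkRow_runs (K := I.K) (i := j) (man := I.man) ?_ ?_ ?_ ?_ ?_ ?_ ?_).mono le_rfl ?_
    · simpa [Instr.apply, State.setReg, State.setArr]
    · simpa [Instr.apply, State.setReg, State.setArr]
    · simpa [Instr.apply, State.setReg, State.setArr]
    · simp [Instr.apply, State.setReg, State.setArr, f5, hj5]
    · simpa [Instr.apply, State.setReg, State.setArr]
    · simp [Instr.apply, State.setReg, State.setArr, hj5, e4]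
    · simp [Instr.apply, State.setReg, State.setArr, hj5]
    · rintro υ ⟨h1, h2⟩ i hi
      simp only [State.setReg]
      rcases Nat.lt_succ_iff_lt_or_eq.1 hi with hi | rfl
      · obtain ⟨h3, h4⟩ := h1 i hi.ne
        rw [h3, h4]
        simpa [Instr.apply, State.setReg, State.setArr, hj5, Function.update_of_ne hi.ne]
          using hI i hi
      · exact h2
  · intro τ h
    refine ⟨fun k hk => ?_, fun k hk => ?_⟩
    · rcases (h k hk).2 with ⟨h1, h2⟩ | ⟨l, h1, h2, h3, h4, h5⟩
      · exact Or.inl ⟨h1, fun l hkl hl => h2 l hl hkl⟩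
      · exact Or.inr ⟨l, h1, h2, h3, h4, h5⟩
    · rw [(h k hk).1]
      exact ⟨fun h j hj => h j (hj.trans hk) hj, fun h l _ hl => h l hl⟩

/-- The whole algorithm. -/
def mainProg : Program := block [buildProg, linkProg, searchProg]

theorem mainProg_runs {m : ℕ} {cross : ℕ → ℕ} {σ : State} (h2 : σ.reg 2 = m)
    (hz : σ.reg 4 = 0) (h4 : ∀ a, σ.arr 4 a = 0) (hc : ∀ i < m, cross i < m)
    (hinj : ∀ i < m, ∀ j < m, cross i = cross j → i = j)
    (hcr : ∀ i < m, ∀ j < m, σ.arr 2 j = σ.arr 1 i ∧ σ.arr 3 j = σ.arr 0 i ↔ j = cross i) :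
    Runs mainProg σ (10000 * (m ^ 2 + 1)) fun τ => ∃ I : Market,
      I.Doubles m (σ.arr 0) (σ.arr 1) cross ∧
      ((τ.reg 0 = 1 ∧ ∀ k < m, ∀ S, I.Stable S → ¬ I.Good m k S) ∨
      (τ.reg 0 = 0 ∧ ∃ k < m, ∃ T, I.Stable T ∧ I.Good m k T ∧ Outputs I T τ)) := by
  -- The three summands bound matching the two lists, linking the `2 * m` options, and `m` rounds of
  -- search with `K = m + m`.
  refine Runs.mono (T := (m * (m * 20 + 50) + 50) + (((m + m) * ((m + m) * 20 + 10) + 2) +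
    (m * ((m + m) * 400 + 410 + 1) + 4))) ?_ ?_ fun _ h => h
  · refine (buildProg_runs h2 hc hcr).frame.seq fun σ₁ ⟨f₁, h3, ht⟩ => ?_
    let I : Market := ⟨m + m, σ₁.arr 5, σ₁.arr 6, σ₁.arr 7⟩
    have hd : I.Doubles m (σ.arr 0) (σ.arr 1) cross := ⟨rfl, fun i hi => (ht i hi).1,
      fun i hi => (ht i hi).2.1, fun i hi => (ht i hi).2.2.1, fun i hi => (ht i hi).2.2.2.1,
      fun i hi => (ht i hi).2.2.2.2.1, fun i hi => (ht i hi).2.2.2.2.2⟩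
    have z₁ : σ₁.reg 4 = 0 := (f₁.1 4 (by decide)).trans hz
    refine (linkProg_runs (I := I) h3 z₁ rfl).frame.seq fun σ₂ ⟨f₂, hn, hs⟩ => ?_
    refine (searchProg_runs (hd.strict hc hinj) hn hs (hd.leveled hc) (Nat.le_add_left m m)
      ?_ ?_).mono le_rfl ?_
    · exact ⟨by rw [f₂.1 2 (by decide), f₁.1 2 (by decide), h2],
        by rw [f₂.1 3 (by decide), h3], by rw [f₂.1 4 (by decide), z₁],
        f₂.2 5 (by decide), f₂.2 6 (by decide), f₂.2 7 (by decide), rfl, rfl⟩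
    · rw [f₂.2 4 (by decide), f₁.2 4 (by decide)]
      exact h4
    · exact fun τ h => ⟨I, hd, h⟩
  · rcases m with _ | m
    · norm_num
    · nlinarith

end RAM

/-! ### Positions in concatenated labelled lists. -/

theorem List.Nodup.pairwise_idxOf {α : Type*} [DecidableEq α] {l : List α} (h : l.Nodup) :
    l.Pairwise fun x y => l.idxOf x < l.idxOf y := by
  rw [List.pairwise_iff_getElem]
  intro i j hi hj hij
  rwa [h.idxOf_getElem, h.idxOf_getElem]

/-- In the concatenation of labelled lists, entries with the same label are ordered as in their
list. -/
theorem List.idxOf_flatMap_lt_iff {α β : Type*} [DecidableEq α] [DecidableEq β] {l : List α}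
    (hl : l.Nodup) {p : α → List β} (hp : ∀ a, (p a).Nodup) {a : α} (ha : a ∈ l) {b c : β}
    (hb : b ∈ p a) (hc : c ∈ p a) :
    (l.flatMap fun a => (p a).map fun b => (a, b)).idxOf (a, b) <
      (l.flatMap fun a => (p a).map fun b => (a, b)).idxOf (a, c) ↔
        (p a).idxOf b < (p a).idxOf c := by
  set L := l.flatMap fun a => (p a).map fun b => (a, b) with hL
  have hmem : ∀ d ∈ p a, (a, d) ∈ L := by
    intro d hd
    simp [hL, ha, hd]
  have hpw : L.Pairwise fun e f => e.1 = f.1 → (p e.1).idxOf e.2 < (p e.1).idxOf f.2 := by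
    rw [hL, List.pairwise_flatMap]
    refine ⟨fun a _ => ?_, hl.imp fun {a a'} hne => ?_⟩
    · rw [List.pairwise_map]
      simpa using (hp a).pairwise_idxOf
    · simp only [List.mem_map]
      rintro _ ⟨x, -, rfl⟩ _ ⟨y, -, rfl⟩ h
      exact absurd h hne
  rw [List.pairwise_iff_getElem] at hpw
  have key : ∀ x ∈ p a, ∀ y ∈ p a, L.idxOf (a, x) < L.idxOf (a, y) →
      (p a).idxOf x < (p a).idxOf y := by
    intro x hx y hy h
    have h1 := List.idxOf_lt_length_iff.2 (hmem x hx)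
    have h2 := List.idxOf_lt_length_iff.2 (hmem y hy)
    have := hpw _ _ h1 h2 h
    rw [List.getElem_idxOf, List.getElem_idxOf] at this
    exact this rfl
  refine ⟨key b hb c hc, fun h => ?_⟩
  by_contra hle
  rcases (not_lt.1 hle).eq_or_lt with he | hlt
  · have := (List.idxOf_inj (hmem c hc)).1 he
    rw [Prod.mk.injEq] at this
    rw [this.2] at h
    exact lt_irrefl _ h
  · exact absurd (key c hc b hb hlt) (by omega)

theorem List.nodup_flatMap_label {α β : Type*} {l : List α}
    (hl : l.Nodup) {p : α → List β} (hp : ∀ a, (p a).Nodup) :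
    (l.flatMap fun a => (p a).map fun b => (a, b)).Nodup := by
  rw [List.nodup_flatMap]
  refine ⟨fun a _ => (hp a).map fun x y h => (Prod.mk.inj h).2, hl.imp fun {a a'} hne => ?_⟩
  simp only [Function.onFun, List.disjoint_left, List.mem_map]
  rintro _ ⟨x, -, rfl⟩ ⟨y, -, h⟩
  exact hne (Prod.mk.inj h).1.symm

/-! ### Edges as positions in the input, and the market of an instance. -/

namespace MarriageInstance

variable (G : MarriageInstance)

theorem mem_edges {G : MarriageInstance} {e : Fin G.nA × Fin G.nB} :
    e ∈ G.edges ↔ e.2 ∈ G.prefA e.1 := by simp [edges]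

theorem mem_edges' {G : MarriageInstance} {e : Fin G.nA × Fin G.nB} :
    e ∈ G.edges ↔ e.1 ∈ G.prefB e.2 := by rw [mem_edges, G.mem_iff]

theorem mem_entriesA {G : MarriageInstance} {e : Fin G.nA × Fin G.nB} :
    e ∈ G.entriesA ↔ e ∈ G.edges := by
  obtain ⟨a, b⟩ := e
  simp [entriesA, mem_edges]

theorem mem_entriesB {G : MarriageInstance} {e : Fin G.nB × Fin G.nA} :
    e ∈ G.entriesB ↔ e.swap ∈ G.edges := by
  obtain ⟨a, b⟩ := e
  simp [entriesB, mem_edges']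

theorem nodup_entriesA : G.entriesA.Nodup :=
  List.nodup_flatMap_label (List.nodup_finRange _) G.nodupA

theorem nodup_entriesB : G.entriesB.Nodup :=
  List.nodup_flatMap_label (List.nodup_finRange _) G.nodupB

theorem length_entriesA : G.entriesA.length = G.m := by
  rw [← List.toFinset_card_of_nodup G.nodup_entriesA, m]
  congr 1
  ext e
  rw [List.mem_toFinset, mem_entriesA]

theorem length_entriesB : G.entriesB.length = G.m := by
  rw [← List.toFinset_card_of_nodup G.nodup_entriesB, m]
  refine Finset.card_bij (fun e _ => e.swap) ?_ ?_ ?_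
  · intro e he
    rwa [List.mem_toFinset, mem_entriesB] at he
  · intro e _ f _ h
    exact Prod.swap_injective h
  · intro e he
    exact ⟨e.swap, by rwa [List.mem_toFinset, mem_entriesB, Prod.swap_swap], Prod.swap_swap e⟩

/-- The position of an edge in the concatenated lists of `A`. -/
def ix (e : Fin G.nA × Fin G.nB) : ℕ := G.entriesA.idxOf e

/-- The position of an edge in the concatenated lists of `B`. -/
def jx (e : Fin G.nA × Fin G.nB) : ℕ := G.entriesB.idxOf e.swap

variable {G}

theorem ix_lt {e : Fin G.nA × Fin G.nB} (he : e ∈ G.edges) : G.ix e < G.m := by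
  rw [← length_entriesA]
  exact List.idxOf_lt_length_iff.2 (mem_entriesA.2 he)

theorem jx_lt {e : Fin G.nA × Fin G.nB} (he : e ∈ G.edges) : G.jx e < G.m := by
  rw [← length_entriesB]
  exact List.idxOf_lt_length_iff.2 (mem_entriesB.2 (by rwa [Prod.swap_swap]))

theorem ix_inj {e f : Fin G.nA × Fin G.nB} (he : e ∈ G.edges) (h : G.ix e = G.ix f) : e = f :=
  (List.idxOf_inj (mem_entriesA.2 he)).1 h

theorem jx_inj {e f : Fin G.nA × Fin G.nB} (he : e ∈ G.edges) (h : G.jx e = G.jx f) : e = f :=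
  Prod.swap_injective ((List.idxOf_inj (mem_entriesB.2 (by rwa [Prod.swap_swap]))).1 h)

theorem exists_ix {i : ℕ} (hi : i < G.m) : ∃ e ∈ G.edges, G.ix e = i := by
  rw [← length_entriesA] at hi
  exact ⟨G.entriesA[i], mem_entriesA.1 (List.getElem_mem hi), G.nodup_entriesA.idxOf_getElem i hi⟩

theorem exists_jx {i : ℕ} (hi : i < G.m) : ∃ e ∈ G.edges, G.jx e = i := by
  rw [← length_entriesB] at hi
  exact ⟨G.entriesB[i].swap, mem_entriesB.1 (List.getElem_mem hi), by
    rw [jx, Prod.swap_swap]; exact G.nodup_entriesB.idxOf_getElem i hi⟩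

/-- Preferences become comparisons of positions in the input, so the input order itself serves as
the men's ranking in the market; `jx` plays this part for the women. -/
theorem ranksA_iff {a : Fin G.nA} {b c : Fin G.nB} (hb : (a, b) ∈ G.edges)
    (hc : (a, c) ∈ G.edges) : G.RanksA a b c ↔ G.ix (a, b) < G.ix (a, c) :=
  (List.idxOf_flatMap_lt_iff (List.nodup_finRange _) G.nodupA (List.mem_finRange a)
    (mem_edges.1 hb) (mem_edges.1 hc)).symm

theorem ranksB_iff {b : Fin G.nB} {a c : Fin G.nA} (ha : (a, b) ∈ G.edges)
    (hc : (c, b) ∈ G.edges) : G.RanksB b a c ↔ G.jx (a, b) < G.jx (c, b) :=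
  (List.idxOf_flatMap_lt_iff (List.nodup_finRange _) G.nodupB (List.mem_finRange b)
    (mem_edges'.1 ha) (mem_edges'.1 hc)).symm

theorem getElem?_ix {e : Fin G.nA × Fin G.nB} (he : e ∈ G.edges) :
    G.entriesA[G.ix e]? = some e := by
  rw [List.getElem?_eq_some_iff]
  exact ⟨by rw [length_entriesA]; exact ix_lt he, List.getElem_idxOf _⟩

theorem getElem?_jx {e : Fin G.nA × Fin G.nB} (he : e ∈ G.edges) :
    G.entriesB[G.jx e]? = some e.swap := by
  rw [List.getElem?_eq_some_iff]
  exact ⟨by rw [length_entriesB]; exact jx_lt he, List.getElem_idxOf _⟩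

variable (G) in
/-- The position in the lists of `B` of the edge at position `i` in the lists of `A`. -/
def cross (i : ℕ) : ℕ := (G.entriesA[i]?).elim 0 G.jx

theorem cross_ix {e : Fin G.nA × Fin G.nB} (he : e ∈ G.edges) : G.cross (G.ix e) = G.jx e := by
  rw [cross, getElem?_ix he]; rfl

/-- The market of `G`. -/
def MarketOf (G : MarriageInstance) (I : Market) : Prop :=
  I.Doubles G.m (G.input.arr 0) (G.input.arr 1) G.cross

/-- The side conditions say that every entry of the lists of `A` has exactly one counterpart in
those of `B`, which `cross` records. -/
theorem mainProg_runs (G : MarriageInstance) :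
    RAM.Runs RAM.mainProg G.input (10000 * (G.m ^ 2 + 1)) fun τ => ∃ I : Market, G.MarketOf I ∧
      ((τ.reg 0 = 1 ∧ ∀ k < G.m, ∀ S, I.Stable S → ¬ I.Good G.m k S) ∨
      (τ.reg 0 = 0 ∧ ∃ k < G.m, ∃ T, I.Stable T ∧ I.Good G.m k T ∧ RAM.Outputs I T τ)) := by
  refine RAM.mainProg_runs rfl rfl (fun _ => rfl) ?_ ?_ ?_
  · intro i hi
    obtain ⟨e, he, rfl⟩ := exists_ix hi
    rw [cross_ix he]
    exact jx_lt he
  · intro i hi j hj h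
    obtain ⟨e, he, rfl⟩ := exists_ix hi
    obtain ⟨f, hf, rfl⟩ := exists_ix hj
    rw [cross_ix he, cross_ix hf] at h
    rw [jx_inj he h]
  · intro i hi j hj
    obtain ⟨e, he, rfl⟩ := exists_ix hi
    obtain ⟨f, hf, rfl⟩ := exists_jx hj
    rw [cross_ix he]
    simp only [input, getElem?_ix he, getElem?_jx hf, Option.elim_some, Prod.fst_swap,
      Prod.snd_swap]
    constructor
    · rintro ⟨h1, h2⟩
      rw [Prod.ext (Fin.ext h2) (Fin.ext h1)]
    · intro h
      rw [jx_inj hf h]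
      exact ⟨rfl, rfl⟩

section Market

variable {I : Market} {e f : Fin G.nA × Fin G.nB}

theorem man_lo (hI : G.MarketOf I) (he : e ∈ G.edges) : I.man (G.ix e) = e.1 := by
  rw [hI.man_low _ (ix_lt he)]; simp [input, getElem?_ix he]

theorem man_hi (hI : G.MarketOf I) (he : e ∈ G.edges) : I.man (G.m + G.ix e) = e.1 := by
  rw [hI.man_high _ (ix_lt he)]; simp [input, getElem?_ix he]

theorem woman_lo (hI : G.MarketOf I) (he : e ∈ G.edges) : I.woman (G.ix e) = e.2 := by
  rw [hI.woman_low _ (ix_lt he)]; simp [input, getElem?_ix he]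

theorem woman_hi (hI : G.MarketOf I) (he : e ∈ G.edges) : I.woman (G.m + G.ix e) = e.2 := by
  rw [hI.woman_high _ (ix_lt he)]; simp [input, getElem?_ix he]

theorem pr_lo (hI : G.MarketOf I) (he : e ∈ G.edges) : I.pr (G.ix e) = G.m + G.jx e + 1 := by
  rw [hI.pr_low _ (ix_lt he), cross_ix he]

theorem pr_hi (hI : G.MarketOf I) (he : e ∈ G.edges) : I.pr (G.m + G.ix e) = G.jx e := by
  rw [hI.pr_high _ (ix_lt he), cross_ix he]

theorem market_cases (hI : G.MarketOf I) {k : ℕ} (hk : k < I.K) :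
    ∃ e ∈ G.edges, k = G.ix e ∨ k = G.m + G.ix e := by
  rcases Market.Doubles.cases hI hk with h | ⟨i, hi, rfl⟩
  · obtain ⟨e, he, rfl⟩ := exists_ix h
    exact ⟨e, he, Or.inl rfl⟩
  · obtain ⟨e, he, rfl⟩ := exists_ix hi
    exact ⟨e, he, Or.inr rfl⟩

theorem market_strict (hI : G.MarketOf I) : I.Strict := by
  refine Market.Doubles.strict hI ?_ ?_
  · intro i hi
    obtain ⟨e, he, rfl⟩ := exists_ix hi
    rw [cross_ix he]
    exact jx_lt he
  · intro i hi j hj h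
    obtain ⟨e, he, rfl⟩ := exists_ix hi
    obtain ⟨f, hf, rfl⟩ := exists_ix hj
    rw [cross_ix he, cross_ix hf] at h
    rw [jx_inj he h]

end Market

/-- The man of `e` is unmatched or ranks `e` above his edge in `M`. -/
def UpA (M : Finset (Fin G.nA × Fin G.nB)) (e : Fin G.nA × Fin G.nB) : Prop :=
  ∀ f ∈ M, f.1 = e.1 → G.ix e < G.ix f

/-- The woman of `e` is unmatched or ranks `e` above her edge in `M`. -/
def UpB (M : Finset (Fin G.nA × Fin G.nB)) (e : Fin G.nA × Fin G.nB) : Prop :=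
  ∀ f ∈ M, f.2 = e.2 → G.jx e < G.jx f

theorem blocks_iff {M : Finset (Fin G.nA × Fin G.nB)} (hM : M ⊆ G.edges)
    {e : Fin G.nA × Fin G.nB} (he : e ∈ G.edges) : G.Blocks M e.1 e.2 ↔ UpA M e ∧ UpB M e := by
  refine (and_iff_right he).trans (and_congr ?_ ?_)
  · refine forall₂_congr fun f hf => forall_congr' fun h => ?_
    obtain ⟨a, b⟩ := e
    obtain ⟨a', b'⟩ := f
    subst h
    exact ranksA_iff he (hM hf)
  · refine forall₂_congr fun f hf => forall_congr' fun h => ?_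
    obtain ⟨a, b⟩ := e
    obtain ⟨a', b'⟩ := f
    subst h
    exact ranksB_iff he (hM hf)

end MarriageInstance

/-! ### From a witness of popularity to a good stable set. -/

namespace MarriageInstance

variable {G : MarriageInstance} {M : Finset (Fin G.nA × Fin G.nB)}

/-- Vertex weights that certify the popularity of `M`. -/
structure IsWitness (M : Finset (Fin G.nA × Fin G.nB)) (x : Fin G.nA → ℤ) (y : Fin G.nB → ℤ) :
    Prop where
  up_up : ∀ e ∈ G.edges, UpA M e → UpB M e → 2 ≤ x e.1 + y e.2
  up : ∀ e ∈ G.edges, UpA M e ∨ UpB M e → 0 ≤ x e.1 + y e.2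
  mem : ∀ e ∈ M, x e.1 + y e.2 = 0
  unmatchedA : ∀ a, (∀ e ∈ M, e.1 ≠ a) → x a = 0
  unmatchedB : ∀ b, (∀ e ∈ M, e.2 ≠ b) → y b = 0
  ge : ∀ a, -1 ≤ x a
  le : ∀ a, x a ≤ 1

/-- The weights of matched men prescribe levels: `1` low, `-1` high, `0` undecided. The repair in
`Market.exists_stable` decides the last kind and does not move the others, in particular not the
partners of `a` and `b`. -/
theorem exists_good_of_witness {I : Market} (hI : G.MarketOf I) (hM : G.IsMatching M)
    {x : Fin G.nA → ℤ} {y : Fin G.nB → ℤ} (h : IsWitness M x y) {a : Fin G.nA} {b : Fin G.nB}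
    (hb : G.Blocks M a b) : ∃ S, I.Stable S ∧ I.Good G.m (G.ix (a, b)) S := by
  classical
  obtain ⟨hME, hMu⟩ := hM
  have hle : ∀ b, y b ≤ 1 := by
    intro b
    by_cases hb : ∃ e ∈ M, e.2 = b
    · obtain ⟨e, he, rfl⟩ := hb
      have := h.mem e he; have := h.ge e.1; omega
    · push Not at hb
      rw [h.unmatchedB b hb]; norm_num
  have matchedA : ∀ a, x a ≠ 0 → ∃ e ∈ M, e.1 = a := by
    intro a ha
    by_contra hc
    push Not at hc
    exact ha (h.unmatchedA a hc)
  have matchedB : ∀ b, y b ≠ 0 → ∃ e ∈ M, e.2 = b := by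
    intro b hb
    by_contra hc
    push Not at hc
    exact hb (h.unmatchedB b hc)
  have notUpA : ∀ e, ¬ UpA M e → ∃ f ∈ M, f.1 = e.1 ∧ G.ix f ≤ G.ix e := by
    intro e he
    simp only [UpA] at he
    push Not at he
    exact he
  have notUpB : ∀ e, ¬ UpB M e → ∃ f ∈ M, f.2 = e.2 ∧ G.jx f ≤ G.jx e := by
    intro e he
    simp only [UpB] at he
    push Not at he
    exact he
  -- Two lifts of `M` that differ only at weight `0`: `φ` puts those edges low and is the starting
  -- matching, `ψ` puts them high and is the protected set `F`. They share the edges of weight `±1`.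
  let φ : Fin G.nA × Fin G.nB → ℕ := fun e => if x e.1 = -1 then G.m + G.ix e else G.ix e
  let ψ : Fin G.nA × Fin G.nB → ℕ := fun e => if x e.1 = 1 then G.ix e else G.m + G.ix e
  have φman : ∀ e ∈ M, I.man (φ e) = e.1 := by
    intro e he
    simp only [φ]
    split_ifs
    exacts [man_hi hI (hME he), man_lo hI (hME he)]
  have φwoman : ∀ e ∈ M, I.woman (φ e) = e.2 := by
    intro e he
    simp only [φ]
    split_ifs
    exacts [woman_hi hI (hME he), woman_lo hI (hME he)]
  have ψman : ∀ e ∈ M, I.man (ψ e) = e.1 := by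
    intro e he
    simp only [ψ]
    split_ifs
    exacts [man_lo hI (hME he), man_hi hI (hME he)]
  have ψwoman : ∀ e ∈ M, I.woman (ψ e) = e.2 := by
    intro e he
    simp only [ψ]
    split_ifs
    exacts [woman_lo hI (hME he), woman_hi hI (hME he)]
  have hK : I.K = G.m + G.m := hI.K
  have φpr : ∀ e ∈ M, I.pr (φ e) ≤ G.m + G.jx e + 1 := by
    intro e he
    simp only [φ]
    split_ifs
    · rw [pr_hi hI (hME he)]; omega
    · rw [pr_lo hI (hME he)]
  have φK : ∀ e ∈ M, φ e < I.K := by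
    intro e he
    have := ix_lt (hME he)
    simp only [φ]
    split_ifs <;> omega
  have hex : ∃ S, I.Stable S ∧ ∀ f ∈ M.image ψ, f ∈ M.image φ → f ∈ S := by
    refine Market.exists_stable (market_strict hI) ?_ ?_ ?_ ?_ ?_
    · refine ⟨fun s hs => ?_, fun s hs t ht hst => ?_⟩
      · obtain ⟨e, he, rfl⟩ := Finset.mem_image.1 hs
        exact φK e he
      · obtain ⟨e, he, rfl⟩ := Finset.mem_image.1 hs
        obtain ⟨f, hf, rfl⟩ := Finset.mem_image.1 ht
        rw [φman e he, φman f hf, φwoman e he, φwoman f hf, Fin.val_inj, Fin.val_inj] at hst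
        rw [hMu e he f hf hst]
    · intro k hk l hlk hlm
      obtain ⟨e, he, rfl⟩ := Finset.mem_image.1 hk
      rw [φman e he] at hlm
      obtain ⟨f, hf, hl⟩ := market_cases hI (hlk.trans (φK e he))
      have hfe : f.1 = e.1 := by
        rcases hl with rfl | rfl
        · rwa [man_lo hI hf, Fin.val_inj] at hlm
        · rwa [man_hi hI hf, Fin.val_inj] at hlm
      have hlw : I.woman l = f.2 := by
        rcases hl with rfl | rfl
        exacts [woman_lo hI hf, woman_hi hI hf]
      have hup : ∀ {f : Fin G.nA × Fin G.nB}, f.1 = e.1 → G.ix f < G.ix e → UpA M f := by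
        intro f hfe hlt g hg hgf
        rwa [hMu g hg e he (Or.inl (hgf.trans hfe))]
      have hfi := ix_lt hf
      have hei := ix_lt (hME he)
      suffices hs : ∃ g ∈ M, g.2 = f.2 ∧ I.pr (φ g) ≤ I.pr l by
        obtain ⟨g, hg, hgf, hgp⟩ := hs
        exact ⟨φ g, Finset.mem_image_of_mem φ hg, by rw [φwoman g hg, hlw, hgf], hgp⟩
      have hxy := h.mem e he
      -- A woman of weight `1` has a partner of weight `-1`, so `φ` gives her a high option, better
      -- than any low one.
      have hone : y f.2 = 1 → ∃ g ∈ M, g.2 = f.2 ∧ I.pr (φ g) = G.jx g := by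
        intro h1
        obtain ⟨g, hg, hgf⟩ := matchedB f.2 (by omega)
        have := h.mem g hg
        rw [hgf] at this
        refine ⟨g, hg, hgf, ?_⟩
        simp only [φ]
        rw [if_pos (by omega), pr_hi hI (hME hg)]
      have g1 := h.ge f.1
      have g2 := h.le f.1
      have g3 := hle f.2
      by_cases hx : x e.1 = -1
      · have hφ : φ e = G.m + G.ix e := by simp [φ, hx]
        rw [hφ] at hlk
        by_cases hy : y f.2 = 1
        · obtain ⟨g, hg, hgf, hgp⟩ := hone hy
          refine ⟨g, hg, hgf, ?_⟩
          rcases hl with rfl | rfl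
          · rw [hgp, pr_lo hI hf]
            have := jx_lt (hME hg); omega
          · rw [hgp, pr_hi hI hf]
            have hu := hup hfe (by omega)
            obtain ⟨g', hg', hgf', hj⟩ := notUpB f fun hb => by
              have := h.up_up f hf hu hb
              rw [hfe] at this; omega
            rwa [hMu g hg g' hg' (Or.inr (hgf.trans hgf'.symm))]
        -- A negative sum means that neither end of `f` prefers it to `M`. So an earlier high option
        -- is impossible, and a low one is dominated by the woman's partner.
        · have hsum : x f.1 + y f.2 ≤ -1 := by rw [hfe]; omega
          have hnot := mt (h.up f hf) (by omega)
          rw [not_or] at hnot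
          rcases hl with rfl | rfl
          · obtain ⟨g, hg, hgf, hj⟩ := notUpB f hnot.2
            refine ⟨g, hg, hgf, (φpr g hg).trans ?_⟩
            rw [pr_lo hI hf]; omega
          · exact absurd (hup hfe (by omega)) hnot.1
      · have hφ : φ e = G.ix e := by simp [φ, hx]
        rw [hφ] at hlk
        have hl : l = G.ix f := hl.resolve_right fun hl => by rw [hl] at hlk; linarith
        subst hl
        by_cases hy : y f.2 = 1
        · obtain ⟨g, hg, hgf, hgp⟩ := hone hy
          refine ⟨g, hg, hgf, ?_⟩
          rw [hgp, pr_lo hI hf]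
          have := jx_lt (hME hg); omega
        · obtain ⟨g, hg, hgf, hj⟩ := notUpB f fun hb => by
            have := h.up_up f hf (hup hfe hlk) hb
            omega
          refine ⟨g, hg, hgf, (φpr g hg).trans ?_⟩
          rw [pr_lo hI hf]; omega
    · intro f hf
      obtain ⟨e, he, rfl⟩ := Finset.mem_image.1 hf
      have := ix_lt (hME he)
      simp only [ψ]
      split_ifs <;> omega
    · intro k hk l hl hlw hlp
      obtain ⟨e, he, rfl⟩ := Finset.mem_image.1 hk
      rw [ψwoman e he] at hlw
      obtain ⟨f, hf, hlf⟩ := market_cases hI hl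
      have hfe : f.2 = e.2 := by
        rcases hlf with rfl | rfl
        · rwa [woman_lo hI hf, Fin.val_inj] at hlw
        · rwa [woman_hi hI hf, Fin.val_inj] at hlw
      have hlm : I.man l = f.1 := by
        rcases hlf with rfl | rfl
        exacts [man_lo hI hf, man_hi hI hf]
      suffices hs : ∃ g ∈ M, g.1 = f.1 ∧ ψ g < l by
        obtain ⟨g, hg, hgf, hgl⟩ := hs
        exact ⟨ψ g, Finset.mem_image_of_mem ψ hg, by rw [ψman g hg, hlm, hgf], hgl⟩
      have hup : G.jx f < G.jx e → UpB M f := by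
        intro hlt g hg hgf
        rwa [hMu g hg e he (Or.inr (hgf.trans hfe))]
      have hfi := ix_lt hf
      have hxy := h.mem e he
      have g1 := h.ge f.1
      have g2 := h.le f.1
      have g3 := h.le e.1
      have g4 := h.ge e.1
      have hlow : ∀ g, x g.1 = 1 → ψ g = G.ix g := fun g hg => by simp [ψ, hg]
      have hhigh : ∀ g, x g.1 ≠ 1 → ψ g = G.m + G.ix g := fun g hg => by simp [ψ, hg]
      have high : l = G.m + G.ix f → x f.1 = 1 → ∃ g ∈ M, g.1 = f.1 ∧ ψ g < l := by
        intro hl hx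
        obtain ⟨g, hg, hgf⟩ := matchedA f.1 (by omega)
        refine ⟨g, hg, hgf, ?_⟩
        rw [hlow g (by rw [hgf, hx]), hl]
        have := ix_lt (hME hg); omega
      -- Excludes equality of options: an edge `f` of `M` sharing its woman with `e` is `e` itself.
      have same : ∀ g ∈ M, G.ix g = G.ix f → f = e := by
        intro g hg hgf
        have := ix_inj (hME hg) hgf
        subst this
        exact hMu g hg e he (Or.inr hfe)
      by_cases hx : x e.1 = 1
      · have hψ := hlow e hx
        rw [hψ, pr_lo hI (hME he)] at hlp
        rcases hlf with hlf | hlf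
        · rw [hlf, pr_lo hI hf] at hlp
          have hu := hup (by omega)
          have h0 := h.up f hf (Or.inr hu)
          rw [hfe] at h0
          have hxf : x f.1 = 1 := by omega
          obtain ⟨g, hg, hgf, hi⟩ := notUpA f fun hb => by
            have := h.up_up f hf hb hu
            rw [hfe] at this; omega
          refine ⟨g, hg, hgf, ?_⟩
          rw [hlow g (by rw [hgf, hxf]), hlf]
          refine lt_of_le_of_ne hi fun hc => ?_
          rw [same g hg hc] at hlp
          omega
        · by_cases hxf : x f.1 = 1
          · exact high hlf hxf
          · have hnot := mt (h.up f hf) (by rw [hfe]; omega)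
            rw [not_or] at hnot
            obtain ⟨g, hg, hgf, hi⟩ := notUpA f hnot.1
            refine ⟨g, hg, hgf, ?_⟩
            rw [hhigh g (by rwa [hgf]), hlf]
            refine Nat.add_lt_add_left (lt_of_le_of_ne hi fun hc => hxf ?_) _
            rw [same g hg hc, hx]
      · have hψ := hhigh e hx
        rw [hψ, pr_hi hI (hME he)] at hlp
        have := jx_lt (hME he)
        rcases hlf with hlf | hlf
        · rw [hlf, pr_lo hI hf] at hlp; omega
        rw [hlf, pr_hi hI hf] at hlp
        have hu := hup hlp
        by_cases hxf : x f.1 = 1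
        · exact high hlf hxf
        · obtain ⟨g, hg, hgf, hi⟩ := notUpA f fun hb => by
            have := h.up_up f hf hb hu
            rw [hfe] at this; omega
          refine ⟨g, hg, hgf, ?_⟩
          rw [hhigh g (by rwa [hgf]), hlf]
          refine Nat.add_lt_add_left (lt_of_le_of_ne hi fun hc => ?_) _
          rw [same g hg hc] at hlp
          omega
    · intro k hk l hl hw
      obtain ⟨e, he, rfl⟩ := Finset.mem_image.1 hk
      obtain ⟨f, hf, rfl⟩ := Finset.mem_image.1 hl
      rw [φwoman f hf, ψwoman e he, Fin.val_inj] at hw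
      obtain rfl := hMu f hf e he (Or.inr hw)
      simp only [φ, ψ]
      split_ifs
      · omega
      · rw [pr_lo hI (hME hf)]
      · exact le_rfl
      · rw [pr_lo hI (hME hf), pr_hi hI (hME hf)]; omega
  obtain ⟨S, hS, hFS⟩ := hex
  have he := hb.1
  obtain ⟨hA, hB⟩ := (blocks_iff hME he).1 hb
  have hsum := h.up_up _ he hA hB
  -- All weights are at most `1`, so a sum of at least `2` forces both to be `1`.
  have hxa : x a = 1 := by have := h.le a; have := hle b; simp only at hsum; omega
  have hyb : y b = 1 := by have := h.le a; have := hle b; simp only at hsum; omega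
  obtain ⟨f, hf, hfa⟩ := matchedA a (by omega)
  obtain ⟨g, hg, hgb⟩ := matchedB b (by omega)
  have hxg : x g.1 = -1 := by have := h.mem g hg; rw [hgb] at this; omega
  have hfS : G.ix f ∈ S := by
    have e1 : φ f = G.ix f := by simp [φ, hfa, hxa]
    have e2 : ψ f = G.ix f := by simp [ψ, hfa, hxa]
    exact hFS _ (e2 ▸ Finset.mem_image_of_mem ψ hf) (e1 ▸ Finset.mem_image_of_mem φ hf)
  have hgS : G.m + G.ix g ∈ S := by
    have e1 : φ g = G.m + G.ix g := by simp [φ, hxg]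
    have e2 : ψ g = G.m + G.ix g := by simp [ψ, hxg]
    exact hFS _ (e2 ▸ Finset.mem_image_of_mem ψ hg) (e1 ▸ Finset.mem_image_of_mem φ hg)
  have hmf := man_lo hI (hME hf)
  have hmk := man_lo hI he
  have hwg := woman_hi hI (hME hg)
  have hwk := woman_lo hI he
  refine ⟨S, hS, fun t ht htm => ?_, ⟨_, hfS, by rw [hmf, hmk, hfa]⟩, _, hgS,
    Nat.le_add_right _ _, by rw [hwg, hwk, hgb], ?_⟩
  · have := hS.1.2 t ht _ hfS (Or.inl (by rw [htm, hmf, hmk, hfa]))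
    subst this
    exact ⟨hA f hf hfa, ix_lt (hME hf)⟩
  · rw [pr_hi hI he, pr_hi hI (hME hg)]
    exact hB g hg hgb

end MarriageInstance

namespace MarriageInstance

variable {G : MarriageInstance}

/-! ### Counting votes -/

open Classical in
/-- The partner of `a`. -/
noncomputable def partnerA (M : Finset (Fin G.nA × Fin G.nB)) (a : Fin G.nA) :
    Option (Fin G.nB) :=
  if h : ∃ b, (a, b) ∈ M then some h.choose else none

open Classical in
/-- The partner of `b`. -/
noncomputable def partnerB (M : Finset (Fin G.nA × Fin G.nB)) (b : Fin G.nB) :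
    Option (Fin G.nA) :=
  if h : ∃ a, (a, b) ∈ M then some h.choose else none

theorem partnerA_eq_some {M : Finset (Fin G.nA × Fin G.nB)} (hM : G.IsMatching M) {a : Fin G.nA}
    {b : Fin G.nB} : partnerA M a = some b ↔ (a, b) ∈ M := by
  unfold partnerA
  split_ifs with h
  · rw [Option.some_inj]
    constructor
    · rintro rfl; exact h.choose_spec
    · intro hb
      exact (Prod.mk.inj (hM.2 _ h.choose_spec _ hb (Or.inl rfl))).2
  · simp only [false_iff]
    exact fun hb => h ⟨b, hb⟩

theorem partnerB_eq_some {M : Finset (Fin G.nA × Fin G.nB)} (hM : G.IsMatching M) {a : Fin G.nA}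
    {b : Fin G.nB} : partnerB M b = some a ↔ (a, b) ∈ M := by
  unfold partnerB
  split_ifs with h
  · rw [Option.some_inj]
    constructor
    · rintro rfl; exact h.choose_spec
    · intro hb
      exact (Prod.mk.inj (hM.2 _ h.choose_spec _ hb (Or.inr rfl))).1
  · simp only [false_iff]
    exact fun hb => h ⟨a, hb⟩

/-- The rank that `a` gives to a possible partner. -/
def rankA (a : Fin G.nA) (o : Option (Fin G.nB)) : ℕ :=
  o.elim (G.prefA a).length (G.prefA a).idxOf

/-- The rank that `b` gives to a possible partner. -/
def rankB (b : Fin G.nB) (o : Option (Fin G.nA)) : ℕ :=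
  o.elim (G.prefB b).length (G.prefB b).idxOf

/-- The vote between two ranks: `1` if the first one is better, `-1` if it is worse. -/
def vote (x y : ℕ) : ℤ := if x < y then 1 else if y < x then -1 else 0

theorem prefersA_iff {M N : Finset (Fin G.nA × Fin G.nB)} (hM : G.IsMatching M)
    (hN : G.IsMatching N) (a : Fin G.nA) :
    G.PrefersA M N a ↔ rankA a (partnerA M a) < rankA a (partnerA N a) := by
  constructor
  · rintro ⟨⟨a', b⟩, he, rfl, h⟩
    rw [(partnerA_eq_some hM).2 he]
    rcases hN' : partnerA N a' with _ | c
    · exact List.idxOf_lt_length_iff.2 (mem_edges.1 (hM.1 he))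
    · exact h (a', c) ((partnerA_eq_some hN).1 hN') rfl
  · intro h
    rcases hM' : partnerA M a with _ | b
    · rw [hM'] at h
      rcases hN' : partnerA N a with _ | c <;> rw [hN'] at h
      · exact absurd h (lt_irrefl _)
      · exact absurd h (not_lt.2 List.idxOf_le_length)
    · refine ⟨(a, b), (partnerA_eq_some hM).1 hM', rfl, ?_⟩
      rintro ⟨a', c⟩ hf rfl
      rw [hM', (partnerA_eq_some hN).2 hf] at h
      exact h

theorem prefersB_iff {M N : Finset (Fin G.nA × Fin G.nB)} (hM : G.IsMatching M)
    (hN : G.IsMatching N) (b : Fin G.nB) :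
    G.PrefersB M N b ↔ rankB b (partnerB M b) < rankB b (partnerB N b) := by
  constructor
  · rintro ⟨⟨a, b'⟩, he, rfl, h⟩
    rw [(partnerB_eq_some hM).2 he]
    rcases hN' : partnerB N b' with _ | c
    · exact List.idxOf_lt_length_iff.2 (mem_edges'.1 (hM.1 he))
    · exact h (c, b') ((partnerB_eq_some hN).1 hN') rfl
  · intro h
    rcases hM' : partnerB M b with _ | a
    · rw [hM'] at h
      rcases hN' : partnerB N b with _ | c <;> rw [hN'] at h
      · exact absurd h (lt_irrefl _)
      · exact absurd h (not_lt.2 List.idxOf_le_length)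
    · refine ⟨(a, b), (partnerB_eq_some hM).1 hM', rfl, ?_⟩
      rintro ⟨c, b'⟩ hf rfl
      rw [hM', (partnerB_eq_some hN).2 hf] at h
      exact h

/-- The vote of `a` for the partner `o` against the partner `o'`. -/
def voteA (a : Fin G.nA) (o o' : Option (Fin G.nB)) : ℤ := vote (rankA a o) (rankA a o')

/-- The vote of `b` for the partner `o` against the partner `o'`. -/
def voteB (b : Fin G.nB) (o o' : Option (Fin G.nA)) : ℤ := vote (rankB b o) (rankB b o')

theorem sum_vote {ι : Type*} [Fintype ι] (p q : ι → ℕ) :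
    ∑ i, vote (p i) (q i) = ((Finset.univ.filter fun i => p i < q i).card : ℤ) -
      (Finset.univ.filter fun i => q i < p i).card := by
  rw [Finset.card_filter, Finset.card_filter]
  push_cast
  rw [← Finset.sum_sub_distrib]
  refine Finset.sum_congr rfl fun i _ => ?_
  unfold vote
  split_ifs <;> omega

/-- The election as a sum of signed votes over vertices, the form from which vertex weights can be
subtracted. -/
theorem votes_sub {M N : Finset (Fin G.nA × Fin G.nB)} (hM : G.IsMatching M)
    (hN : G.IsMatching N) : (G.votes N M : ℤ) - G.votes M N =
      ∑ a, voteA a (partnerA N a) (partnerA M a) + ∑ b, voteB b (partnerB N b) (partnerB M b) := by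
  have h1 : ∀ {M N : Finset (Fin G.nA × Fin G.nB)}, G.IsMatching M → G.IsMatching N →
      G.votes M N = (Finset.univ.filter fun a => rankA a (partnerA M a) <
        rankA a (partnerA N a)).card + (Finset.univ.filter fun b => rankB b (partnerB M b) <
        rankB b (partnerB N b)).card := by
    intro M N hM hN
    unfold votes
    congr 2 <;> ext x <;> simp [prefersA_iff hM hN, prefersB_iff hM hN]
  rw [h1 hM hN, h1 hN hM]
  simp only [voteA, voteB]
  rw [sum_vote, sum_vote]
  push_cast
  ring

theorem voteA_none_le (a : Fin G.nA) (o : Option (Fin G.nB)) : voteA a none o ≤ 0 := by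
  have : rankA a o ≤ (G.prefA a).length := by
    rcases o with _ | b
    exacts [le_rfl, List.idxOf_le_length]
  simp only [voteA, vote, rankA, Option.elim_none] at this ⊢
  split_ifs <;> omega

theorem voteB_none_le (b : Fin G.nB) (o : Option (Fin G.nA)) : voteB b none o ≤ 0 := by
  have : rankB b o ≤ (G.prefB b).length := by
    rcases o with _ | b
    exacts [le_rfl, List.idxOf_le_length]
  simp only [voteB, vote, rankB, Option.elim_none] at this ⊢
  split_ifs <;> omega

theorem voteA_none_mem {M : Finset (Fin G.nA × Fin G.nB)} (hM : G.IsMatching M)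
    {e : Fin G.nA × Fin G.nB} (he : e ∈ M) : voteA e.1 none (partnerA M e.1) = -1 := by
  rw [(partnerA_eq_some hM).2 he]
  have : (G.prefA e.1).idxOf e.2 < (G.prefA e.1).length :=
    List.idxOf_lt_length_iff.2 (mem_edges.1 (hM.1 he))
  simp [voteA, vote, rankA, this, this.le]

theorem voteB_none_mem {M : Finset (Fin G.nA × Fin G.nB)} (hM : G.IsMatching M)
    {e : Fin G.nA × Fin G.nB} (he : e ∈ M) : voteB e.2 none (partnerB M e.2) = -1 := by
  rw [(partnerB_eq_some hM).2 he]
  have : (G.prefB e.2).idxOf e.1 < (G.prefB e.2).length :=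
    List.idxOf_lt_length_iff.2 (mem_edges'.1 (hM.1 he))
  simp [voteB, vote, rankB, this, this.le]

theorem vote_le (x y : ℕ) : vote x y ≤ 1 := by
  unfold vote; split_ifs <;> omega

theorem vote_eq_one {x y : ℕ} : vote x y = 1 ↔ x < y := by
  unfold vote; split_ifs <;> simp_all

theorem vote_ne_zero {x y : ℕ} (h : x ≠ y) : vote x y = 1 ∨ vote x y = -1 := by
  rcases lt_or_gt_of_ne h with h' | h'
  · exact Or.inl (by simp [vote, h'])
  · exact Or.inr (by simp [vote, h', h'.not_gt])

theorem voteA_eq_one {M : Finset (Fin G.nA × Fin G.nB)} (hM : G.IsMatching M)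
    {e : Fin G.nA × Fin G.nB} (he : e ∈ G.edges) :
    voteA e.1 (some e.2) (partnerA M e.1) = 1 ↔ UpA M e := by
  obtain ⟨a, b⟩ := e
  rw [voteA, vote_eq_one]
  rcases h : partnerA M a with _ | c
  · refine iff_of_true (List.idxOf_lt_length_iff.2 (mem_edges.1 he)) ?_
    rintro ⟨a', c⟩ hf rfl
    rw [(partnerA_eq_some hM).2 hf] at h
    cases h
  · have hc := (partnerA_eq_some hM).1 h
    refine (ranksA_iff he (hM.1 hc)).trans ⟨?_, fun h => h _ hc rfl⟩
    rintro h f hf hfa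
    rwa [hM.2 f hf _ hc (Or.inl hfa)]

theorem voteB_eq_one {M : Finset (Fin G.nA × Fin G.nB)} (hM : G.IsMatching M)
    {e : Fin G.nA × Fin G.nB} (he : e ∈ G.edges) :
    voteB e.2 (some e.1) (partnerB M e.2) = 1 ↔ UpB M e := by
  obtain ⟨a, b⟩ := e
  rw [voteB, vote_eq_one]
  rcases h : partnerB M b with _ | c
  · refine iff_of_true (List.idxOf_lt_length_iff.2 (mem_edges'.1 he)) ?_
    rintro ⟨c, b'⟩ hf rfl
    rw [(partnerB_eq_some hM).2 hf] at h
    cases h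
  · have hc := (partnerB_eq_some hM).1 h
    refine (ranksB_iff he (hM.1 hc)).trans ⟨?_, fun h => h _ hc rfl⟩
    rintro h f hf hfa
    rwa [hM.2 f hf _ hc (Or.inr hfa)]

theorem voteA_of_not_mem {M : Finset (Fin G.nA × Fin G.nB)} (hM : G.IsMatching M)
    {e : Fin G.nA × Fin G.nB} (he : e ∈ G.edges) (heM : e ∉ M) :
    voteA e.1 (some e.2) (partnerA M e.1) = 1 ∨ voteA e.1 (some e.2) (partnerA M e.1) = -1 := by
  obtain ⟨a, b⟩ := e
  refine vote_ne_zero ?_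
  rcases h : partnerA M a with _ | c
  · exact (List.idxOf_lt_length_iff.2 (mem_edges.1 he)).ne
  · intro hr
    have := (List.idxOf_inj (mem_edges.1 he)).1 hr
    simp only at this
    exact heM (this ▸ (partnerA_eq_some hM).1 h)

theorem voteB_of_not_mem {M : Finset (Fin G.nA × Fin G.nB)} (hM : G.IsMatching M)
    {e : Fin G.nA × Fin G.nB} (he : e ∈ G.edges) (heM : e ∉ M) :
    voteB e.2 (some e.1) (partnerB M e.2) = 1 ∨ voteB e.2 (some e.1) (partnerB M e.2) = -1 := by
  obtain ⟨a, b⟩ := e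
  refine vote_ne_zero ?_
  rcases h : partnerB M b with _ | c
  · exact (List.idxOf_lt_length_iff.2 (mem_edges'.1 he)).ne
  · intro hr
    have := (List.idxOf_inj (mem_edges'.1 he)).1 hr
    simp only at this
    exact heM (this ▸ (partnerB_eq_some hM).1 h)

theorem voteA_mem {M : Finset (Fin G.nA × Fin G.nB)} (hM : G.IsMatching M)
    {e : Fin G.nA × Fin G.nB} (he : e ∈ M) : voteA e.1 (some e.2) (partnerA M e.1) = 0 := by
  rw [(partnerA_eq_some hM).2 he]; simp [voteA, vote]

theorem voteB_mem {M : Finset (Fin G.nA × Fin G.nB)} (hM : G.IsMatching M)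
    {e : Fin G.nA × Fin G.nB} (he : e ∈ M) : voteB e.2 (some e.1) (partnerB M e.2) = 0 := by
  rw [(partnerB_eq_some hM).2 he]; simp [voteB, vote]

/-! ### A sufficient condition for dominance -/

theorem sum_vertices {N : Finset (Fin G.nA × Fin G.nB)} (hN : G.IsMatching N)
    (s : Fin G.nA → ℤ) (t : Fin G.nB → ℤ) :
    ∑ a, s a + ∑ b, t b = ∑ e ∈ N, (s e.1 + t e.2) +
      (∑ a ∈ (N.image Prod.fst)ᶜ, s a + ∑ b ∈ (N.image Prod.snd)ᶜ, t b) := by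
  have h1 : ∑ a ∈ N.image Prod.fst, s a = ∑ e ∈ N, s e.1 :=
    Finset.sum_image fun e he f hf h => hN.2 e he f hf (Or.inl h)
  have h2 : ∑ b ∈ N.image Prod.snd, t b = ∑ e ∈ N, t e.2 :=
    Finset.sum_image fun e he f hf h => hN.2 e he f hf (Or.inr h)
  rw [← Finset.sum_add_sum_compl (N.image Prod.fst) s,
    ← Finset.sum_add_sum_compl (N.image Prod.snd) t, h1, h2, Finset.sum_add_distrib]
  ring

/-- A witness whose bounds are strict at edges with an unmatched man certifies dominance. -/
theorem IsWitness.isDominant {M : Finset (Fin G.nA × Fin G.nB)} (hM : G.IsMatching M)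
    {x : Fin G.nA → ℤ} {y : Fin G.nB → ℤ} (h : IsWitness M x y)
    (hx : ∀ e ∈ G.edges, (∀ f ∈ M, f.1 ≠ e.1) → 1 ≤ x e.1 + y e.2) : G.IsDominant M := by
  classical
  -- The weights sum to `0`, so they may be subtracted from the votes. Then each edge of `N` and
  -- each vertex missed by `N` contributes at most `0`, and each edge of `N` whose man is unmatched
  -- in `M` at most `-1`.
  have key : ∀ N, G.IsMatching N → (G.votes N M : ℤ) - G.votes M N ≤
      - ((N.filter fun e => ∀ f ∈ M, f.1 ≠ e.1).card : ℤ) := by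
    intro N hN
    have hzero : ∑ a, x a + ∑ b, y b = 0 := by
      rw [sum_vertices hM, Finset.sum_eq_zero h.mem, Finset.sum_eq_zero, Finset.sum_eq_zero]
      · rfl
      · intro b hb
        refine h.unmatchedB b fun e he heb => ?_
        exact Finset.mem_compl.1 hb (heb ▸ Finset.mem_image_of_mem _ he)
      · intro a ha
        refine h.unmatchedA a fun e he hea => ?_
        exact Finset.mem_compl.1 ha (hea ▸ Finset.mem_image_of_mem _ he)
    have hge : ∀ b, -1 ≤ y b := by
      intro b
      by_cases hb : ∃ e ∈ M, e.2 = b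
      · obtain ⟨e, he, rfl⟩ := hb
        have := h.mem e he; have := h.le e.1; omega
      · push Not at hb
        rw [h.unmatchedB b hb]; norm_num
    have hsplit : (G.votes N M : ℤ) - G.votes M N =
        ∑ a, (voteA a (partnerA N a) (partnerA M a) - x a) +
          ∑ b, (voteB b (partnerB N b) (partnerB M b) - y b) := by
      rw [votes_sub hM hN, Finset.sum_sub_distrib, Finset.sum_sub_distrib]
      linarith
    rw [hsplit, sum_vertices hN]
    have hA : ∑ a ∈ (N.image Prod.fst)ᶜ, (voteA a (partnerA N a) (partnerA M a) - x a) ≤ 0 := by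
      refine Finset.sum_nonpos fun a ha => ?_
      have hNa : partnerA N a = none := by
        rcases hp : partnerA N a with _ | b
        · rfl
        · exact absurd (Finset.mem_image.2 ⟨_, (partnerA_eq_some hN).1 hp, rfl⟩)
            (Finset.mem_compl.1 ha)
      rw [hNa]
      by_cases hM' : ∃ e ∈ M, e.1 = a
      · obtain ⟨e, he, rfl⟩ := hM'
        have := h.ge e.1
        rw [voteA_none_mem hM he]; omega
      · push Not at hM'
        have := voteA_none_le a (partnerA M a)
        rw [h.unmatchedA a hM']; omega
    have hB : ∑ b ∈ (N.image Prod.snd)ᶜ, (voteB b (partnerB N b) (partnerB M b) - y b) ≤ 0 := by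
      refine Finset.sum_nonpos fun b hb => ?_
      have hNb : partnerB N b = none := by
        rcases hp : partnerB N b with _ | a
        · rfl
        · exact absurd (Finset.mem_image.2 ⟨_, (partnerB_eq_some hN).1 hp, rfl⟩)
            (Finset.mem_compl.1 hb)
      rw [hNb]
      by_cases hM' : ∃ e ∈ M, e.2 = b
      · obtain ⟨e, he, rfl⟩ := hM'
        have := hge e.2
        rw [voteB_none_mem hM he]; omega
      · push Not at hM'
        have := voteB_none_le b (partnerB M b)
        rw [h.unmatchedB b hM']; omega
    have hE : ∑ e ∈ N, (voteA e.1 (partnerA N e.1) (partnerA M e.1) - x e.1 +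
        (voteB e.2 (partnerB N e.2) (partnerB M e.2) - y e.2)) ≤
          ∑ e ∈ N, if ∀ f ∈ M, f.1 ≠ e.1 then -1 else 0 := by
      refine Finset.sum_le_sum fun e he => ?_
      have heE := hN.1 he
      rw [(partnerA_eq_some hN).2 he, (partnerB_eq_some hN).2 he]
      by_cases heM : e ∈ M
      · rw [voteA_mem hM heM, voteB_mem hM heM, if_neg fun h => h e heM rfl]
        have := h.mem e heM; omega
      have a1 := voteA_eq_one hM heE
      have a2 := voteA_of_not_mem hM heE heM
      have b1 := voteB_eq_one hM heE
      have b2 := voteB_of_not_mem hM heE heM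
      have b3 := vote_le (rankB e.2 (some e.1)) (rankB e.2 (partnerB M e.2))
      have c1 := h.up_up e heE
      have c2 := h.up e heE
      have c3 := h.ge e.1
      have c4 := hge e.2
      rw [← a1, ← b1] at c1 c2
      split_ifs with hu
      · have hu1 : UpA M e := fun f hf hfe => absurd hfe (hu f hf)
        have hu2 := a1.2 hu1
        have := hx e heE hu
        -- The unmatched man votes for the edge. If the woman did too, her weight would have to be
        -- `2`; so the votes cancel and the slack remains.
        rcases b2 with b2 | b2
        · have h0 := c1 hu2 b2
          rw [h.unmatchedA e.1 hu] at h0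
          by_cases hb : ∃ f ∈ M, f.2 = e.2
          · obtain ⟨f, hf, hfe⟩ := hb
            have h5 := h.mem f hf; have := h.ge f.1
            rw [hfe] at h5; omega
          · push Not at hb
            rw [h.unmatchedB e.2 hb] at h0; omega
        · omega
      · rcases a2 with a2 | a2 <;> rcases b2 with b2 | b2
        · have := c1 a2 b2; omega
        · have := c2 (Or.inl a2); omega
        · have := c2 (Or.inr b2); omega
        · omega
    rw [Finset.card_filter]
    push_cast
    rw [← Finset.sum_neg_distrib]
    have : ∀ e : Fin G.nA × Fin G.nB, -(if ∀ f ∈ M, f.1 ≠ e.1 then (1 : ℤ) else 0) =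
        if ∀ f ∈ M, f.1 ≠ e.1 then -1 else 0 := by
      intro e; split_ifs <;> rfl
    simp only [this]
    linarith
  refine ⟨⟨hM, fun N hN => ?_⟩, fun N hN hlt => ?_⟩
  · have := key N hN; omega
  -- A larger matching must match a man whom `M` leaves unmatched.
  · have hne : (N.filter fun e => ∀ f ∈ M, f.1 ≠ e.1).Nonempty := by
      by_contra hc
      rw [Finset.not_nonempty_iff_eq_empty, Finset.filter_eq_empty_iff] at hc
      have hsub : N.image Prod.fst ⊆ M.image Prod.fst := by
        intro a ha
        obtain ⟨e, he, rfl⟩ := Finset.mem_image.1 ha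
        have := hc he
        push Not at this
        obtain ⟨f, hf, hfe⟩ := this
        exact Finset.mem_image.2 ⟨f, hf, hfe⟩
      have := Finset.card_le_card hsub
      rw [Finset.card_image_of_injOn fun e he f hf h => hN.2 e he f hf (Or.inl h),
        Finset.card_image_of_injOn fun e he f hf h => hM.2 e he f hf (Or.inl h)] at this
      omega
    have := key N hN
    have := Finset.card_pos.2 hne
    omega

/-! ### Stable sets of the market -/

/-- The edges of which an option is in `S`. -/
def matchingOf (G : MarriageInstance) (S : Finset ℕ) : Finset (Fin G.nA × Fin G.nB) :=
  G.edges.filter fun e => G.ix e ∈ S ∨ G.m + G.ix e ∈ S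

theorem mem_matchingOf {S : Finset ℕ} {e : Fin G.nA × Fin G.nB} :
    e ∈ G.matchingOf S ↔ e ∈ G.edges ∧ (G.ix e ∈ S ∨ G.m + G.ix e ∈ S) := by
  simp [matchingOf]

theorem isMatching_matchingOf {I : Market} (hI : G.MarketOf I) {S : Finset ℕ} (hS : I.IsMatch S) :
    G.IsMatching (G.matchingOf S) := by
  refine ⟨Finset.filter_subset _ _, fun e he f hf hef => ?_⟩
  obtain ⟨he, hes⟩ := mem_matchingOf.1 he
  obtain ⟨hf, hfs⟩ := mem_matchingOf.1 hf
  have h1 := ix_lt he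
  have h2 := ix_lt hf
  have ml := man_lo hI he
  have mh := man_hi hI he
  have wl := woman_lo hI he
  have wh := woman_hi hI he
  have ml' := man_lo hI hf
  have mh' := man_hi hI hf
  have wl' := woman_lo hI hf
  have wh' := woman_hi hI hf
  rw [← Fin.val_inj, ← Fin.val_inj] at hef
  refine ix_inj he ?_
  rcases hes with hes | hes <;> rcases hfs with hfs | hfs <;>
  · have := hS.2 _ hes _ hfs (by omega)
    omega

theorem stable_isDominant {I : Market} (hI : G.MarketOf I) {S : Finset ℕ} (hS : I.Stable S) :
    G.IsDominant (G.matchingOf S) := by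
  classical
  have hM := isMatching_matchingOf hI hS.1
  have hE : ∀ e, e ∈ G.matchingOf S → e ∈ G.edges := fun e he => hM.1 he
  have hu := hM.2
  let x : Fin G.nA → ℤ := fun a =>
    if ∃ e ∈ G.edges, e.1 = a ∧ G.ix e ∈ S then 1 else
      if ∃ e ∈ G.edges, e.1 = a ∧ G.m + G.ix e ∈ S then -1 else 0
  let y : Fin G.nB → ℤ := fun b =>
    if ∃ e ∈ G.edges, e.2 = b ∧ G.ix e ∈ S then -1 else
      if ∃ e ∈ G.edges, e.2 = b ∧ G.m + G.ix e ∈ S then 1 else 0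
  have xlo : ∀ e ∈ G.edges, G.ix e ∈ S → x e.1 = 1 := fun e he h => if_pos ⟨e, he, rfl, h⟩
  have ylo : ∀ e ∈ G.edges, G.ix e ∈ S → y e.2 = -1 := fun e he h => if_pos ⟨e, he, rfl, h⟩
  have nolo : ∀ e ∈ G.edges, ∀ f ∈ G.edges, (e.1 = f.1 ∨ e.2 = f.2) → G.ix e ∈ S →
      G.m + G.ix f ∉ S := by
    intro e he f hf hef h1 h2
    rw [← Fin.val_inj, ← Fin.val_inj] at hef
    have := hS.1.2 _ h1 _ h2 (by
      rw [man_lo hI he, man_hi hI hf, woman_lo hI he, woman_hi hI hf]; exact hef)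
    have := ix_lt he
    omega
  have xhi : ∀ e ∈ G.edges, G.m + G.ix e ∈ S → x e.1 = -1 := by
    intro e he h
    have : ¬ ∃ f ∈ G.edges, f.1 = e.1 ∧ G.ix f ∈ S := by
      rintro ⟨f, hf, hfe, h'⟩
      exact nolo f hf e he (Or.inl hfe) h' h
    simp only [x]
    rw [if_neg this, if_pos ⟨e, he, rfl, h⟩]
  have yhi : ∀ e ∈ G.edges, G.m + G.ix e ∈ S → y e.2 = 1 := by
    intro e he h
    have : ¬ ∃ f ∈ G.edges, f.2 = e.2 ∧ G.ix f ∈ S := by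
      rintro ⟨f, hf, hfe, h'⟩
      exact nolo f hf e he (Or.inr hfe) h' h
    simp only [y]
    rw [if_neg this, if_pos ⟨e, he, rfl, h⟩]
  have hxa : ∀ a, (∀ e ∈ G.matchingOf S, e.1 ≠ a) → x a = 0 := by
    intro a ha
    simp only [x]
    rw [if_neg, if_neg]
    · rintro ⟨e, he, hea, h⟩
      exact ha e (mem_matchingOf.2 ⟨he, Or.inr h⟩) hea
    · rintro ⟨e, he, hea, h⟩
      exact ha e (mem_matchingOf.2 ⟨he, Or.inl h⟩) hea
  have hyb : ∀ b, (∀ e ∈ G.matchingOf S, e.2 ≠ b) → y b = 0 := by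
    intro b hb
    simp only [y]
    rw [if_neg, if_neg]
    · rintro ⟨e, he, heb, h⟩
      exact hb e (mem_matchingOf.2 ⟨he, Or.inr h⟩) heb
    · rintro ⟨e, he, heb, h⟩
      exact hb e (mem_matchingOf.2 ⟨he, Or.inl h⟩) heb
  have hx1 : ∀ a, -1 ≤ x a ∧ x a ≤ 1 := by
    intro a; simp only [x]; split_ifs <;> norm_num
  have hy1 : ∀ b, -1 ≤ y b := by
    intro b; simp only [y]; split_ifs <;> norm_num
  -- Stability against the low option of `e`; a woman on a high option refuses it regardless of
  -- rank.
  have D1 : ∀ e ∈ G.edges, (x e.1 = 1 ∧ ¬ UpA (G.matchingOf S) e) ∨ y e.2 = 1 ∨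
      (y e.2 = -1 ∧ ¬ UpB (G.matchingOf S) e) := by
    intro e he
    have hK : G.ix e < I.K := by have := ix_lt he; rw [hI.K]; omega
    rcases hS.2 _ hK with ⟨s, hs, hsm, hle⟩ | ⟨s, hs, hsw, hle⟩
    · obtain ⟨f, hf, rfl | rfl⟩ := market_cases hI (hS.1.1 s hs)
      · rw [man_lo hI hf, man_lo hI he, Fin.val_inj] at hsm
        refine Or.inl ⟨hsm ▸ xlo f hf hs, fun hu => ?_⟩
        have := hu f (mem_matchingOf.2 ⟨hf, Or.inl hs⟩) hsm
        omega
      · have := ix_lt he; omega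
    · obtain ⟨f, hf, rfl | rfl⟩ := market_cases hI (hS.1.1 s hs)
      · rw [woman_lo hI hf, woman_lo hI he, Fin.val_inj] at hsw
        rw [pr_lo hI hf, pr_lo hI he] at hle
        refine Or.inr (Or.inr ⟨hsw ▸ ylo f hf hs, fun hu => ?_⟩)
        have := hu f (mem_matchingOf.2 ⟨hf, Or.inl hs⟩) hsw
        omega
      · rw [woman_hi hI hf, woman_lo hI he, Fin.val_inj] at hsw
        exact Or.inr (Or.inl (hsw ▸ yhi f hf hs))
  -- Stability against the high option of `e`; a man on a low option does not want it regardless of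
  -- rank.
  have D2 : ∀ e ∈ G.edges, x e.1 = 1 ∨ (x e.1 = -1 ∧ ¬ UpA (G.matchingOf S) e) ∨
      (y e.2 = 1 ∧ ¬ UpB (G.matchingOf S) e) := by
    intro e he
    have hK : G.m + G.ix e < I.K := by have := ix_lt he; rw [hI.K]; omega
    rcases hS.2 _ hK with ⟨s, hs, hsm, hle⟩ | ⟨s, hs, hsw, hle⟩
    · obtain ⟨f, hf, rfl | rfl⟩ := market_cases hI (hS.1.1 s hs)
      · rw [man_lo hI hf, man_hi hI he, Fin.val_inj] at hsm
        exact Or.inl (hsm ▸ xlo f hf hs)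
      · rw [man_hi hI hf, man_hi hI he, Fin.val_inj] at hsm
        refine Or.inr (Or.inl ⟨hsm ▸ xhi f hf hs, fun hu => ?_⟩)
        have := hu f (mem_matchingOf.2 ⟨hf, Or.inr hs⟩) hsm
        omega
    · obtain ⟨f, hf, rfl | rfl⟩ := market_cases hI (hS.1.1 s hs)
      · have := jx_lt he
        rw [pr_lo hI hf, pr_hi hI he] at hle
        omega
      · rw [woman_hi hI hf, woman_hi hI he, Fin.val_inj] at hsw
        rw [pr_hi hI hf, pr_hi hI he] at hle
        refine Or.inr (Or.inr ⟨hsw ▸ yhi f hf hs, fun hu => ?_⟩)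
        have := hu f (mem_matchingOf.2 ⟨hf, Or.inr hs⟩) hsw
        omega
  refine IsWitness.isDominant hM (x := x) (y := y)
    ⟨fun e he hA hB => ?_, fun e he h => ?_, fun e he => ?_, hxa, hyb, fun a => (hx1 a).1,
      fun a => (hx1 a).2⟩ fun e he h => ?_
  · rcases D1 e he with h | h | h
    · exact absurd hA h.2
    · rcases D2 e he with h' | h' | h'
      · omega
      · exact absurd hA h'.2
      · exact absurd hB h'.2
    · exact absurd hB h.2
  · have := hx1 e.1
    have := hy1 e.2
    rcases D1 e he with h1 | h1 | h1
    · omega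
    · omega
    · have hA := h.resolve_right h1.2
      rcases D2 e he with h' | h' | h'
      · omega
      · exact absurd hA h'.2
      · omega
  · obtain ⟨he, h | h⟩ := mem_matchingOf.1 he
    · rw [xlo e he h, ylo e he h]; norm_num
    · rw [xhi e he h, yhi e he h]; norm_num
  -- An unmatched man would take even the high option, so `D2` leaves only a woman of weight `1`.
  · have h0 := hxa e.1 h
    have hA : UpA (G.matchingOf S) e := fun f hf hfe => absurd hfe (h f hf)
    rcases D2 e he with h' | h' | h' <;> omega

/-- Within one level, options are compared as in `G`. So the edge of `k` blocks: its man is matched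
low and after it, its woman high and worse than it. -/
theorem good_not_stable {I : Market} (hI : G.MarketOf I) {S : Finset ℕ} (hS : I.Stable S)
    {k : ℕ} (hk : k < G.m) (hg : I.Good G.m k S) : ¬ G.IsStable (G.matchingOf S) := by
  obtain ⟨e, he, rfl⟩ := exists_ix hk
  obtain ⟨g1, -, t, ht, htm, htw, htp⟩ := hg
  rintro ⟨hM, hno⟩
  refine hno e.1 e.2 ((blocks_iff hM.1 he).2 ⟨fun f hf hfe => ?_, fun f hf hfe => ?_⟩)
  · obtain ⟨hf, h | h⟩ := mem_matchingOf.1 hf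
    · exact (g1 _ h (by rw [man_lo hI hf, man_lo hI he, hfe])).1
    · have := (g1 _ h (by rw [man_hi hI hf, man_lo hI he, hfe])).2
      omega
  · obtain ⟨hf, h⟩ := mem_matchingOf.1 hf
    have hw : ∀ s ∈ S, I.woman s = f.2 → s = t := by
      intro s hs hsw
      refine hS.1.2 s hs t ht (Or.inr ?_)
      rw [hsw, htw, woman_lo hI he, hfe]
    rcases h with h | h
    · have := hw _ h (woman_lo hI hf)
      have := ix_lt hf
      omega
    · have := hw _ h (woman_hi hI hf)
      subst this
      rwa [pr_hi hI he, pr_hi hI hf] at htp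

theorem returns_matchingOf {I : Market} (hI : G.MarketOf I) {T : Finset ℕ} (hT : I.Stable T)
    {σ : RAM.State} (ho : RAM.Outputs I T σ) : G.Returns σ (G.matchingOf T) := by
  have hM := isMatching_matchingOf hI hT.1
  have mem : ∀ {e}, e ∈ G.matchingOf T → σ.arr 4 e.1 = e.2 + 1 := by
    intro e he
    obtain ⟨he, h | h⟩ := mem_matchingOf.1 he
    · have := ho.2 _ h
      rwa [man_lo hI he, woman_lo hI he] at this
    · have := ho.2 _ h
      rwa [man_hi hI he, woman_hi hI he] at this
  intro a
  by_cases ha : ∃ b, (a, b) ∈ G.matchingOf T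
  · obtain ⟨b, hb⟩ := ha
    have h1 : σ.arr 4 a = b + 1 := mem hb
    refine ⟨fun c => ⟨fun hc => ?_, fun hc => mem hc⟩, ?_⟩
    · rw [h1] at hc
      have : b = c := Fin.ext (by omega)
      rwa [← this]
    · rw [h1]
      exact iff_of_false (by omega) fun h => h b hb
  · push Not at ha
    have h1 : σ.arr 4 a = 0 := by
      refine ho.1 a fun t ht hta => ?_
      obtain ⟨e, he, rfl | rfl⟩ := market_cases hI (hT.1.1 t ht)
      · rw [man_lo hI he, Fin.val_inj] at hta
        subst hta
        exact ha e.2 (mem_matchingOf.2 ⟨he, Or.inl ht⟩)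
      · rw [man_hi hI he, Fin.val_inj] at hta
        subst hta
        exact ha e.2 (mem_matchingOf.2 ⟨he, Or.inr ht⟩)
    refine ⟨fun c => ?_, iff_of_true h1 ha⟩
    rw [h1]
    exact iff_of_false (by omega) (ha c)

end MarriageInstance

/-! ### Potentials -/

namespace Walk

variable {V : Type*} {r : V → V → Prop} {w : V → V → ℤ}

/-- The walk from `p` through the list `l` to `q` follows the relation `r`. -/
def Rel (r : V → V → Prop) : V → List V → V → Prop
  | p, [], q => r p q
  | p, x :: l, q => r p x ∧ Rel r x l q

/-- The weight of the walk from `p` through the list `l` to `q`. -/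
def weight (w : V → V → ℤ) : V → List V → V → ℤ
  | p, [], q => w p q
  | p, x :: l, q => w p x + weight w x l q

theorem rel_append (l l' : List V) (p x q : V) :
    Rel r p (l ++ x :: l') q ↔ Rel r p l x ∧ Rel r x l' q := by
  induction l generalizing p with
  | nil => rfl
  | cons y l ih => simp only [List.cons_append, Rel, ih, and_assoc]

theorem weight_append (l l' : List V) (p x q : V) :
    weight w p (l ++ x :: l') q = weight w p l x + weight w x l' q := by
  induction l generalizing p with
  | nil => rfl
  | cons y l ih => simp only [List.cons_append, weight, ih, add_assoc]

theorem rel_of_isChain {l : List V} {p q : V} (h : List.IsChain r (p :: l))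
    (hq : r ((p :: l).getLast (List.cons_ne_nil _ _)) q) : Rel r p l q := by
  induction l generalizing p with
  | nil => exact hq
  | cons x l ih =>
    rw [List.isChain_cons_cons] at h
    exact ⟨h.1, ih h.2 (by simpa using hq)⟩

theorem weight_eq_sum {f : V → V} {l : List V} {p q : V} (h : Rel (fun a b => f a = b) p l q) :
    weight w p l q = ((p :: l).map fun x => w x (f x)).sum := by
  induction l generalizing p with
  | nil => simp [weight, show f p = q from h]
  | cons x l ih => simp [weight, ih h.2, show f p = x from h.1]

theorem forall_rel {f : V → V} {l : List V} {p q : V} (h : Rel (fun a b => f a = b) p l q)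
    (hr : Rel r p l q) : ∀ x ∈ p :: l, r x (f x) := by
  induction l generalizing p with
  | nil =>
    intro x hx
    rw [List.mem_singleton.1 hx, show f p = q from h]
    exact hr
  | cons y l ih =>
    intro x hx
    rcases List.mem_cons.1 hx with rfl | hx
    · rw [show f x = y from h.1]
      exact hr.1
    · exact ih h.2 hr.2 x hx

theorem exists_repeat {l : List V} (h : ¬ l.Nodup) :
    ∃ x l₁ l₂ l₃, l = l₁ ++ x :: (l₂ ++ x :: l₃) := by
  induction l with
  | nil => exact absurd List.nodup_nil h
  | cons y l ih =>
    by_cases hy : y ∈ l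
    · obtain ⟨l₂, l₃, rfl⟩ := List.append_of_mem hy
      exact ⟨y, [], l₂, l₃, rfl⟩
    · obtain ⟨x, l₁, l₂, l₃, rfl⟩ := ih fun hl => h (List.nodup_cons.2 ⟨hy, hl⟩)
      exact ⟨x, y :: l₁, l₂, l₃, rfl⟩

variable [Fintype V] [DecidableEq V]

/-- If no permutation along `r` has positive weight, then no closed walk along `r` has. -/
theorem weight_closed_nonpos (hr : ∀ p, r p p) (hw : ∀ p, w p p = 0)
    (h : ∀ σ : Equiv.Perm V, (∀ p, r p (σ p)) → ∑ p, w p (σ p) ≤ 0) (l : List V) (p : V)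
    (hl : Rel r p l p) : weight w p l p ≤ 0 := by
  induction hn : l.length using Nat.strong_induction_on generalizing l p with
  | _ n ih =>
    subst hn
    by_cases hp : p ∈ l
    · obtain ⟨l₁, l₂, rfl⟩ := List.append_of_mem hp
      rw [rel_append] at hl
      rw [weight_append]
      have h1 := ih l₁.length (by simp) l₁ p hl.1 rfl
      have h2 := ih l₂.length (by simp; omega) l₂ p hl.2 rfl
      omega
    by_cases hd : l.Nodup
    · have hnd : (p :: l).Nodup := List.nodup_cons.2 ⟨hp, hd⟩
      -- A closed walk without repetitions is a cyclic permutation; the fixed points contribute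
      -- weight `0`. Walks with a repeated vertex split into shorter closed walks.
      set σ := (p :: l).formPerm with hσ
      have hs : Rel (fun a b => σ a = b) p l p := by
        refine rel_of_isChain ?_ (List.formPerm_apply_getLast p l)
        rw [List.isChain_iff_getElem]
        intro i hi
        exact List.formPerm_apply_lt_getElem _ hnd i hi
      have hfix : ∀ x, x ∉ p :: l → σ x = x := fun x hx => List.formPerm_apply_of_notMem hx
      have h1 := h σ fun x => by
        by_cases hx : x ∈ p :: l
        · exact forall_rel hs hl x hx
        · rw [hfix x hx]; exact hr x
      rw [weight_eq_sum hs, ← List.sum_toFinset _ hnd]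
      refine le_of_eq_of_le ?_ h1
      refine Finset.sum_subset (Finset.subset_univ _) fun x _ hx => ?_
      rw [hfix x fun hx' => hx (List.mem_toFinset.2 hx'), hw]
    · obtain ⟨x, l₁, l₂, l₃, rfl⟩ := exists_repeat hd
      rw [rel_append, rel_append] at hl
      rw [weight_append, weight_append]
      have h1 := ih _ (by simp) (l₁ ++ x :: l₃) p ((rel_append _ _ _ _ _).2 ⟨hl.1, hl.2.2⟩) rfl
      have h2 := ih _ (by simp; omega) l₂ x hl.2.1 rfl
      rw [weight_append] at h1
      omega

/-- If no permutation along `r` has positive weight, then there is a potential. -/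
theorem exists_potential (hr : ∀ p, r p p) (hw : ∀ p, w p p = 0)
    (h : ∀ σ : Equiv.Perm V, (∀ p, r p (σ p)) → ∑ p, w p (σ p) ≤ 0) (z : V)
    (hz : ∀ p, r p z) (hz' : ∀ p, r z p) :
    ∃ u : V → ℤ, u z = 0 ∧ ∀ p q, r p q → w p q + u q ≤ u p := by
  -- The potential of `p` is the largest weight of a walk from `p` to `z`; closing such a walk by
  -- the step from `z` to `p` bounds it.
  let s : V → Set ℤ := fun p => {c | ∃ l, Rel r p l z ∧ weight w p l z = c}
  have hne : ∀ p, (s p).Nonempty := fun p => ⟨_, [], hz p, rfl⟩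
  have hbd : ∀ p, BddAbove (s p) := by
    refine fun p => ⟨-w z p, ?_⟩
    rintro _ ⟨l, hl, rfl⟩
    have := weight_closed_nonpos hr hw h (p :: l) z ⟨hz' p, hl⟩
    simp only [weight] at this
    omega
  refine ⟨fun p => sSup (s p), le_antisymm ?_ ?_, fun p q hpq => ?_⟩
  · obtain ⟨l, hl, he⟩ := Int.csSup_mem (hne z) (hbd z)
    change sSup (s z) ≤ 0
    rw [← he]
    exact weight_closed_nonpos hr hw h l z hl
  · exact le_csSup (hbd z) ⟨[], hr z, hw z⟩
  · obtain ⟨l, hl, he⟩ := Int.csSup_mem (hne q) (hbd q)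
    change w p q + sSup (s q) ≤ sSup (s p)
    rw [← he]
    exact le_csSup (hbd p) ⟨q :: l, ⟨hpq, hl⟩, rfl⟩

end Walk

/-! ### Popular matchings have integral witnesses. -/

namespace MarriageInstance

variable {G : MarriageInstance}

/-- A combinatorial form of integral linear programming duality. Nodes are the pairs of `M` and the
single vertices; a step from `p` to `q` pairs the man of `p` with the woman of `q` and is weighted
by their two votes against `M`. Permutations along admissible steps are matchings, so popularity
excludes positive weight and a potential exists, which supplies the weights. -/
theorem IsPopular.exists_isWitness {M : Finset (Fin G.nA × Fin G.nB)} (h : G.IsPopular M) :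
    ∃ x y, IsWitness M x y := by
  classical
  obtain ⟨hM, hpop⟩ := h
  -- A man's node carries his partner too, so the node of a matched woman is empty. The extra node
  -- `none` carries nobody: stepping to it leaves a man unmatched, stepping from it leaves a woman
  -- unmatched.
  let mn : Option (Fin G.nA ⊕ Fin G.nB) → Option (Fin G.nA) := fun p =>
    p.elim none (Sum.elim some fun _ => none)
  let wm : Option (Fin G.nA ⊕ Fin G.nB) → Option (Fin G.nB) := fun p =>
    p.elim none (Sum.elim (partnerA M) fun b => if partnerB M b = none then some b else none)
  let node : Fin G.nB → Option (Fin G.nA ⊕ Fin G.nB) := fun b =>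
    some ((partnerB M b).elim (Sum.inr b) Sum.inl)
  have hmn : ∀ p a, mn p = some a ↔ p = some (Sum.inl a) := by
    rintro (_ | a' | b') a <;> simp [mn]
  have hwm : ∀ p b, wm p = some b ↔ p = node b := by
    have key : ∀ a b, partnerA M a = some b ↔ partnerB M b = some a := fun a b =>
      (partnerA_eq_some hM).trans (partnerB_eq_some hM).symm
    rintro (_ | a' | b') b
    · simp [wm, node]
    · rcases hb : partnerB M b with _ | a
      · simp [wm, node, hb, key]
      · simp [wm, node, hb, key, eq_comm]
    · rcases hb : partnerB M b with _ | a
      · by_cases hbb : b' = b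
        · subst hbb; simp [wm, node, hb]
        · simp [wm, node, hb, hbb]
      · simp only [wm, node, hb, Option.elim_some, Sum.elim_inr, Option.some_inj, reduceCtorEq,
          iff_false]
        split_ifs with hb'
        · rintro h
          rw [Option.some_inj.1 h, hb] at hb'
          cases hb'
        · simp
  let r : Option (Fin G.nA ⊕ Fin G.nB) → Option (Fin G.nA ⊕ Fin G.nB) → Prop := fun p q =>
    ∀ a b, mn p = some a → wm q = some b → (a, b) ∈ G.edges
  let w : Option (Fin G.nA ⊕ Fin G.nB) → Option (Fin G.nA ⊕ Fin G.nB) → ℤ := fun p q =>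
    (mn p).elim 0 (fun a => voteA a (wm q) (partnerA M a)) +
      (wm q).elim 0 (fun b => voteB b (mn p) (partnerB M b))
  have hr : ∀ p, r p p := by
    rintro p a b ha hb
    rw [hmn] at ha
    subst ha
    exact hM.1 ((partnerA_eq_some hM).1 hb)
  have hvA : ∀ a o, voteA (G := G) a o o = 0 := fun a o => by simp [voteA, vote]
  have hvB : ∀ b o, voteB (G := G) b o o = 0 := fun a o => by simp [voteB, vote]
  have hw : ∀ p, w p p = 0 := by
    rintro (_ | a | b)
    · rfl
    · change voteA a (partnerA M a) (partnerA M a) + (partnerA M a).elim 0 (fun b =>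
        voteB b (some a) (partnerB M b)) = 0
      rw [hvA]
      rcases ha : partnerA M a with _ | b
      · rfl
      · rw [Option.elim_some, (partnerB_eq_some hM).2 ((partnerA_eq_some hM).1 ha), hvB, add_zero]
    · change 0 + (if partnerB M b = none then some b else none).elim 0 (fun b =>
        voteB b none (partnerB M b)) = 0
      split_ifs with hb
      · rw [Option.elim_some, hb, hvB, add_zero]
      · rfl
  have hperm : ∀ σ : Equiv.Perm (Option (Fin G.nA ⊕ Fin G.nB)), (∀ p, r p (σ p)) →
      ∑ p, w p (σ p) ≤ 0 := by
    intro σ hσ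
    -- The matching of a permutation: the man of `p` gets the woman of `σ p`. Injectivity of `σ` and
    -- uniqueness of the node of a woman make it a matching.
    let N : Finset (Fin G.nA × Fin G.nB) :=
      Finset.univ.filter fun e => wm (σ (some (Sum.inl e.1))) = some e.2
    have hmem : ∀ a b, (a, b) ∈ N ↔ wm (σ (some (Sum.inl a))) = some b := by simp [N]
    have hN : G.IsMatching N := by
      refine ⟨?_, ?_⟩
      · rintro ⟨a, b⟩ he
        exact hσ _ a b ((hmn _ _).2 rfl) ((hmem a b).1 he)
      · rintro ⟨a, b⟩ he ⟨a', b'⟩ hf hef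
        rw [hmem] at he hf
        rcases hef with rfl | rfl
        · rw [he] at hf
          rw [Option.some_inj.1 hf]
        · rw [hwm] at he hf
          have := σ.injective (he.trans hf.symm)
          rw [Sum.inl.inj (Option.some_inj.1 this)]
    have hpA : ∀ a, partnerA N a = wm (σ (some (Sum.inl a))) := fun a =>
      Option.ext fun b => (partnerA_eq_some hN).trans (hmem a b)
    have hpB : ∀ b, partnerB N b = mn (σ.symm (node b)) := fun b =>
      Option.ext fun a => by
        rw [partnerB_eq_some hN, hmem, hwm, hmn, Equiv.symm_apply_eq, eq_comm]
    have hA : ∑ p, (mn p).elim 0 (fun a => voteA a (wm (σ p)) (partnerA M a)) =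
        ∑ a, voteA a (partnerA N a) (partnerA M a) := by
      simp [Fintype.sum_option, Fintype.sum_sum_type, mn, hpA]
    have hB : ∑ p, (wm (σ p)).elim 0 (fun b => voteB b (mn p) (partnerB M b)) =
        ∑ b, voteB b (partnerB N b) (partnerB M b) := by
      have h1 : ∀ p, (wm (σ p)).elim 0 (fun b => voteB b (mn p) (partnerB M b)) =
          ∑ b, if p = σ.symm (node b) then voteB b (mn p) (partnerB M b) else 0 := by
        intro p
        rcases hb : wm (σ p) with _ | b
        · refine (Finset.sum_eq_zero fun b _ => if_neg fun hp => ?_).symm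
          rw [Equiv.eq_symm_apply, ← hwm, hb] at hp
          cases hp
        · rw [Finset.sum_eq_single b, if_pos]
          · rfl
          · rw [Equiv.eq_symm_apply, ← hwm, hb]
          · refine fun c _ hc => if_neg fun hp => ?_
            rw [Equiv.eq_symm_apply, ← hwm, hb, Option.some_inj] at hp
            exact hc hp.symm
          · exact fun hb' => absurd (Finset.mem_univ b) hb'
      simp only [h1]
      rw [Finset.sum_comm]
      refine Finset.sum_congr rfl fun b _ => ?_
      rw [Finset.sum_ite_eq' Finset.univ, if_pos (Finset.mem_univ _), hpB]
    have := votes_sub hM hN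
    have := hpop N hN
    simp only [w]
    rw [Finset.sum_add_distrib, hA, hB]
    omega
  -- Normalising at the empty node gives weight `0` to unmatched vertices and the bounds `±1` for
  -- matched men, since leaving a matched vertex single costs one vote.
  obtain ⟨u, hu0, hu⟩ := Walk.exists_potential hr hw hperm none
    (fun p a b _ hb => by simp [wm] at hb) (fun p a b ha _ => by simp [mn] at ha)
  have hwn : ∀ b, wm (node b) = some b := fun b => (hwm _ b).2 rfl
  have hedge : ∀ e ∈ G.edges, voteA e.1 (some e.2) (partnerA M e.1) +
      voteB e.2 (some e.1) (partnerB M e.2) ≤ u (some (Sum.inl e.1)) - u (node e.2) := by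
    intro e he
    have := hu (some (Sum.inl e.1)) (node e.2) fun a b ha hb => by
      rw [hmn] at ha
      rw [hwn] at hb
      obtain rfl := Sum.inl.inj (Option.some_inj.1 ha)
      obtain rfl := Option.some_inj.1 hb
      exact he
    simp only [w, hwn, Option.elim_some] at this
    change voteA e.1 (some e.2) (partnerA M e.1) + voteB e.2 (some e.1) (partnerB M e.2) + _ ≤ _
      at this
    omega
  have hout : ∀ a, voteA a none (partnerA M a) ≤ u (some (Sum.inl a)) := by
    intro a
    have := hu (some (Sum.inl a)) none fun a b _ hb => by simp [wm] at hb
    rw [hu0] at this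
    change voteA a none (partnerA M a) + 0 + 0 ≤ _ at this
    omega
  have hin : ∀ b, voteB b none (partnerB M b) + u (node b) ≤ 0 := by
    intro b
    have := hu none (node b) fun a b ha _ => by simp [mn] at ha
    rw [hu0] at this
    simp only [w, hwn] at this
    change 0 + voteB b none (partnerB M b) + _ ≤ _ at this
    omega
  have hnode : ∀ e ∈ M, node e.2 = some (Sum.inl e.1) := by
    intro e he
    simp [node, (partnerB_eq_some hM).2 he]
  have hnoA : ∀ a, (∀ e ∈ M, e.1 ≠ a) → partnerA M a = none := by
    intro a ha
    rcases hp : partnerA M a with _ | b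
    · rfl
    · exact absurd rfl (ha _ ((partnerA_eq_some hM).1 hp))
  have hnoB : ∀ b, (∀ e ∈ M, e.2 ≠ b) → partnerB M b = none := by
    intro b hb
    rcases hp : partnerB M b with _ | a
    · rfl
    · exact absurd rfl (hb _ ((partnerB_eq_some hM).1 hp))
  have hunA : ∀ a, (∀ e ∈ M, e.1 ≠ a) → u (some (Sum.inl a)) = 0 := by
    intro a ha
    have h1 := hout a
    have h2 := hu none (some (Sum.inl a)) fun a b ha _ => by simp [mn] at ha
    rw [hnoA a ha, hvA] at h1
    have h3 : w none (some (Sum.inl a)) = 0 := by simp [w, mn, wm, hnoA a ha]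
    rw [h3, hu0] at h2
    omega
  refine ⟨fun a => u (some (Sum.inl a)), fun b => -u (node b), ?_, ?_, ?_, hunA, ?_, ?_, ?_⟩
  · intro e he hA hB
    have := hedge e he
    rw [(voteA_eq_one hM he).2 hA, (voteB_eq_one hM he).2 hB] at this
    omega
  · intro e he hAB
    have h0 := hedge e he
    by_cases heM : e ∈ M
    · rw [voteA_mem hM heM, voteB_mem hM heM] at h0
      omega
    · have h1 := voteA_of_not_mem hM he heM
      have h2 := voteB_of_not_mem hM he heM
      rw [← voteA_eq_one hM he, ← voteB_eq_one hM he] at hAB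
      omega
  · intro e he
    simp only [hnode e he]
    omega
  · intro b hb
    have h1 := hin b
    have hb' := hnoB b hb
    rw [hb', hvB] at h1
    have h2 := hu (node b) none fun a b _ hb => by simp [wm] at hb
    have h3 : w (node b) none = 0 := by simp [w, mn, wm, node, hb']
    rw [h3, hu0] at h2
    omega
  · intro a
    by_cases ha : ∃ e ∈ M, e.1 = a
    · obtain ⟨e, he, rfl⟩ := ha
      have := hout e.1
      rw [voteA_none_mem hM he] at this
      omega
    · push Not at ha
      rw [hunA a ha]
      norm_num
  · intro a
    by_cases ha : ∃ e ∈ M, e.1 = a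
    · obtain ⟨e, he, rfl⟩ := ha
      have := hin e.2
      rw [voteB_none_mem hM he, hnode e he] at this
      omega
    · push Not at ha
      rw [hunA a ha]
      norm_num

/-- An unstable popular matching yields a stable set of the market that is good for some edge. -/
theorem IsPopular.exists_good {I : Market} (hI : G.MarketOf I)
    {M : Finset (Fin G.nA × Fin G.nB)} (h : G.IsPopular M) (hM : ¬ G.IsStable M) :
    ∃ k < G.m, ∃ S, I.Stable S ∧ I.Good G.m k S := by
  have hb : ∃ a b, G.Blocks M a b := by
    by_contra hc
    push Not at hc
    exact hM ⟨h.1, hc⟩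
  obtain ⟨a, b, hb⟩ := hb
  obtain ⟨x, y, hxy⟩ := h.exists_isWitness
  exact ⟨G.ix (a, b), ix_lt hb.1, exists_good_of_witness hI h.1 hxy hb⟩

end MarriageInstance

/-! ### The theorem. -/

theorem mainTheorem2 :
    (∀ G : MarriageInstance,
      (∃ M, G.IsPopular M ∧ ¬ G.IsStable M) ↔ (∃ M, G.IsDominant M ∧ ¬ G.IsStable M)) ∧
    ∃ (P : RAM.Program) (C : ℕ), ∀ G : MarriageInstance,
      ∃ (t : ℕ) (σ : RAM.State), RAM.Exec P G.input t σ ∧ t ≤ C * (G.m ^ 2 + 1) ∧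
        ((σ.reg 0 = 1 ∧ ∀ M, G.IsPopular M → G.IsStable M) ∨
          (σ.reg 0 = 0 ∧ ∃ M, G.IsPopular M ∧ ¬ G.IsStable M ∧ G.Returns σ M)) := by
  refine ⟨fun G => ⟨?_, fun ⟨M, hM, hs⟩ => ⟨M, hM.1, hs⟩⟩, RAM.mainProg, 10000, fun G => ?_⟩
  · rintro ⟨M, hM, hs⟩
    -- The run serves here only to supply a market of `G`.
    obtain ⟨t, σ, -, -, I, hI, -⟩ := G.mainProg_runs
    obtain ⟨k, hk, S, hS, hg⟩ := hM.exists_good hI hs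
    exact ⟨_, MarriageInstance.stable_isDominant hI hS, MarriageInstance.good_not_stable hI hS hk hg⟩
  · obtain ⟨t, σ, he, ht, I, hI, h⟩ := G.mainProg_runs
    refine ⟨t, σ, he, ht, ?_⟩
    rcases h with ⟨h0, hno⟩ | ⟨h0, k, hk, T, hT, hg, ho⟩
    · refine Or.inl ⟨h0, fun M hM => ?_⟩
      by_contra hs
      obtain ⟨k, hk, S, hS, hg⟩ := hM.exists_good hI hs
      exact hno k hk S hS hg
    · exact Or.inr ⟨h0, _, (MarriageInstance.stable_isDominant hI hT).1, MarriageInstance.good_not_stable hI hT hk hg,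
        MarriageInstance.returns_matchingOf hI hT ho⟩
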